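/- Let $H_S\in\mathbb C^{2\times2}$ be Hermitian, $T\in(0,\infty]$, $\Delta E:=\max\sigma(H_S)-\min\sigma(H_S)$, with the conventions $e^{-H/T}:=\mathbb 1$ and $e^{-\Delta E/T}:=1$ for $T=\infty$. For a Hermitian bath Hamiltonian $H_B\in\mathbb C^{m\times m}$ and a unitary $U$ on $\mathbb C^2\otimes\mathbb C^m$ that is energy-conserving, i.e. $U(H_S\otimes\mathbb 1+\mathbb 1\otimes H_B)U^*=H_S\otimes\mathbb 1+\mathbb 1\otimes H_B$, the map $\rho\mapsto\operatorname{tr}_B\big(U(\rho\otimes e^{-H_B/T}/\operatorname{tr}(e^{-H_B/T}))U^*\big)$ is called a thermal operation; $\mathsf{TO}$ is the set of all thermal operations, over all $m\ge1$, $H_B$ and $U$. $\mathsf{EnTO}$ is the set of all completely positive trace-preserving linear maps $S$ on $\mathbb C^{2\times2}$ with $S(e^{-H_S/T})=e^{-H_S/T}$ and $S([H_S,X])=[H_S,S(X)]$ for all $X$. If $H_S=E_1|g_1\rangle\langle g_1|+E_2|g_2\rangle\langle g_2|$ is non-degenerate ($E_1<E_2$, $\{g_1,g_2\}$ an orthonormal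 basis), put $f(\lambda):=\sqrt{(1-\lambda)(1-\lambda e^{-\Delta E/T})}$. Let $D$ be the set of all linear maps on $\mathbb C^{2\times 2}$ whose Choi matrix with respect to $\{g_1,g_2\}$ is $$\begin{pmatrix}1-\lambda e^{-\Delta E/T}&0&0&re^{i\phi}\\0&\lambda e^{-\Delta E/T}&0&0\\0&0&\lambda&0\\re^{-i\phi}&0&0&1-\lambda\end{pmatrix}\qquad(*)$$ for some $\lambda\in\mathbb R$, $r\ge0$, $\phi\in[-\pi,\pi)$, and let $\Psi_T:D\to\mathbb R\times\mathbb C$, $\Psi_T(S):=(\langle g_1,S(|g_2\rangle\langle g_2|)g_1\rangle,\langle g_1,S(|g_1\rangle\langle g_2|)g_2\rangle)=(\lambda,re^{i\phi})$. "Relative" interior and boundary are meant relative to $D$. Then the following hold. (i) $\overline{\mathsf{TO}}=\mathsf{EnTO}$. For (ii)-(iv) assume that $H_S$ is non-degenerate. Then a linear map $S$ is in $\mathsf{EnTO}$ if and only if its Choi matrix is $(*)$ for some $\lambda\in[0,1]$, $r\in[0,f(\lambda)]$, $\phi\in[-\pi,\pi)$; $\Psi_T$ is injective on $D$ and maps $\mathsf{EnTO}$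 bijectively onto $\{(\lambda,c):\lambda\in[0,1],|c|\le f(\lambda)\}$. (ii) $\mathsf{TO}$ is convex, and $\mathsf{TO}=\mathsf{EnTO}\setminus\Psi_T^{-1}(\{(\lambda,f(\lambda)e^{i\phi}):\lambda\in(0,1],\phi\in[-\pi,\pi)\})$. In other words, an element of $\mathsf{EnTO}$ is in $\mathsf{TO}$ if and only if it has $\lambda=0$ or lies in the relative interior of $\mathsf{EnTO}$; in particular $\mathsf{EnTO}\setminus\mathsf{TO}$ is contained in the relative boundary of $\mathsf{EnTO}$. (iii) The semigroup (under composition) generated by the thermal operations with bath Hamiltonians $\operatorname{diag}(0,\Delta E,\ldots,m\Delta E)$, $m\in\mathbb N_0$, equals $\mathsf{TO}$ if and only if $T>\Delta E/\ln2$. The difference of the two sets is always contained in $\Psi_T^{-1}(\{(\lambda,0):\lambda\in[0,1]\})$, and the two sets have the same closure. (iv) Every element of $\mathsf{EnTO}$ can be realized by a thermal operation with a single-mode bosonic bath $H_B=\operatorname{diag}(j\Delta E)_{j=0}^\infty$ on $\ell^2(\mathbb N_0)$ if and only if $T\ge\Delta E/\ln2$. If $T<\Delta E/\ln 2$, then the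 image under $\Psi_T$ of the set of elements of $\mathsf{EnTO}$ that cannot be realized in this way has strictly positive Lebesgue measure in $\mathbb R\times\mathbb C$, and there are $\lambda_0,r_0>0$ such that every map with $\Psi_T(S)=(\lambda,c)$ realized in this way with $\lambda\le\lambda_0$ has $|c|\ge r_0$. (Here $U$ is any energy-conserving unitary on $\mathbb C^2\otimes\ell^2(\mathbb N_0)$. For $T=\infty$, where $H_B$ has no Gibbs state, $S$ counts as realized by $U$ if $S=\lim_{N\to\infty}\operatorname{tr}_B(U((\cdot)\otimes\omega_N)U^*)$, where $\omega_N$ is the maximally mixed state on the lowest $N+1$ levels.) -/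

import Mathlib

open scoped ENNReal Kronecker ComplexConjugate ComplexOrder

noncomputable section

namespace ThermalOps

/-- Linear maps on `ℂ^{n×n}`, with the usual (operator norm) topology; since `ℂ^{n×n}` is
finite-dimensional every linear map is continuous. Multiplication is composition. -/
abbrev Superop (n : Type*) := Matrix n n ℂ →L[ℂ] Matrix n n ℂ

/-- The inverse temperature `1/T` of `T ∈ (0,∞]`; it is `0` for `T = ∞`. -/
def invTemp (T : ℝ≥0∞) : ℝ := (T⁻¹).toReal

section General

variable {n : Type*} [Fintype n] [DecidableEq n]

/-- `e^{-H/T}`, which is the identity matrix for `T = ∞`. -/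
def boltzmann (H : Matrix n n ℂ) (T : ℝ≥0∞) : Matrix n n ℂ :=
  NormedSpace.exp (-(((invTemp T : ℝ) : ℂ) • H))

/-- The Gibbs state `e^{-H/T} / tr(e^{-H/T})`, which is maximally mixed for `T = ∞`. -/
def gibbs (H : Matrix n n ℂ) (T : ℝ≥0∞) : Matrix n n ℂ :=
  (boltzmann H T).trace⁻¹ • boltzmann H T

/-- Partial trace over the second tensor factor. -/
def partialTrace {m : ℕ} (X : Matrix (n × Fin m) (n × Fin m) ℂ) : Matrix n n ℂ :=
  Matrix.of fun i k => ∑ a, X (i, a) (k, a)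

/-- `H_S ⊗ 1_B + 1 ⊗ H_B`. -/
def totalHamiltonian {m : ℕ} (HS : Matrix n n ℂ) (HB : Matrix (Fin m) (Fin m) ℂ) :
    Matrix (n × Fin m) (n × Fin m) ℂ :=
  HS ⊗ₖ (1 : Matrix (Fin m) (Fin m) ℂ) + (1 : Matrix n n ℂ) ⊗ₖ HB

/-- `U` is a unitary with `U (H_S ⊗ 1 + 1 ⊗ H_B) U* = H_S ⊗ 1 + 1 ⊗ H_B`. -/
def EnergyConserving {m : ℕ} (HS : Matrix n n ℂ) (HB : Matrix (Fin m) (Fin m) ℂ)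
    (U : Matrix (n × Fin m) (n × Fin m) ℂ) : Prop :=
  U ∈ Matrix.unitaryGroup (n × Fin m) ℂ ∧
    U * totalHamiltonian HS HB * U.conjTranspose = totalHamiltonian HS HB

/-- `ρ ↦ tr_B(U (ρ ⊗ ω) U*)`. -/
def dilation {m : ℕ} (ω : Matrix (Fin m) (Fin m) ℂ)
    (U : Matrix (n × Fin m) (n × Fin m) ℂ) : Superop n :=
  LinearMap.toContinuousLinearMap
    { toFun := fun ρ => partialTrace (U * (ρ ⊗ₖ ω) * U.conjTranspose)
      map_add' := by
        intro ρ σ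
        ext i k
        simp [partialTrace, Matrix.add_kronecker, Matrix.mul_add, Matrix.add_mul,
          Finset.sum_add_distrib]
      map_smul' := by
        intro c ρ
        ext i k
        simp [partialTrace, Matrix.smul_kronecker, Finset.mul_sum] }

/-- `Φ_{T,m}(H_B, U) = tr_B(U((·) ⊗ e^{-H_B/T}/tr(e^{-H_B/T}))U*)`. -/
def thermalMap {m : ℕ} (T : ℝ≥0∞) (HB : Matrix (Fin m) (Fin m) ℂ)
    (U : Matrix (n × Fin m) (n × Fin m) ℂ) : Superop n :=
  dilation (gibbs HB T) U

/-- The thermal operations with respect to `H_S` and `T`. -/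
def TO (HS : Matrix n n ℂ) (T : ℝ≥0∞) : Set (Superop n) :=
  {S | ∃ m : ℕ, 0 < m ∧ ∃ HB : Matrix (Fin m) (Fin m) ℂ, HB.IsHermitian ∧
    ∃ U : Matrix (n × Fin m) (n × Fin m) ℂ,
      EnergyConserving HS HB U ∧ S = thermalMap T HB U}

/-- The map `S ⊗ id_k` on `ℂ^{n×n} ⊗ ℂ^{k×k}`. -/
def ampliation (S : Superop n) (k : ℕ) (X : Matrix (n × Fin k) (n × Fin k) ℂ) :
    Matrix (n × Fin k) (n × Fin k) ℂ :=
  Matrix.of fun p q => S (Matrix.of fun i j => X (i, p.2) (j, q.2)) p.1 q.1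

/-- Completely positive and trace preserving maps. -/
def IsCPTP (S : Superop n) : Prop :=
  (∀ (k : ℕ) (X : Matrix (n × Fin k) (n × Fin k) ℂ),
    X.PosSemidef → (ampliation S k X).PosSemidef) ∧
  ∀ X : Matrix n n ℂ, (S X).trace = X.trace

/-- Enhanced thermal operations: channels that fix `e^{-H_S/T}` and commute with
`ad_{H_S} = [H_S, ·]`. -/
def EnTO (HS : Matrix n n ℂ) (T : ℝ≥0∞) : Set (Superop n) :=
  {S | IsCPTP S ∧ S (boltzmann HS T) = boltzmann HS T ∧
    ∀ X : Matrix n n ℂ, S (HS * X - X * HS) = HS * S X - S X * HS}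

/-- `ΔE = max σ(H) - min σ(H)`. -/
def energyGap (H : Matrix n n ℂ) : ℝ := sSup (spectrum ℝ H) - sInf (spectrum ℝ H)

/-- `H` (Hermitian) has as many different eigenvalues as its size. -/
def NonDegenerate (H : Matrix n n ℂ) : Prop := (spectrum ℝ H).ncard = Fintype.card n

/-- `diag(0, ΔE, …, m ΔE)`. -/
def truncatedBath (ΔE : ℝ) (m : ℕ) : Matrix (Fin (m + 1)) (Fin (m + 1)) ℂ :=
  Matrix.diagonal fun j => (((j : ℕ) * ΔE : ℝ) : ℂ)

/-- The thermal operations whose bath Hamiltonian is `diag(0, ΔE, …, m ΔE)` for some `m`, where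
`ΔE` is the energy gap of the system. -/
def truncatedTO (HS : Matrix n n ℂ) (T : ℝ≥0∞) : Set (Superop n) :=
  {S | ∃ (m : ℕ) (U : Matrix (n × Fin (m + 1)) (n × Fin (m + 1)) ℂ),
    EnergyConserving HS (truncatedBath (energyGap HS) m) U ∧
      S = thermalMap T (truncatedBath (energyGap HS) m) U}

/-- The semigroup (under composition) generated by `truncatedTO`. -/
def truncatedSemigroup (HS : Matrix n n ℂ) (T : ℝ≥0∞) : Set (Superop n) :=
  (Subsemigroup.closure (truncatedTO HS T) : Set (Superop n))

/-- The Hilbert space `ℂ^n ⊗ ℓ²(ℕ)` of the system and a single bosonic mode. The basis vector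
`(i, j)` is `e_i ⊗ |j⟩`. -/
abbrev ModeSpace (n : Type*) := lp (fun _ : n × ℕ => ℂ) 2

/-- `(ψ, χ)` is in the graph of the (unbounded, self-adjoint) operator `H_S ⊗ 1 + 1 ⊗ H_B` on its
natural domain, where `H_B = diag(j ΔE)_{j ≥ 0}`. -/
def InTotalGraph (HS : Matrix n n ℂ) (ΔE : ℝ) (ψ χ : ModeSpace n) : Prop :=
  ∀ (i : n) (j : ℕ), χ (i, j) = (∑ k, HS i k * ψ (k, j)) + (((j : ℝ) * ΔE : ℝ) : ℂ) * ψ (i, j)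

/-- The unitary `U` satisfies `U (H_S ⊗ 1 + 1 ⊗ H_B) U* = H_S ⊗ 1 + 1 ⊗ H_B` as an identity of
unbounded operators (domains included), where `H_B = diag(j ΔE)_{j ≥ 0}`. -/
def ModeEnergyConserving (HS : Matrix n n ℂ) (ΔE : ℝ)
    (U : ModeSpace n ≃ₗᵢ[ℂ] ModeSpace n) : Prop :=
  ∀ ψ χ : ModeSpace n, InTotalGraph HS ΔE ψ χ ↔ InTotalGraph HS ΔE (U ψ) (U χ)

/-- The block `⟨a|_B U |j⟩_B` of `U`, an operator on the system. -/
def modeBlock (U : ModeSpace n ≃ₗᵢ[ℂ] ModeSpace n) (a j : ℕ) : Matrix n n ℂ :=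
  Matrix.of fun i k => U (lp.single 2 (k, j) 1) (i, a)

/-- `S = tr_B(U ((·) ⊗ ω) U*)` for the diagonal mode state `ω = ∑ j, p j |j⟩⟨j|`: written in the
basis `|j⟩`, this is `S ρ = ∑ a j, p j ⟨a|U|j⟩ ρ ⟨a|U|j⟩*`. -/
def IsModeDilation (U : ModeSpace n ≃ₗᵢ[ℂ] ModeSpace n) (p : ℕ → ℝ) (S : Superop n) : Prop :=
  ∀ ρ : Matrix n n ℂ,
    HasSum (fun x : ℕ × ℕ =>
      ((p x.2 : ℝ) : ℂ) • (modeBlock U x.1 x.2 * ρ * (modeBlock U x.1 x.2).conjTranspose)) (S ρ)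

/-- The weights `e^{-j ΔE/T} / ∑ k, e^{-k ΔE/T}` of the Gibbs state of `diag(j ΔE)_{j ≥ 0}`, for
`T < ∞` and `ΔE > 0`. -/
def modeGibbs (ΔE : ℝ) (T : ℝ≥0∞) (j : ℕ) : ℝ :=
  Real.exp (-(invTemp T * (j * ΔE))) / ∑' k : ℕ, Real.exp (-(invTemp T * (k * ΔE)))

/-- The weights of the maximally mixed state on the lowest `N + 1` levels of the mode. -/
def modeUniform (N j : ℕ) : ℝ := if j ≤ N then 1 / ((N : ℝ) + 1) else 0

/-- The maps realized by a thermal operation with the single-mode bosonic bath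
`H_B = diag(j ΔE)_{j ≥ 0}`, where `ΔE` is the energy gap of the system. For `T < ∞` the bath is in
its Gibbs state. For `T = ∞` there is no Gibbs state; one then takes, for a fixed
energy-conserving unitary, the limit over the maximally mixed states of the lowest levels. -/
def bosonicTO (HS : Matrix n n ℂ) (T : ℝ≥0∞) : Set (Superop n) :=
  {S | ∃ U : ModeSpace n ≃ₗᵢ[ℂ] ModeSpace n, ModeEnergyConserving HS (energyGap HS) U ∧
    ((T < ⊤ ∧ IsModeDilation U (modeGibbs (energyGap HS) T) S) ∨
     (T = ⊤ ∧ ∃ R : ℕ → Superop n, (∀ N, IsModeDilation U (modeUniform N) (R N)) ∧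
        Filter.Tendsto R Filter.atTop (nhds S)))}

end General

section Qubit

/-- An orthonormal basis of `ℂ²`. -/
abbrev QubitBasis := OrthonormalBasis (Fin 2) ℂ (EuclideanSpace ℂ (Fin 2))

/-- `g` is an eigenbasis of `H` with `H = E₁|g₁⟩⟨g₁| + E₂|g₂⟩⟨g₂|` and `E₁ < E₂`
(`g₁` is `g 0` and `g₂` is `g 1`). -/
def IsOrderedEigenbasis (H : Matrix (Fin 2) (Fin 2) ℂ) (g : QubitBasis) : Prop :=
  ∃ E₁ E₂ : ℝ, E₁ < E₂ ∧
    H.mulVec (g 0).ofLp = (E₁ : ℂ) • (g 0).ofLp ∧ H.mulVec (g 1).ofLp = (E₂ : ℂ) • (g 1).ofLp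

/-- `|g_j⟩⟨g_k|`. -/
def ketBra (g : QubitBasis) (j k : Fin 2) : Matrix (Fin 2) (Fin 2) ℂ :=
  Matrix.vecMulVec (g j).ofLp (star (g k).ofLp)

/-- `⟨g_a, A g_b⟩`. -/
def matrixElement (g : QubitBasis) (A : Matrix (Fin 2) (Fin 2) ℂ) (a b : Fin 2) : ℂ :=
  star (g a).ofLp ⬝ᵥ A.mulVec (g b).ofLp

/-- The Choi matrix `∑ j k, |j⟩⟨k| ⊗ S(|g_j⟩⟨g_k|)` of `S` with respect to `g`; the index pairs
are ordered as `(1,1), (1,2), (2,1), (2,2)`. -/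
def choi (g : QubitBasis) (S : Superop (Fin 2)) : Matrix (Fin 4) (Fin 4) ℂ :=
  (Matrix.of fun p q : Fin 2 × Fin 2 => matrixElement g (S (ketBra g p.1 q.1)) p.2 q.2).submatrix
    (finProdFinEquiv (m := 2) (n := 2)).symm (finProdFinEquiv (m := 2) (n := 2)).symm

/-- `e^{-ΔE/T}`, which is `1` for `T = ∞`. -/
def boltzmannFactor (H : Matrix (Fin 2) (Fin 2) ℂ) (T : ℝ≥0∞) : ℝ :=
  Real.exp (-(invTemp T * energyGap H))

/-- The Choi matrix with parameters `λ = l` and `c = r e^{iφ}`. -/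
def canonicalChoi (H : Matrix (Fin 2) (Fin 2) ℂ) (T : ℝ≥0∞) (l : ℝ) (c : ℂ) :
    Matrix (Fin 4) (Fin 4) ℂ :=
  !![((1 - l * boltzmannFactor H T : ℝ) : ℂ), 0, 0, c;
     0, ((l * boltzmannFactor H T : ℝ) : ℂ), 0, 0;
     0, 0, ((l : ℝ) : ℂ), 0;
     conj c, 0, 0, ((1 - l : ℝ) : ℂ)]

/-- `r e^{iφ}`. -/
def polar (r φ : ℝ) : ℂ := (r : ℂ) * Complex.exp (φ * Complex.I)

/-- The largest possible `r` for given `λ = l`, namely `√((1-λ)(1-λ e^{-ΔE/T}))`. -/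
def maxRadius (H : Matrix (Fin 2) (Fin 2) ℂ) (T : ℝ≥0∞) (l : ℝ) : ℝ :=
  Real.sqrt ((1 - l) * (1 - l * boltzmannFactor H T))

/-- `Ψ_T(S) = (⟨g₁, S(|g₂⟩⟨g₂|) g₁⟩, ⟨g₁, S(|g₁⟩⟨g₂|) g₂⟩) ∈ ℝ × ℂ`. It is only used on maps with
a canonical Choi matrix, where the first entry is real. -/
def Psi (g : QubitBasis) (S : Superop (Fin 2)) : ℝ × ℂ :=
  ((matrixElement g (S (ketBra g 1 1)) 0 0).re, matrixElement g (S (ketBra g 0 1)) 0 1)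

/-- The domain of `Ψ_T`: all maps whose Choi matrix is canonical for some `λ ∈ ℝ`, `r ≥ 0`,
`φ ∈ [-π,π)`. -/
def PsiDomain (H : Matrix (Fin 2) (Fin 2) ℂ) (T : ℝ≥0∞) (g : QubitBasis) :
    Set (Superop (Fin 2)) :=
  {S | ∃ l r φ : ℝ, 0 ≤ r ∧ φ ∈ Set.Ico (-Real.pi) Real.pi ∧
    choi g S = canonicalChoi H T l (polar r φ)}

/-- `Ψ_T⁻¹(X)`. -/
def PsiPreimage (H : Matrix (Fin 2) (Fin 2) ℂ) (T : ℝ≥0∞) (g : QubitBasis) (X : Set (ℝ × ℂ)) :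
    Set (Superop (Fin 2)) :=
  {S | S ∈ PsiDomain H T g ∧ Psi g S ∈ X}

/-- The interior of `A` relative to `D`. -/
def relInterior {α : Type*} [TopologicalSpace α] (D A : Set α) : Set α :=
  Subtype.val '' interior (Subtype.val ⁻¹' A : Set D)

/-- The boundary of `A` relative to `D`. -/
def relFrontier {α : Type*} [TopologicalSpace α] (D A : Set α) : Set α :=
  Subtype.val '' frontier (Subtype.val ⁻¹' A : Set D)

end Qubit

end ThermalOps

end

open ThermalOps

/-! Let q = e^{-ΔE/T}. For non-degenerate `H_S` everything is reduced to the two parameters (λ, c).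
Covariance removes all matrix elements that change a Bohr frequency, and trace preservation, the
Gibbs state and positivity leave |c|² ≤ (1-λ)(1-λq) (`EnTO.exists_canonical`). Inclusions,
convexity, closures and products then become statements about regions in ℝ × ℂ.

For a thermal operation, λ and c are Hilbert–Schmidt products of blocks of `U` weighted by the bath
state, and |c| ≤ f(λ) is Cauchy–Schwarz. Equality makes the two diagonal blocks of `U` proportional.
Unitarity then gives BB* and B*B the same mean bath energy, where B is the block that sends g₂ to
g₁. But B raises the bath energy by ΔE, so B = 0 and λ = 0 (`thermalMap_strict`).

Conversely, on a ladder bath with spacing ΔE an energy-conserving unitary can be built from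
rotations of the planes spanned by (g₁, j+1) and (g₂, j). With moduli σ_j, phases z_j and bath
weights p_j it has λ = Σ p_j (1 - σ_{j+1}²) and c = Σ p_j σ_j σ_{j+1} z_j. On the infinite ladder
geometric moduli σ_j = k^j give c = f(λ), so finite truncations reach every point strictly below f
(`exists_profile`). Smaller |c| comes from averaging two phases, which degenerate bath levels do for
free (`average_mem_TO`). This determines TO (`mem_TO_iff`). Shrinking the parameters towards (0, 0)
shows that its closure is EnTO.

If `H_S` is scalar, EnTO consists of the unital channels. In the basis of quaternion units their
Choi matrices are real, so they have Kraus operators that are real quaternions, that is, multiples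
of unitaries (`exists_real_kraus`). Mixtures of unitary conjugations are limits of uniform averages.

For the truncated baths the degeneracy is missing and only products are available. They give every c
≠ 0. The value c = 0 requires phases with Σ q^j z_j = 0 over a finite range, a closed polygon. It
exists for q > 1/2 (`exists_phases_sum_eq_zero`) and not for q ≤ 1/2, where the first side is longer
than all others together.

For the bosonic mode the polygon is infinite and closes at q = 1/2 as well. A path of moduli and
phases with constant λ joins |c| = f(λ) to c = 0, so all intermediate |c| occur (`exists_ladder`).
For q < 1/2 the two lowest energy levels alone give |c| + λ ≥ 1 - 2q
(`one_sub_two_mul_le_of_mem_bosonicTO`), which excludes an open set near (0, 0). -/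

namespace ThermalOps

/-! ### Matrix elements, Choi matrices and canonical maps in an orthonormal basis -/

section Basis

variable (g : QubitBasis)

/-- The unitary whose columns are the basis vectors. -/
noncomputable def basisMatrix : Matrix (Fin 2) (Fin 2) ℂ := Matrix.of fun i a => (g a).ofLp i

theorem basisMatrix_star_mul : (basisMatrix g).conjTranspose * basisMatrix g = 1 := by
  ext a b
  have h := orthonormal_iff_ite.mp g.orthonormal a b
  rw [PiLp.inner_apply] at h
  simp only [Matrix.mul_apply, Matrix.conjTranspose_apply, basisMatrix, Matrix.of_apply,
    Matrix.one_apply]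
  rw [← h]
  refine Finset.sum_congr rfl fun i _ => ?_
  simp [mul_comm]

theorem basisMatrix_mul_star : basisMatrix g * (basisMatrix g).conjTranspose = 1 :=
  mul_eq_one_comm.mp (basisMatrix_star_mul g)

theorem matrixElement_eq (A : Matrix (Fin 2) (Fin 2) ℂ) (a b : Fin 2) :
    matrixElement g A a b = ((basisMatrix g).conjTranspose * A * basisMatrix g) a b := by
  rw [Matrix.mul_assoc]
  simp only [matrixElement, Matrix.mul_apply, dotProduct, Matrix.mulVec, basisMatrix,
    Matrix.conjTranspose_apply, Matrix.of_apply, Pi.star_apply]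

theorem ketBra_eq (j k : Fin 2) :
    ketBra g j k = basisMatrix g * Matrix.single j k 1 * (basisMatrix g).conjTranspose := by
  ext a b
  rw [Matrix.mul_assoc]
  simp only [ketBra, Matrix.vecMulVec_apply, Matrix.mul_apply, basisMatrix,
    Matrix.conjTranspose_apply, Matrix.of_apply, Pi.star_apply, Matrix.single_apply]
  simp [ite_and]

theorem matrixElement_add (A B : Matrix (Fin 2) (Fin 2) ℂ) (a b : Fin 2) :
    matrixElement g (A + B) a b = matrixElement g A a b + matrixElement g B a b := by
  simp [matrixElement_eq, Matrix.mul_add, Matrix.add_mul]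

theorem matrixElement_smul (r : ℂ) (A : Matrix (Fin 2) (Fin 2) ℂ) (a b : Fin 2) :
    matrixElement g (r • A) a b = r * matrixElement g A a b := by
  simp [matrixElement_eq]

theorem matrixElement_ketBra (j k a b : Fin 2) :
    matrixElement g (ketBra g j k) a b = if a = j ∧ b = k then 1 else 0 := by
  rw [matrixElement_eq, ketBra_eq]
  have : (basisMatrix g).conjTranspose * (basisMatrix g * Matrix.single j k 1 *
      (basisMatrix g).conjTranspose) * basisMatrix g =
      ((basisMatrix g).conjTranspose * basisMatrix g) * Matrix.single j k 1 *
      ((basisMatrix g).conjTranspose * basisMatrix g) := by simp only [Matrix.mul_assoc]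
  rw [this, basisMatrix_star_mul]
  simp [Matrix.single_apply, eq_comm]

theorem eq_basisMatrix_mul (A : Matrix (Fin 2) (Fin 2) ℂ) :
    A = basisMatrix g * ((basisMatrix g).conjTranspose * A * basisMatrix g) *
      (basisMatrix g).conjTranspose := by
  have : basisMatrix g * ((basisMatrix g).conjTranspose * A * basisMatrix g) *
      (basisMatrix g).conjTranspose = (basisMatrix g * (basisMatrix g).conjTranspose) * A *
      (basisMatrix g * (basisMatrix g).conjTranspose) := by simp only [Matrix.mul_assoc]
  rw [this, basisMatrix_mul_star]
  simp

theorem matrixElement_ext {A B : Matrix (Fin 2) (Fin 2) ℂ}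
    (h : ∀ a b, matrixElement g A a b = matrixElement g B a b) : A = B := by
  rw [eq_basisMatrix_mul g A, eq_basisMatrix_mul g B]
  congr 2
  ext a b
  rw [← matrixElement_eq, ← matrixElement_eq, h]

theorem matrixElement_mul (A B : Matrix (Fin 2) (Fin 2) ℂ) (a b : Fin 2) :
    matrixElement g (A * B) a b = ∑ i, matrixElement g A a i * matrixElement g B i b := by
  have : (basisMatrix g).conjTranspose * (A * B) * basisMatrix g =
      ((basisMatrix g).conjTranspose * A * basisMatrix g) *
      ((basisMatrix g).conjTranspose * B * basisMatrix g) := by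
    rw [show ((basisMatrix g).conjTranspose * A * basisMatrix g) *
      ((basisMatrix g).conjTranspose * B * basisMatrix g) = (basisMatrix g).conjTranspose * A *
      (basisMatrix g * (basisMatrix g).conjTranspose) * B * basisMatrix g by
        simp only [Matrix.mul_assoc], basisMatrix_mul_star]
    simp [Matrix.mul_assoc]
  simp only [matrixElement_eq, this]
  rw [Matrix.mul_apply]

theorem matrixElement_conjTranspose (A : Matrix (Fin 2) (Fin 2) ℂ) (a b : Fin 2) :
    matrixElement g A.conjTranspose a b = conj (matrixElement g A b a) := by
  rw [matrixElement_eq, matrixElement_eq]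
  have : (basisMatrix g).conjTranspose * A.conjTranspose * basisMatrix g =
    ((basisMatrix g).conjTranspose * A * basisMatrix g).conjTranspose := by
    simp [Matrix.mul_assoc]
  rw [this, Matrix.conjTranspose_apply]
  rfl

theorem trace_eq_matrixElement (A : Matrix (Fin 2) (Fin 2) ℂ) :
    A.trace = matrixElement g A 0 0 + matrixElement g A 1 1 := by
  rw [matrixElement_eq, matrixElement_eq, ← Matrix.trace_fin_two, Matrix.trace_mul_comm,
    ← Matrix.mul_assoc, basisMatrix_mul_star, Matrix.one_mul]

/-- `⟨g_a, · g_b⟩` as a linear functional. -/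
noncomputable def matrixElementₗ (a b : Fin 2) : Matrix (Fin 2) (Fin 2) ℂ →ₗ[ℂ] ℂ where
  toFun A := matrixElement g A a b
  map_add' A B := matrixElement_add g A B a b
  map_smul' r A := matrixElement_smul g r A a b

theorem continuous_matrixElement (a b : Fin 2) :
    Continuous fun A => matrixElement g A a b :=
  (matrixElementₗ g a b).continuous_of_finiteDimensional

theorem sum_ketBra (A : Matrix (Fin 2) (Fin 2) ℂ) :
    A = ∑ j, ∑ k, matrixElement g A j k • ketBra g j k := by
  refine matrixElement_ext g fun a b => ?_
  simp only [Fin.sum_univ_two, matrixElement_add, matrixElement_smul, matrixElement_ketBra]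
  fin_cases a <;> fin_cases b <;> simp

theorem superop_ext {S R : Superop (Fin 2)}
    (h : ∀ j k a b, matrixElement g (S (ketBra g j k)) a b =
      matrixElement g (R (ketBra g j k)) a b) : S = R := by
  ext1 A
  rw [sum_ketBra g A]
  simp only [map_sum, map_smul]
  exact Finset.sum_congr rfl fun j _ => Finset.sum_congr rfl fun k _ => by
    rw [matrixElement_ext g (h j k)]

/-- The superoperator `ρ ↦ ⟨g_j, ρ g_k⟩ |g_a⟩⟨g_b|`. -/
noncomputable def elementary (j k a b : Fin 2) : Superop (Fin 2) :=
  LinearMap.toContinuousLinearMap ((matrixElementₗ g j k).smulRight (ketBra g a b))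

theorem elementary_apply (j k a b : Fin 2) (A : Matrix (Fin 2) (Fin 2) ℂ) :
    elementary g j k a b A = matrixElement g A j k • ketBra g a b := rfl

/-- The covariant, trace preserving map with transition probabilities `x` (from `g₂` to `g₁`) and
`y` (from `g₁` to `g₂`), multiplying the coherence `|g₁⟩⟨g₂|` by `c`. -/
noncomputable def covMap (x y c : ℂ) : Superop (Fin 2) :=
  (1 - y) • elementary g 0 0 0 0 + y • elementary g 0 0 1 1 + x • elementary g 1 1 0 0 +
    (1 - x) • elementary g 1 1 1 1 + c • elementary g 0 1 0 1 + conj c • elementary g 1 0 1 0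

theorem covMap_apply (x y c : ℂ) (A : Matrix (Fin 2) (Fin 2) ℂ) :
    covMap g x y c A =
      ((1 - y) * matrixElement g A 0 0 + x * matrixElement g A 1 1) • ketBra g 0 0 +
      (y * matrixElement g A 0 0 + (1 - x) * matrixElement g A 1 1) • ketBra g 1 1 +
      (c * matrixElement g A 0 1) • ketBra g 0 1 +
      (conj c * matrixElement g A 1 0) • ketBra g 1 0 := by
  simp only [covMap, add_apply, FunLike.coe_smul,
    Pi.smul_apply, elementary_apply, smul_smul, add_smul]
  abel

theorem matrixElement_covMap (x y c : ℂ) (A : Matrix (Fin 2) (Fin 2) ℂ) (a b : Fin 2) :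
    matrixElement g (covMap g x y c A) a b =
      !![(1 - y) * matrixElement g A 0 0 + x * matrixElement g A 1 1, c * matrixElement g A 0 1;
        conj c * matrixElement g A 1 0,
        y * matrixElement g A 0 0 + (1 - x) * matrixElement g A 1 1] a b := by
  simp only [covMap_apply, matrixElement_add, matrixElement_smul, matrixElement_ketBra]
  fin_cases a <;> fin_cases b <;> simp

theorem continuous_covMap : Continuous fun p : ℂ × ℂ × ℂ => covMap g p.1 p.2.1 p.2.2 := by
  unfold covMap
  fun_prop

theorem continuous_Psi : Continuous (Psi g) := by
  unfold Psi
  refine Continuous.prodMk ?_ ?_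
  · exact Complex.continuous_re.comp ((continuous_matrixElement g 0 0).comp
      (ContinuousEvalConst.continuous_eval_const _))
  · exact (continuous_matrixElement g 0 1).comp
      (ContinuousEvalConst.continuous_eval_const _)

theorem choi_apply (S : Superop (Fin 2)) (p q : Fin 2 × Fin 2) :
    choi g S (finProdFinEquiv p) (finProdFinEquiv q) =
      matrixElement g (S (ketBra g p.1 q.1)) p.2 q.2 := by
  simp [choi]

theorem choi_injective : Function.Injective (choi g) := by
  intro S R h
  refine superop_ext g fun j k a b => ?_
  rw [← choi_apply g S (j, a) (k, b), ← choi_apply g R (j, a) (k, b), h]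

/-- The map with canonical Choi matrix. -/
noncomputable def canonicalMap (q l : ℝ) (c : ℂ) : Superop (Fin 2) :=
  covMap g (l : ℂ) ((l * q : ℝ) : ℂ) c

theorem choi_canonicalMap (H : Matrix (Fin 2) (Fin 2) ℂ) (T : ℝ≥0∞) (l : ℝ) (c : ℂ) :
    choi g (canonicalMap g (boltzmannFactor H T) l c) = canonicalChoi H T l c := by
  ext i j
  obtain ⟨p, rfl⟩ := (finProdFinEquiv (m := 2) (n := 2)).surjective i
  obtain ⟨q, rfl⟩ := (finProdFinEquiv (m := 2) (n := 2)).surjective j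
  rw [choi_apply, canonicalMap, matrixElement_covMap]
  simp only [matrixElement_ketBra]
  obtain ⟨p1, p2⟩ := p
  obtain ⟨q1, q2⟩ := q
  have h0 : (finProdFinEquiv ((0, 0) : Fin 2 × Fin 2)) = (0 : Fin 4) := rfl
  have h1 : (finProdFinEquiv ((0, 1) : Fin 2 × Fin 2)) = (1 : Fin 4) := rfl
  have h2 : (finProdFinEquiv ((1, 0) : Fin 2 × Fin 2)) = (2 : Fin 4) := rfl
  have h3 : (finProdFinEquiv ((1, 1) : Fin 2 × Fin 2)) = (3 : Fin 4) := rfl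
  fin_cases p1 <;> fin_cases p2 <;> fin_cases q1 <;> fin_cases q2 <;>
    simp [h0, h1, h2, h3, canonicalChoi]

theorem choi_eq_canonicalChoi_iff (H : Matrix (Fin 2) (Fin 2) ℂ) (T : ℝ≥0∞) (S : Superop (Fin 2))
    (l : ℝ) (c : ℂ) :
    choi g S = canonicalChoi H T l c ↔ S = canonicalMap g (boltzmannFactor H T) l c := by
  rw [← choi_canonicalMap g]
  exact (choi_injective g).eq_iff

theorem Psi_canonicalMap (q l : ℝ) (c : ℂ) : Psi g (canonicalMap g q l c) = (l, c) := by
  simp [Psi, canonicalMap, matrixElement_covMap, matrixElement_ketBra]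

theorem continuous_canonicalMap (q : ℝ) :
    Continuous fun p : ℝ × ℂ => canonicalMap g q p.1 p.2 :=
  (continuous_covMap g).comp (f := fun p : ℝ × ℂ => (((p.1 : ℝ) : ℂ), ((p.1 * q : ℝ) : ℂ), p.2))
    (by fun_prop)

theorem exists_polar (c : ℂ) : ∃ φ ∈ Set.Ico (-Real.pi) Real.pi, polar ‖c‖ φ = c := by
  by_cases h : c.arg = Real.pi
  -- `Complex.arg` takes values in (-π, π], so the endpoint π is replaced by -π.
  · refine ⟨-Real.pi, ⟨le_rfl, by linarith [Real.pi_pos]⟩, ?_⟩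
    have := Complex.norm_mul_exp_arg_mul_I c
    rw [h] at this
    rw [← this]
    simp [polar, Complex.exp_neg]
  · exact ⟨c.arg, ⟨(Complex.neg_pi_lt_arg c).le, lt_of_le_of_ne (Complex.arg_le_pi c) h⟩,
      Complex.norm_mul_exp_arg_mul_I c⟩

theorem norm_polar {r : ℝ} (hr : 0 ≤ r) (φ : ℝ) : ‖polar r φ‖ = r := by
  simp [polar, Complex.norm_exp_ofReal_mul_I, abs_of_nonneg hr]

/-- Polar coordinates impose no restriction on c, so later arguments can use a complex parameter
instead of r and φ. -/
theorem mem_PsiDomain_iff (H : Matrix (Fin 2) (Fin 2) ℂ) (T : ℝ≥0∞) (S : Superop (Fin 2)) :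
    S ∈ PsiDomain H T g ↔
      ∃ (l : ℝ) (c : ℂ), S = canonicalMap g (boltzmannFactor H T) l c := by
  constructor
  · rintro ⟨l, r, φ, -, -, h⟩
    exact ⟨l, _, (choi_eq_canonicalChoi_iff g H T S l _).mp h⟩
  · rintro ⟨l, c, h⟩
    obtain ⟨φ, hφ, hc⟩ := exists_polar c
    exact ⟨l, ‖c‖, φ, norm_nonneg c, hφ, by
      rw [hc]; exact (choi_eq_canonicalChoi_iff g H T S l c).mpr h⟩

end Basis

/-! ### Spectrum, energy gap and ordered eigenbasis of the system Hamiltonian -/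

section Eigenbasis

variable {H : Matrix (Fin 2) (Fin 2) ℂ} {g : QubitBasis}

theorem eq_of_eigenvectors {E : Fin 2 → ℝ}
    (h : ∀ j, H.mulVec (g j).ofLp = (E j : ℂ) • (g j).ofLp) :
    H = basisMatrix g * Matrix.diagonal (fun j => (E j : ℂ)) * (basisMatrix g).conjTranspose := by
  have : H * basisMatrix g = basisMatrix g * Matrix.diagonal (fun j => (E j : ℂ)) := by
    ext i j
    have := congrFun (h j) i
    rw [Matrix.mul_diagonal]
    simp only [Matrix.mul_apply, basisMatrix, Matrix.of_apply]
    simpa [Matrix.mulVec, dotProduct, mul_comm] using this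
  rw [← this, Matrix.mul_assoc, basisMatrix_mul_star, Matrix.mul_one]

theorem spectrum_conj_diagonal (E : Fin 2 → ℝ)
    (h : H = basisMatrix g * Matrix.diagonal (fun j => (E j : ℂ)) *
      (basisMatrix g).conjTranspose) : spectrum ℝ H = Set.range E := by
  let u : (Matrix (Fin 2) (Fin 2) ℂ)ˣ := ⟨basisMatrix g, (basisMatrix g).conjTranspose,
    basisMatrix_mul_star g, basisMatrix_star_mul g⟩
  have h1 : spectrum ℂ H = Set.range fun j => (E j : ℂ) := by
    rw [h]
    have := spectrum.units_conjugate (R := ℂ) (a := Matrix.diagonal (fun j => (E j : ℂ))) (u := u)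
    rw [show basisMatrix g * Matrix.diagonal (fun j => (E j : ℂ)) *
      (basisMatrix g).conjTranspose = (u : Matrix (Fin 2) (Fin 2) ℂ) *
        Matrix.diagonal (fun j => (E j : ℂ)) * ((u⁻¹ :) : Matrix (Fin 2) (Fin 2) ℂ) from rfl, this,
      spectrum_diagonal]
  rw [← spectrum.preimage_algebraMap ℂ, h1]
  ext x
  simp

theorem energyGap_eq (E : Fin 2 → ℝ) (hE : E 0 < E 1)
    (h : H = basisMatrix g * Matrix.diagonal (fun j => (E j : ℂ)) *
      (basisMatrix g).conjTranspose) : energyGap H = E 1 - E 0 := by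
  have : Set.range E = {E 0, E 1} := by
    ext x
    simp [Fin.exists_fin_two, eq_comm]
  rw [energyGap, spectrum_conj_diagonal E h, this, csSup_pair, csInf_pair]
  simp [hE.le]

theorem IsOrderedEigenbasis.exists_eq (hg : IsOrderedEigenbasis H g) :
    ∃ E : Fin 2 → ℝ, E 0 < E 1 ∧ energyGap H = E 1 - E 0 ∧
      H = basisMatrix g * Matrix.diagonal (fun j => (E j : ℂ)) *
        (basisMatrix g).conjTranspose := by
  obtain ⟨E₁, E₂, hlt, h1, h2⟩ := hg
  have h := eq_of_eigenvectors (H := H) (g := g) (E := ![E₁, E₂]) (by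
    exact Fin.forall_fin_two.mpr ⟨by simpa using h1, by simpa using h2⟩)
  exact ⟨![E₁, E₂], by simpa, by simpa using energyGap_eq ![E₁, E₂] (by simpa) h, h⟩

theorem exists_isOrderedEigenbasis (hH : H.IsHermitian) (hd : NonDegenerate H) :
    ∃ g : QubitBasis, IsOrderedEigenbasis H g := by
  have hne : hH.eigenvalues 0 ≠ hH.eigenvalues 1 := by
    intro h
    rw [NonDegenerate, hH.spectrum_real_eq_range_eigenvalues] at hd
    have : Set.range hH.eigenvalues = {hH.eigenvalues 0} := by
      ext x
      simp [Fin.exists_fin_two, ← h, eq_comm]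
    rw [this] at hd
    simp at hd
  have hv := hH.mulVec_eigenvectorBasis
  rcases lt_or_gt_of_ne hne with h | h
  · exact ⟨hH.eigenvectorBasis, _, _, h, by simpa using hv 0, by simpa using hv 1⟩
  · refine ⟨hH.eigenvectorBasis.reindex (Equiv.swap 0 1), _, _, h, ?_, ?_⟩
    · simpa using hv 1
    · simpa using hv 0

theorem eq_smul_one_of_not_nonDegenerate (hH : H.IsHermitian) (hd : ¬ NonDegenerate H) :
    ∃ E : ℝ, H = (E : ℂ) • 1 := by
  have he : hH.eigenvalues 0 = hH.eigenvalues 1 := by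
    by_contra hne
    apply hd
    rw [NonDegenerate, hH.spectrum_real_eq_range_eigenvalues]
    have : Set.range hH.eigenvalues = {hH.eigenvalues 0, hH.eigenvalues 1} := by
      ext x
      simp [Fin.exists_fin_two, eq_comm]
    rw [this, Set.ncard_pair hne]
    simp
  have h := eq_of_eigenvectors (H := H) (g := hH.eigenvectorBasis) (E := hH.eigenvalues)
    (by intro j; simpa using hH.mulVec_eigenvectorBasis j)
  refine ⟨hH.eigenvalues 0, ?_⟩
  have hc : (Matrix.diagonal fun j => ((hH.eigenvalues j : ℝ) : ℂ)) =
      ((hH.eigenvalues 0 : ℝ) : ℂ) • (1 : Matrix (Fin 2) (Fin 2) ℂ) := by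
    ext i j
    fin_cases i <;> fin_cases j <;> simp [he]
  rw [hc] at h
  conv_lhs => rw [h]
  simp [basisMatrix_mul_star]

end Eigenbasis

end ThermalOps

namespace ThermalOps

/-! ### Thermal operations in any dimension: Kraus forms, inclusion in EnTO, closedness -/

section General

variable {n : Type*} [Fintype n] [DecidableEq n]

/-- With a continuous left inverse, φ passes through an infinite sum whether or not it converges, so
the exponential series needs no convergence argument. -/
theorem exp_ringHom_of_leftInverse {ι κ : Type*} [Fintype ι] [DecidableEq ι] [Fintype κ]
    [DecidableEq κ] (φ : Matrix κ κ ℂ →+* Matrix ι ι ℂ) (hφ : Continuous φ)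
    {ψ : Matrix ι ι ℂ → Matrix κ κ ℂ} (hψ : Continuous ψ) (h : Function.LeftInverse ψ φ)
    (A : Matrix κ κ ℂ) : NormedSpace.exp (φ A) = φ (NormedSpace.exp A) := by
  simp only [NormedSpace.exp_eq_tsum_rat]
  rw [h.map_tsum _ hφ hψ]
  simp [map_rat_smul]

/-- `A ↦ A ⊗ 1`. -/
def kroneckerOneHom (κ ι : Type*) [Fintype ι] [DecidableEq ι] [Fintype κ] [DecidableEq κ] :
    Matrix κ κ ℂ →+* Matrix (κ × ι) (κ × ι) ℂ where
  toFun A := A ⊗ₖ (1 : Matrix ι ι ℂ)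
  map_one' := Matrix.one_kronecker_one
  map_mul' A B := by rw [← Matrix.mul_kronecker_mul, Matrix.one_mul]
  map_zero' := Matrix.zero_kronecker _
  map_add' A B := Matrix.add_kronecker _ _ _

/-- `A ↦ 1 ⊗ A`. -/
def oneKroneckerHom (κ ι : Type*) [Fintype ι] [DecidableEq ι] [Fintype κ] [DecidableEq κ] :
    Matrix κ κ ℂ →+* Matrix (ι × κ) (ι × κ) ℂ where
  toFun A := (1 : Matrix ι ι ℂ) ⊗ₖ A
  map_one' := Matrix.one_kronecker_one
  map_mul' A B := by rw [← Matrix.mul_kronecker_mul, Matrix.one_mul]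
  map_zero' := Matrix.kronecker_zero _
  map_add' A B := Matrix.kronecker_add _ _ _

theorem exp_one_kronecker {ι κ : Type*} [Fintype ι] [DecidableEq ι] [Fintype κ] [DecidableEq κ]
    (A : Matrix κ κ ℂ) :
    NormedSpace.exp ((1 : Matrix ι ι ℂ) ⊗ₖ A) = (1 : Matrix ι ι ℂ) ⊗ₖ NormedSpace.exp A := by
  -- The left inverse is restriction to one block, which needs an index to exist.
  rcases isEmpty_or_nonempty ι with hι | ⟨⟨i⟩⟩
  · exact Subsingleton.elim _ _
  · exact exp_ringHom_of_leftInverse (oneKroneckerHom κ ι)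
      (continuous_matrix fun p q => by
        simp only [oneKroneckerHom, RingHom.coe_mk, MonoidHom.coe_mk, OneHom.coe_mk,
          Matrix.kroneckerMap_apply]
        fun_prop)
      (ψ := fun M => M.submatrix (fun a => (i, a)) fun a => (i, a))
      (continuous_id.matrix_submatrix _ _) (fun M => by ext; simp [oneKroneckerHom]) A

theorem exp_kronecker_one {ι κ : Type*} [Fintype ι] [DecidableEq ι] [Fintype κ] [DecidableEq κ]
    (A : Matrix κ κ ℂ) :
    NormedSpace.exp (A ⊗ₖ (1 : Matrix ι ι ℂ)) = NormedSpace.exp A ⊗ₖ (1 : Matrix ι ι ℂ) := by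
  rcases isEmpty_or_nonempty ι with hι | ⟨⟨i⟩⟩
  · exact Subsingleton.elim _ _
  · exact exp_ringHom_of_leftInverse (kroneckerOneHom κ ι)
      (continuous_matrix fun p q => by
        simp only [kroneckerOneHom, RingHom.coe_mk, MonoidHom.coe_mk, OneHom.coe_mk,
          Matrix.kroneckerMap_apply]
        fun_prop)
      (ψ := fun M => M.submatrix (fun a => (a, i)) fun a => (a, i))
      (continuous_id.matrix_submatrix _ _) (fun M => by ext; simp [kroneckerOneHom]) A

/-- The system and bath summands commute, so the exponential factorizes. -/
theorem boltzmann_totalHamiltonian {m : ℕ} (HS : Matrix n n ℂ) (HB : Matrix (Fin m) (Fin m) ℂ)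
    (T : ℝ≥0∞) :
    boltzmann (totalHamiltonian HS HB) T = boltzmann HS T ⊗ₖ boltzmann HB T := by
  unfold boltzmann totalHamiltonian
  rw [smul_add, neg_add, ← Matrix.smul_kronecker, ← Matrix.kronecker_smul, ← neg_one_smul ℂ,
    ← neg_one_smul ℂ (_ ⊗ₖ _), ← Matrix.smul_kronecker, ← Matrix.kronecker_smul,
    Matrix.exp_add_of_commute, exp_kronecker_one, exp_one_kronecker, ← Matrix.mul_kronecker_mul,
    Matrix.mul_one, Matrix.one_mul, neg_one_smul, neg_one_smul]
  simp only [commute_iff_eq, ← Matrix.mul_kronecker_mul, Matrix.mul_one, Matrix.one_mul]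

/-- The block `⟨a|_B U |b⟩_B` of `U`. -/
def bathBlock {ι : Type*} (U : Matrix (n × ι) (n × ι) ℂ) (a b : ι) : Matrix n n ℂ :=
  Matrix.of fun i j => U (i, a) (j, b)

theorem partialTrace_conj {m : ℕ} (ω : Matrix (Fin m) (Fin m) ℂ)
    (U : Matrix (n × Fin m) (n × Fin m) ℂ) (ρ : Matrix n n ℂ) :
    partialTrace (U * (ρ ⊗ₖ ω) * U.conjTranspose) =
      ∑ a, ∑ b, ∑ b', ω b b' • (bathBlock U a b * ρ * (bathBlock U a b').conjTranspose) := by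
  ext i k
  simp only [partialTrace, Matrix.of_apply, Matrix.sum_apply, Matrix.smul_apply]
  refine Finset.sum_congr rfl fun a _ => ?_
  simp only [Matrix.mul_apply, Fintype.sum_prod_type, Matrix.kroneckerMap_apply,
    Matrix.conjTranspose_apply, bathBlock, Matrix.of_apply, Finset.sum_mul, Finset.mul_sum,
    smul_eq_mul]
  calc _ = ∑ k', ∑ b', ∑ b, ∑ i', U (i, a) (i', b) * (ρ i' k' * ω b b') * star (U (k, a) (k', b')) :=
        Finset.sum_congr rfl fun k' _ => Finset.sum_congr rfl fun b' _ => Finset.sum_comm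
    _ = ∑ b', ∑ k', ∑ b, ∑ i', U (i, a) (i', b) * (ρ i' k' * ω b b') * star (U (k, a) (k', b')) :=
        Finset.sum_comm
    _ = ∑ b', ∑ b, ∑ k', ∑ i', U (i, a) (i', b) * (ρ i' k' * ω b b') * star (U (k, a) (k', b')) :=
        Finset.sum_congr rfl fun b' _ => Finset.sum_comm
    _ = ∑ b, ∑ b', ∑ k', ∑ i', U (i, a) (i', b) * (ρ i' k' * ω b b') * star (U (k, a) (k', b')) :=
        Finset.sum_comm
    _ = _ := by
        refine Finset.sum_congr rfl fun b _ => Finset.sum_congr rfl fun b' _ =>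
          Finset.sum_congr rfl fun k' _ => Finset.sum_congr rfl fun i' _ => ?_
        ring

theorem dilation_apply {m : ℕ} (ω : Matrix (Fin m) (Fin m) ℂ)
    (U : Matrix (n × Fin m) (n × Fin m) ℂ) (ρ : Matrix n n ℂ) :
    dilation ω U ρ = partialTrace (U * (ρ ⊗ₖ ω) * U.conjTranspose) := rfl

theorem dilation_diagonal {m : ℕ} (p : Fin m → ℂ)
    (U : Matrix (n × Fin m) (n × Fin m) ℂ) (ρ : Matrix n n ℂ) :
    dilation (Matrix.diagonal p) U ρ =
      ∑ a, ∑ b, p b • (bathBlock U a b * ρ * (bathBlock U a b).conjTranspose) := by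
  rw [dilation_apply, partialTrace_conj]
  refine Finset.sum_congr rfl fun a _ => Finset.sum_congr rfl fun b _ => ?_
  rw [Finset.sum_eq_single b]
  · simp
  · intro b' _ hb
    simp [Matrix.diagonal_apply_ne' _ hb]
  · simp

/-- Absorbing a root `W` of the bath state into `U` yields Kraus operators without diagonalizing the
bath Hamiltonian. -/
theorem dilation_mul_conjTranspose {m : ℕ} (W : Matrix (Fin m) (Fin m) ℂ)
    (U : Matrix (n × Fin m) (n × Fin m) ℂ) (ρ : Matrix n n ℂ) :
    dilation (W * W.conjTranspose) U ρ =
      ∑ a, ∑ b, bathBlock (U * ((1 : Matrix n n ℂ) ⊗ₖ W)) a b * ρ *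
        (bathBlock (U * ((1 : Matrix n n ℂ) ⊗ₖ W)) a b).conjTranspose := by
  have h : dilation (W * W.conjTranspose) U ρ =
      dilation (Matrix.diagonal fun _ => 1) (U * ((1 : Matrix n n ℂ) ⊗ₖ W)) ρ := by
    rw [dilation_apply, dilation_apply]
    congr 1
    rw [Matrix.conjTranspose_mul, Matrix.conjTranspose_kronecker, Matrix.diagonal_one]
    have : ρ ⊗ₖ (W * W.conjTranspose) = ((1 : Matrix n n ℂ) ⊗ₖ W) * (ρ ⊗ₖ 1) *
        ((1 : Matrix n n ℂ).conjTranspose ⊗ₖ W.conjTranspose) := by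
      rw [← Matrix.mul_kronecker_mul, ← Matrix.mul_kronecker_mul]
      simp
    rw [this]
    simp only [Matrix.mul_assoc]
  rw [h, dilation_diagonal]
  simp

theorem ampliation_posSemidef_of_kraus {ι : Type*} [Fintype ι] {S : Superop n}
    (K : ι → Matrix n n ℂ) (hS : ∀ ρ, S ρ = ∑ x, K x * ρ * (K x).conjTranspose) (k : ℕ)
    (X : Matrix (n × Fin k) (n × Fin k) ℂ) (hX : X.PosSemidef) :
    (ampliation S k X).PosSemidef := by
  have : ampliation S k X = ∑ x, (K x ⊗ₖ (1 : Matrix (Fin k) (Fin k) ℂ)) * X *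
      (K x ⊗ₖ (1 : Matrix (Fin k) (Fin k) ℂ)).conjTranspose := by
    ext ⟨i, p⟩ ⟨j, q⟩
    simp only [ampliation, hS, Matrix.of_apply, Matrix.sum_apply]
    refine Finset.sum_congr rfl fun x _ => ?_
    simp only [Matrix.mul_apply, Fintype.sum_prod_type, Matrix.conjTranspose_kronecker,
      Matrix.kroneckerMap_apply, Matrix.conjTranspose_one, Matrix.one_apply, Matrix.of_apply]
    simp
  rw [this]
  exact Matrix.posSemidef_sum _ fun x _ => hX.mul_mul_conjTranspose_same _

theorem trace_partialTrace {m : ℕ} (X : Matrix (n × Fin m) (n × Fin m) ℂ) :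
    (partialTrace X).trace = X.trace := by
  simp [partialTrace, Matrix.trace, Fintype.sum_prod_type]

theorem partialTrace_kronecker {m : ℕ} (A : Matrix n n ℂ) (B : Matrix (Fin m) (Fin m) ℂ) :
    partialTrace (A ⊗ₖ B) = B.trace • A := by
  ext i k
  simp [partialTrace, Matrix.trace, Finset.mul_sum, mul_comm]

/-- The bath summand drops out because the trace over the bath is cyclic for operators on the bath
(`h3`). -/
theorem partialTrace_commutator {m : ℕ} (A : Matrix n n ℂ) (B : Matrix (Fin m) (Fin m) ℂ)
    (X : Matrix (n × Fin m) (n × Fin m) ℂ) :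
    partialTrace (totalHamiltonian A B * X - X * totalHamiltonian A B) =
      A * partialTrace X - partialTrace X * A := by
  ext i k
  simp only [partialTrace, totalHamiltonian, Matrix.of_apply, Matrix.sub_apply, Matrix.mul_apply,
    Fintype.sum_prod_type, Matrix.add_apply, Matrix.kroneckerMap_apply, Matrix.one_apply]
  simp only [add_mul, mul_add, Finset.sum_add_distrib, Finset.sum_sub_distrib, mul_ite, ite_mul,
    mul_one, mul_zero, zero_mul, one_mul, Finset.sum_ite_eq, Finset.sum_ite_eq', Finset.mem_univ,
    if_true]
  have h1 : ∑ a, ∑ j, A i j * X (j, a) (k, a) = ∑ j, A i j * ∑ a, X (j, a) (k, a) := by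
    rw [Finset.sum_comm]; simp [Finset.mul_sum]
  have h2 : ∑ a, ∑ j, X (i, a) (j, a) * A j k = ∑ j, (∑ a, X (i, a) (j, a)) * A j k := by
    rw [Finset.sum_comm]; simp [Finset.sum_mul]
  have h3 : ∑ a, ∑ b, B a b * X (i, b) (k, a) = ∑ a, ∑ b, X (i, a) (k, b) * B b a := by
    rw [Finset.sum_comm]; simp [mul_comm]
  simp [h1, h2, h3, Finset.sum_ite_irrel]

/-- The root is the exponential at half the inverse temperature. Its invertibility is what later
allows it to be cancelled from identities between blocks. -/
theorem exists_boltzmann_sqrt {ι : Type*} [Fintype ι] [DecidableEq ι] {H : Matrix ι ι ℂ}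
    (hH : H.IsHermitian) (T : ℝ≥0∞) :
    ∃ W : Matrix ι ι ℂ, IsUnit W ∧ Commute H W ∧ W * W.conjTranspose = boltzmann H T := by
  have hh : (-(((invTemp T / 2 : ℝ) : ℂ) • H)).IsHermitian := by
    rw [Matrix.IsHermitian, Matrix.conjTranspose_neg, Matrix.conjTranspose_smul, hH.eq]
    simp
  refine ⟨NormedSpace.exp (-(((invTemp T / 2 : ℝ) : ℂ) • H)), Matrix.isUnit_exp _,
    ((Commute.refl H).smul_right _).neg_right.exp_right, ?_⟩
  rw [hh.exp.eq, ← Matrix.exp_add_of_commute _ _ (Commute.refl _), boltzmann, ← neg_add,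
    ← add_smul]
  push_cast
  ring_nf

theorem trace_boltzmann_pos {ι : Type*} [Fintype ι] [DecidableEq ι] [Nonempty ι]
    {H : Matrix ι ι ℂ} (hH : H.IsHermitian) (T : ℝ≥0∞) : 0 < (boltzmann H T).trace := by
  obtain ⟨W, hW, -, hWW⟩ := exists_boltzmann_sqrt hH T
  rw [← hWW]
  refine lt_of_le_of_ne (Matrix.posSemidef_self_mul_conjTranspose W).trace_nonneg fun h => ?_
  rw [eq_comm, Matrix.trace_mul_conjTranspose_self_eq_zero_iff] at h
  exact hW.ne_zero h

theorem exists_gibbs_sqrt {ι : Type*} [Fintype ι] [DecidableEq ι] [Nonempty ι] {H : Matrix ι ι ℂ}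
    (hH : H.IsHermitian) (T : ℝ≥0∞) :
    ∃ W : Matrix ι ι ℂ, IsUnit W ∧ Commute H W ∧ W * W.conjTranspose = gibbs H T := by
  obtain ⟨W, hW, hc, hWW⟩ := exists_boltzmann_sqrt hH T
  have hp := trace_boltzmann_pos hH T
  obtain ⟨t, ht⟩ : ∃ t : ℝ, (t : ℂ) = (boltzmann H T).trace :=
    ⟨_, (Complex.eq_re_of_ofReal_le hp.le).symm⟩
  rw [← ht] at hp
  have ht0 : 0 < t := by exact_mod_cast hp
  refine ⟨((Real.sqrt t⁻¹ : ℝ) : ℂ) • W, ?_, hc.smul_right _, ?_⟩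
  · exact hW.smul (Units.mk0 ((Real.sqrt t⁻¹ : ℝ) : ℂ) (by
      simpa using (Real.sqrt_pos.mpr ht0).ne'))
  · rw [Matrix.conjTranspose_smul, Matrix.smul_mul, Matrix.mul_smul, smul_smul, hWW, gibbs, ← ht]
    congr 1
    simp only [Complex.star_def, Complex.conj_ofReal, ← Complex.ofReal_mul]
    rw [Real.mul_self_sqrt (by positivity), Complex.ofReal_inv]

theorem trace_gibbs {ι : Type*} [Fintype ι] [DecidableEq ι] [Nonempty ι] {H : Matrix ι ι ℂ}
    (hH : H.IsHermitian) (T : ℝ≥0∞) : (gibbs H T).trace = 1 := by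
  rw [gibbs, Matrix.trace_smul, smul_eq_mul, inv_mul_cancel₀ (trace_boltzmann_pos hH T).ne']

theorem commute_gibbs {ι : Type*} [Fintype ι] [DecidableEq ι] (H : Matrix ι ι ℂ) (T : ℝ≥0∞) :
    Commute H (gibbs H T) :=
  (((Commute.refl H).smul_right _).neg_right.exp_right).smul_right _

theorem EnergyConserving.commute {m : ℕ} {HS : Matrix n n ℂ} {HB : Matrix (Fin m) (Fin m) ℂ}
    {U : Matrix (n × Fin m) (n × Fin m) ℂ} (h : EnergyConserving HS HB U) :
    Commute U (totalHamiltonian HS HB) := by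
  have := congrArg (· * U) h.2
  simp only [Matrix.mul_assoc] at this
  rw [show U.conjTranspose * U = 1 from Matrix.mem_unitaryGroup_iff'.mp h.1, Matrix.mul_one] at this
  exact this

theorem energyConserving_of_commute {m : ℕ} {HS : Matrix n n ℂ} {HB : Matrix (Fin m) (Fin m) ℂ}
    {U : Matrix (n × Fin m) (n × Fin m) ℂ} (hU : U ∈ Matrix.unitaryGroup (n × Fin m) ℂ)
    (h : Commute U (totalHamiltonian HS HB)) : EnergyConserving HS HB U := by
  refine ⟨hU, ?_⟩
  rw [h.eq, Matrix.mul_assoc, show U * U.conjTranspose = 1 from Matrix.mem_unitaryGroup_iff.mp hU,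
    Matrix.mul_one]

theorem thermalMap_isCPTP {m : ℕ} (hm : 0 < m) {T : ℝ≥0∞} {HB : Matrix (Fin m) (Fin m) ℂ}
    (hB : HB.IsHermitian) {U : Matrix (n × Fin m) (n × Fin m) ℂ}
    (hU : U ∈ Matrix.unitaryGroup (n × Fin m) ℂ) : IsCPTP (thermalMap T HB U) := by
  have : Nonempty (Fin m) := ⟨⟨0, hm⟩⟩
  constructor
  · obtain ⟨W, -, -, hW⟩ := exists_gibbs_sqrt hB T
    intro k X hX
    refine ampliation_posSemidef_of_kraus (ι := Fin m × Fin m)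
      (fun x => bathBlock (U * ((1 : Matrix n n ℂ) ⊗ₖ W)) x.1 x.2) (fun ρ => ?_) k X hX
    rw [thermalMap, ← hW, dilation_mul_conjTranspose, Fintype.sum_prod_type]
  · intro X
    rw [thermalMap, dilation_apply, trace_partialTrace, Matrix.trace_mul_comm, ← Matrix.mul_assoc,
      show U.conjTranspose * U = 1 from Matrix.mem_unitaryGroup_iff'.mp hU, Matrix.one_mul,
      Matrix.trace_kronecker, trace_gibbs hB T, mul_one]

/-- The joint Gibbs operator is a product and commutes with `U`, which gives the fixed point. The
bath state commutes with the bath Hamiltonian and `U` with the total one, so the system commutator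
can be completed to the total commutator, moved through `U` and reduced again by the partial trace.
-/
theorem TO_subset_EnTO (HS : Matrix n n ℂ) (T : ℝ≥0∞) : TO HS T ⊆ EnTO HS T := by
  rintro S ⟨m, hm, HB, hB, U, hU, rfl⟩
  have : Nonempty (Fin m) := ⟨⟨0, hm⟩⟩
  have hc := hU.commute
  refine ⟨thermalMap_isCPTP hm hB hU.1, ?_, fun X => ?_⟩
  · have h1 : U * boltzmann (totalHamiltonian HS HB) T * U.conjTranspose =
        boltzmann (totalHamiltonian HS HB) T := by
      have : Commute U (boltzmann (totalHamiltonian HS HB) T) :=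
        ((hc.smul_right _).neg_right).exp_right
      rw [this.eq, Matrix.mul_assoc,
        show U * U.conjTranspose = 1 from Matrix.mem_unitaryGroup_iff.mp hU.1, Matrix.mul_one]
    rw [thermalMap, dilation_apply, gibbs, Matrix.kronecker_smul, ← boltzmann_totalHamiltonian,
      Matrix.mul_smul, Matrix.smul_mul, h1, boltzmann_totalHamiltonian, ← Matrix.kronecker_smul]
    have := trace_gibbs hB T
    rw [gibbs] at this
    rw [partialTrace_kronecker, this, one_smul]
  · rw [thermalMap, dilation_apply, dilation_apply, ← partialTrace_commutator _ HB]
    congr 1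
    have h1 : (HS * X - X * HS) ⊗ₖ gibbs HB T = totalHamiltonian HS HB * (X ⊗ₖ gibbs HB T) -
        (X ⊗ₖ gibbs HB T) * totalHamiltonian HS HB := by
      rw [totalHamiltonian, Matrix.add_mul, Matrix.mul_add]
      simp only [← Matrix.mul_kronecker_mul, Matrix.one_mul, Matrix.mul_one, (commute_gibbs HB T).eq]
      rw [add_sub_add_right_eq_sub]
      ext ⟨i, a⟩ ⟨j, b⟩
      simp [sub_mul]
    have hc' : U.conjTranspose * totalHamiltonian HS HB = totalHamiltonian HS HB * U.conjTranspose := by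
      have h2 := congrArg (U.conjTranspose * ·) hU.2
      simp only [← Matrix.mul_assoc] at h2
      rw [show U.conjTranspose * U = 1 from Matrix.mem_unitaryGroup_iff'.mp hU.1, Matrix.one_mul]
        at h2
      exact h2.symm
    rw [h1, Matrix.mul_sub, Matrix.sub_mul]
    congr 1
    · rw [← Matrix.mul_assoc, hc.eq]
      simp only [Matrix.mul_assoc]
    · simp only [Matrix.mul_assoc, hc']

theorem isClosed_EnTO (HS : Matrix n n ℂ) (T : ℝ≥0∞) : IsClosed (EnTO HS T) := by
  have hev (X : Matrix n n ℂ) : Continuous fun S : Superop n => S X :=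
    ContinuousEvalConst.continuous_eval_const X
  have h1 : EnTO HS T = {S : Superop n | ∀ (k : ℕ) (X : Matrix (n × Fin k) (n × Fin k) ℂ),
      X.PosSemidef → (ampliation S k X).PosSemidef} ∩ ({S | ∀ X : Matrix n n ℂ,
      (S X).trace = X.trace} ∩ ({S | S (boltzmann HS T) = boltzmann HS T} ∩
      {S | ∀ X : Matrix n n ℂ, S (HS * X - X * HS) = HS * S X - S X * HS})) := by
    ext S
    simp [EnTO, IsCPTP, and_assoc]
  rw [h1]
  refine IsClosed.inter ?_ (IsClosed.inter ?_ (IsClosed.inter ?_ ?_))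
  · simp only [Set.ofPred_forall]
    refine isClosed_iInter fun k => isClosed_iInter fun X => isClosed_iInter fun _ => ?_
    have hc : Continuous fun S : Superop n => ampliation S k X :=
      continuous_matrix fun p q => (hev _).matrix_elem _ _
    simp only [Matrix.posSemidef_iff_dotProduct_mulVec, Matrix.IsHermitian]
    rw [Set.ofPred_and, Set.ofPred_forall]
    refine IsClosed.inter (isClosed_eq hc.matrix_conjTranspose hc) ?_
    refine isClosed_iInter fun v => isClosed_le continuous_const ?_
    exact continuous_const.dotProduct (hc.matrix_mulVec continuous_const)
  · rw [Set.ofPred_forall]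
    exact isClosed_iInter fun X => isClosed_eq (hev X).matrix_trace continuous_const
  · exact isClosed_eq (hev _) continuous_const
  · rw [Set.ofPred_forall]
    refine isClosed_iInter fun X => isClosed_eq (hev _) ?_
    exact (continuous_const.matrix_mul (hev X)).sub ((hev X).matrix_mul continuous_const)

theorem boltzmann_diagonal {ι : Type*} [Fintype ι] [DecidableEq ι] (ε : ι → ℝ) (T : ℝ≥0∞) :
    boltzmann (Matrix.diagonal fun j => (ε j : ℂ)) T =
      Matrix.diagonal fun j => ((Real.exp (-(invTemp T * ε j)) : ℝ) : ℂ) := by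
  have : -(((invTemp T : ℝ) : ℂ) • Matrix.diagonal fun j => (ε j : ℂ)) =
      Matrix.diagonal fun j => ((-(invTemp T * ε j) : ℝ) : ℂ) := by
    ext i j
    by_cases h : i = j
    · subst h; simp
    · simp [h]
  rw [boltzmann, this, Matrix.exp_diagonal]
  congr 1
  ext j
  rw [Pi.coe_exp, Complex.ofReal_exp, Complex.exp_eq_exp_ℂ]

theorem gibbs_diagonal {ι : Type*} [Fintype ι] [DecidableEq ι] (ε : ι → ℝ) (T : ℝ≥0∞) :
    gibbs (Matrix.diagonal fun j => (ε j : ℂ)) T = Matrix.diagonal fun j =>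
      ((Real.exp (-(invTemp T * ε j)) / ∑ k, Real.exp (-(invTemp T * ε k)) : ℝ) : ℂ) := by
  rw [gibbs, boltzmann_diagonal, Matrix.trace_diagonal, ← Matrix.diagonal_smul]
  congr 1
  ext j
  simp [div_eq_inv_mul]

theorem isHermitian_diagonal_ofReal {ι : Type*} [DecidableEq ι] (ε : ι → ℝ) :
    (Matrix.diagonal fun j => (ε j : ℂ)).IsHermitian := by
  rw [Matrix.IsHermitian, Matrix.diagonal_conjTranspose]
  congr 1
  ext j
  simp

/-- Admits any finite index type for the bath levels, so that products of index types can serve as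
baths. -/
theorem mem_TO_of_diagonal {ι : Type*} [Fintype ι] [DecidableEq ι] [Nonempty ι]
    {HS : Matrix n n ℂ} {T : ℝ≥0∞} (ε : ι → ℝ) {U : Matrix (n × ι) (n × ι) ℂ}
    (hU : U ∈ Matrix.unitaryGroup (n × ι) ℂ)
    (hc : Commute U (HS ⊗ₖ (1 : Matrix ι ι ℂ) +
      (1 : Matrix n n ℂ) ⊗ₖ Matrix.diagonal fun j => (ε j : ℂ)))
    {S : Superop n} (hS : ∀ ρ, S ρ = ∑ a, ∑ b,
      ((Real.exp (-(invTemp T * ε b)) / ∑ k, Real.exp (-(invTemp T * ε k)) : ℝ) : ℂ) •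
        (bathBlock U a b * ρ * (bathBlock U a b).conjTranspose)) : S ∈ TO HS T := by
  let e : Fin (Fintype.card ι) ≃ ι := (Fintype.equivFin ι).symm
  let f : n × Fin (Fintype.card ι) ≃ n × ι := (Equiv.refl n).prodCongr e
  have hf : totalHamiltonian HS (Matrix.diagonal fun j => ((ε (e j) : ℝ) : ℂ)) =
      (HS ⊗ₖ (1 : Matrix ι ι ℂ) +
      (1 : Matrix n n ℂ) ⊗ₖ Matrix.diagonal fun j => (ε j : ℂ)).submatrix f f := by
    ext ⟨i, a⟩ ⟨j, b⟩
    simp [totalHamiltonian, f, Matrix.diagonal_apply, Matrix.one_apply]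
  refine ⟨Fintype.card ι, Fintype.card_pos, Matrix.diagonal fun j => ((ε (e j) : ℝ) : ℂ),
    isHermitian_diagonal_ofReal _, U.submatrix f f, energyConserving_of_commute ?_ ?_, ?_⟩
  · rw [Matrix.mem_unitaryGroup_iff, Matrix.star_eq_conjTranspose, Matrix.conjTranspose_submatrix,
      Matrix.submatrix_mul_equiv, ← Matrix.star_eq_conjTranspose,
      Matrix.mem_unitaryGroup_iff.mp hU, Matrix.submatrix_one_equiv]
  · rw [commute_iff_eq, hf, Matrix.submatrix_mul_equiv, Matrix.submatrix_mul_equiv, hc.eq]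
  · ext1 ρ
    rw [thermalMap, gibbs_diagonal (fun j => ε (e j)), dilation_diagonal, hS,
      Equiv.sum_comp e fun j => Real.exp (-(invTemp T * ε j))]
    rw [← Equiv.sum_comp e]
    refine Finset.sum_congr rfl fun a _ => ?_
    rw [← Equiv.sum_comp e]
    rfl

end General

end ThermalOps

namespace ThermalOps

/-! ### Uniform averages by means of degenerate bath levels -/

section Average

variable {n : Type*} [Fintype n] [DecidableEq n]

/-- Every bath level is given the degeneracy space ℂ^ι, on which the Gibbs state is uniform. The
block diagonal unitary applies `V x` conditioned on the label x, so the bath itself supplies the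
random choice. -/
theorem average_mem_TO {κ ι : Type*} [Fintype κ] [DecidableEq κ] [Nonempty κ] [Fintype ι]
    [DecidableEq ι] [Nonempty ι] {HS : Matrix n n ℂ} {T : ℝ≥0∞} (ε : κ → ℝ)
    {V : ι → Matrix (n × κ) (n × κ) ℂ} (hV : ∀ x, V x ∈ Matrix.unitaryGroup (n × κ) ℂ)
    (hc : ∀ x, Commute (V x) (HS ⊗ₖ (1 : Matrix κ κ ℂ) +
      (1 : Matrix n n ℂ) ⊗ₖ Matrix.diagonal fun j => (ε j : ℂ)))
    {S : Superop n} (hS : ∀ ρ, S ρ = (Fintype.card ι : ℂ)⁻¹ • ∑ x, ∑ a, ∑ b,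
      ((Real.exp (-(invTemp T * ε b)) / ∑ k, Real.exp (-(invTemp T * ε k)) : ℝ) : ℂ) •
        (bathBlock (V x) a b * ρ * (bathBlock (V x) a b).conjTranspose)) : S ∈ TO HS T := by
  let e : n × (κ × ι) ≃ (n × κ) × ι := (Equiv.prodAssoc n κ ι).symm
  have hH : HS ⊗ₖ (1 : Matrix (κ × ι) (κ × ι) ℂ) +
      (1 : Matrix n n ℂ) ⊗ₖ Matrix.diagonal (fun j : κ × ι => ((ε j.1 : ℝ) : ℂ)) =
      (Matrix.blockDiagonal fun _ : ι => HS ⊗ₖ (1 : Matrix κ κ ℂ) +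
      (1 : Matrix n n ℂ) ⊗ₖ Matrix.diagonal fun j => (ε j : ℂ)).submatrix e e := by
    ext ⟨i, a, x⟩ ⟨j, b, y⟩
    by_cases hxy : x = y
    · subst hxy
      simp [e, Matrix.diagonal_apply, Matrix.one_apply, Matrix.blockDiagonal_apply]
    · simp [e, Matrix.diagonal_apply, Matrix.blockDiagonal_apply, hxy]
  refine mem_TO_of_diagonal (ι := κ × ι) (fun j => ε j.1)
    (U := (Matrix.blockDiagonal V).submatrix e e) ?_ ?_ fun ρ => ?_
  · rw [Matrix.mem_unitaryGroup_iff, Matrix.star_eq_conjTranspose, Matrix.conjTranspose_submatrix,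
      Matrix.submatrix_mul_equiv, Matrix.blockDiagonal_conjTranspose, ← Matrix.blockDiagonal_mul]
    have : (fun k => V k * (V k).conjTranspose) = 1 :=
      funext fun x => Matrix.mem_unitaryGroup_iff.mp (hV x)
    rw [this, Matrix.blockDiagonal_one, Matrix.submatrix_one_equiv]
  · rw [hH, commute_iff_eq, Matrix.submatrix_mul_equiv, Matrix.submatrix_mul_equiv,
      ← Matrix.blockDiagonal_mul, ← Matrix.blockDiagonal_mul]
    simp only [(hc _).eq]
  · rw [hS]
    simp only [Fintype.sum_prod_type]
    have hb (a b : κ) (x y : ι) : bathBlock ((Matrix.blockDiagonal V).submatrix e e) (a, x) (b, y) =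
        if x = y then bathBlock (V x) a b else 0 := by
      ext i j
      by_cases hxy : x = y
      · subst hxy
        simp [bathBlock, e]
      · simp [bathBlock, e, Matrix.blockDiagonal_apply, hxy]
    -- The degeneracy multiplies the partition function by |ι|, which is the factor of the average.
    have hsum : ∑ k, ∑ _y : ι, Real.exp (-(invTemp T * ε k)) =
        Fintype.card ι * ∑ k, Real.exp (-(invTemp T * ε k)) := by
      simp [Finset.mul_sum]
    simp only [hb, hsum]
    rw [Finset.sum_comm, Finset.smul_sum]
    refine Finset.sum_congr rfl fun a _ => ?_
    rw [Finset.smul_sum]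
    refine Finset.sum_congr rfl fun x _ => ?_
    rw [Finset.smul_sum]
    refine Finset.sum_congr rfl fun b _ => ?_
    rw [Finset.sum_eq_single x (fun y _ hy => by simp [hy.symm]) (by simp)]
    rw [if_pos rfl, smul_smul]
    congr 1
    push_cast
    rw [mul_comm (Fintype.card ι : ℂ), div_mul_eq_div_div, div_eq_inv_mul _ (Fintype.card ι : ℂ)]

end Average

/-- `ρ ↦ u ρ u*`. -/
noncomputable def conjMap {n : Type*} [Fintype n] (u : Matrix n n ℂ) : Superop n :=
  LinearMap.toContinuousLinearMap
    (LinearMap.mulRight ℂ u.conjTranspose ∘ₗ LinearMap.mulLeft ℂ u)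

theorem conjMap_apply {n : Type*} [Fintype n] (u ρ : Matrix n n ℂ) :
    conjMap u ρ = u * ρ * u.conjTranspose := rfl

/-- Complete positivity evaluated on the rank-one operator of the vector Σ_i v_i ⊗ e_i. -/
theorem posSemidef_choi {n : Type*} [Fintype n] [DecidableEq n] {S : Superop n} (hS : IsCPTP S)
    {k : ℕ} (v : Fin k → n → ℂ) :
    (Matrix.of fun x y : n × Fin k =>
      S (Matrix.vecMulVec (v x.2) (star (v y.2))) x.1 y.1).PosSemidef := by
  have h := hS.1 k (Matrix.vecMulVec (fun x : n × Fin k => v x.2 x.1)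
    (star fun x : n × Fin k => v x.2 x.1)) (Matrix.posSemidef_vecMulVec_self_star _)
  exact h

/-! ### Scalar Hamiltonian: unital qubit channels as mixtures of unitaries -/

section Unital

/-- Under a scalar Hamiltonian every unitary conserves energy, so a bath with one energy and
degeneracy |ι| suffices. -/
theorem sum_conjMap_mem_TO {ι : Type*} [Fintype ι] [Nonempty ι] [DecidableEq ι] (E : ℝ) (T : ℝ≥0∞)
    {u : ι → Matrix (Fin 2) (Fin 2) ℂ} (hu : ∀ x, u x ∈ Matrix.unitaryGroup (Fin 2) ℂ) :
    (Fintype.card ι : ℂ)⁻¹ • ∑ x, conjMap (u x) ∈ TO ((E : ℂ) • 1 : Matrix (Fin 2) (Fin 2) ℂ) T := by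
  refine average_mem_TO (κ := Unit) (fun _ => 0) (V := fun x => u x ⊗ₖ 1) (fun x => ?_)
    (fun x => ?_) fun ρ => ?_
  · rw [Matrix.mem_unitaryGroup_iff, Matrix.star_eq_conjTranspose, Matrix.conjTranspose_kronecker,
      ← Matrix.mul_kronecker_mul, ← Matrix.star_eq_conjTranspose,
      Matrix.mem_unitaryGroup_iff.mp (hu x)]
    simp
  · have : (Matrix.diagonal fun _ : Unit => ((0 : ℝ) : ℂ)) = 0 := by ext; simp
    rw [this, Matrix.kronecker_zero, add_zero, Matrix.smul_kronecker, Matrix.one_kronecker_one]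
    exact (Commute.one_right _).smul_right _
  · have hb (x : ι) : bathBlock (u x ⊗ₖ (1 : Matrix Unit Unit ℂ)) () () = u x := by
      ext i j; simp [bathBlock]
    simp [hb, conjMap_apply]

theorem convex_combination_conjMap_mem_closure {k : ℕ} (E : ℝ) (T : ℝ≥0∞)
    {u : Fin k → Matrix (Fin 2) (Fin 2) ℂ} (hu : ∀ x, u x ∈ Matrix.unitaryGroup (Fin 2) ℂ)
    (w : Fin k → ℝ) (hw : ∀ x, 0 ≤ w x) (hw1 : ∑ x, w x = 1) :
    ∑ x, (w x : ℂ) • conjMap (u x) ∈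
      closure (TO ((E : ℂ) • 1 : Matrix (Fin 2) (Fin 2) ℂ) T) := by
  have hk : 0 < k := by
    rcases Nat.eq_zero_or_pos k with rfl | h
    · simp at hw1
    · exact h
  -- Multiplicities whose proportions tend to the weights. The extra copy keeps the index type
  -- non-empty for every N and disappears in the limit.
  let c (N : ℕ) (x : Fin k) : ℕ := ⌊w x * N⌋₊ + 1
  have hc (x : Fin k) : Filter.Tendsto (fun N : ℕ => (c N x : ℝ) / N) Filter.atTop (nhds (w x)) := by
    have h1 := (tendsto_nat_floor_mul_div_atTop (hw x)).comp (tendsto_natCast_atTop_atTop (R := ℝ))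
    have h2 := h1.add (tendsto_one_div_atTop_nhds_zero_nat (𝕜 := ℝ))
    rw [add_zero] at h2
    refine h2.congr fun N => ?_
    simp [c, add_div]
  have hs : Filter.Tendsto (fun N : ℕ => ∑ x, (c N x : ℝ) / N) Filter.atTop (nhds 1) := by
    rw [← hw1]
    exact tendsto_finsetSum _ fun x _ => hc x
  have hlim : Filter.Tendsto
      (fun N : ℕ => ∑ x, (((c N x : ℝ) / N / ∑ y, (c N y : ℝ) / N : ℝ) : ℂ) • conjMap (u x))
      Filter.atTop (nhds (∑ x, (w x : ℂ) • conjMap (u x))) := by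
    refine tendsto_finsetSum _ fun x _ => Filter.Tendsto.smul_const ?_ _
    have := (hc x).div hs one_ne_zero
    rw [div_one] at this
    exact (Complex.continuous_ofReal.tendsto _).comp this
  refine mem_closure_of_tendsto hlim ?_
  filter_upwards [Filter.eventually_gt_atTop 0] with N hN
  have hne : Nonempty (Σ x : Fin k, Fin (c N x)) := ⟨⟨⟨0, hk⟩, ⟨0, by simp [c]⟩⟩⟩
  have := sum_conjMap_mem_TO E T (ι := Σ x : Fin k, Fin (c N x)) (u := fun x => u x.1)
    fun x => hu x.1
  convert this using 1
  rw [Fintype.sum_sigma, Fintype.card_sigma, Finset.smul_sum]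
  refine Finset.sum_congr rfl fun x _ => ?_
  have hN' : (N : ℂ) ≠ 0 := by exact_mod_cast hN.ne'
  simp only [Finset.sum_const, Finset.card_univ, Fintype.card_fin, ← Nat.cast_smul_eq_nsmul ℂ,
    smul_smul, ← Finset.sum_div]
  congr 1
  push_cast
  field_simp

/-- The quaternion units `1, iσ_x, iσ_y, iσ_z` as the columns of a matrix. -/
noncomputable def quaternionUnits : Matrix (Fin 2 × Fin 2) (Fin 4) ℂ :=
  Matrix.of fun x α => (![(1 : Matrix (Fin 2) (Fin 2) ℂ), !![0, Complex.I; Complex.I, 0],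
    !![0, 1; -1, 0], !![Complex.I, 0; 0, -Complex.I]] α) x.1 x.2

theorem quaternionUnits_mul_conjTranspose :
    quaternionUnits * quaternionUnits.conjTranspose = (2 : ℂ) • 1 := by
  ext ⟨i, p⟩ ⟨j, q⟩
  fin_cases i <;> fin_cases p <;> fin_cases j <;> fin_cases q <;>
    simp [Matrix.mul_apply, Fin.sum_univ_four, quaternionUnits] <;> norm_num

/-- A real combination of the quaternion units is a quaternion, and multiplying it by its conjugate
gives its norm. Hence it is a non-negative multiple of a unitary. -/
theorem real_combination_mul_conjTranspose (b : Fin 4 → ℝ) :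
    let W : Matrix (Fin 2) (Fin 2) ℂ :=
      Matrix.of fun i p => ∑ α, quaternionUnits (i, p) α * (b α : ℂ)
    W * W.conjTranspose = ((∑ α, b α ^ 2 : ℝ) : ℂ) • 1 := by
  intro W
  ext i j
  fin_cases i <;> fin_cases j <;>
    simp [W, Matrix.mul_apply, Fin.sum_univ_four, quaternionUnits] <;> ring_nf <;> simp <;> ring

open scoped MatrixOrder Matrix.Norms.L2Operator in
theorem exists_eq_conjTranspose_mul_self {ι : Type*} [Fintype ι] [DecidableEq ι]
    {A : Matrix ι ι ℝ} (hA : A.PosSemidef) : ∃ B : Matrix ι ι ℝ, A = B.conjTranspose * B :=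
  CStarAlgebra.nonneg_iff_eq_star_mul_self.mp hA.nonneg

theorem conjMap_single_apply (u : Matrix (Fin 2) (Fin 2) ℂ) (p q i j : Fin 2) :
    conjMap u (Matrix.single p q 1) i j = u i p * conj (u j q) := by
  simp [conjMap_apply, Matrix.mul_apply, Matrix.single_apply, ite_and]

/-- For a unital trace preserving map the Choi matrix is real in the basis of quaternion units. A
real positive semidefinite matrix factors over ℝ, and the rows of the factor are the real
coefficients of the Kraus operators. -/
theorem exists_real_kraus {S : Superop (Fin 2)} (hS : IsCPTP S) (h1 : S 1 = 1) :
    ∃ b : Fin 4 → Fin 4 → ℝ, ∀ ρ, S ρ = ∑ k, conjMap (Matrix.of fun i p =>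
      ∑ α, quaternionUnits (i, p) α * (b k α : ℂ)) ρ := by
  let C : Matrix (Fin 2 × Fin 2) (Fin 2 × Fin 2) ℂ :=
    Matrix.of fun x y => S (Matrix.single x.2 y.2 1) x.1 y.1
  have hC : C.PosSemidef := by
    have h := posSemidef_choi hS (k := 2) (fun i => Pi.single i 1)
    convert h using 5 with x y
    ext i j
    simp [Matrix.vecMulVec_apply, Matrix.single_apply, Pi.single_apply, eq_comm, ite_and]
    split_ifs <;> rfl
  have htp (p q : Fin 2) : C (0, p) (0, q) + C (1, p) (1, q) = if p = q then 1 else 0 := by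
    have := hS.2 (Matrix.single p q 1)
    rw [Matrix.trace_fin_two] at this
    rw [show C (0, p) (0, q) + C (1, p) (1, q) = _ from this, Matrix.trace_fin_two]
    fin_cases p <;> fin_cases q <;> simp
  have hun (i j : Fin 2) : C (i, 0) (j, 0) + C (i, 1) (j, 1) = if i = j then 1 else 0 := by
    have : S (Matrix.single 0 0 1) + S (Matrix.single 1 1 1) = 1 := by
      rw [← map_add, ← h1]
      congr 1
      ext i j
      fin_cases i <;> fin_cases j <;> simp
    have := congrFun (congrFun this i) j
    rw [Matrix.one_apply] at this
    exact this
  have hherm (x y : Fin 2 × Fin 2) : star (C x y) = C y x := hC.isHermitian.apply y x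
  let R : Matrix (Fin 4) (Fin 4) ℂ :=
    (4⁻¹ : ℂ) • (quaternionUnits.conjTranspose * C * quaternionUnits)
  have hCR : C = quaternionUnits * R * quaternionUnits.conjTranspose := by
    have : quaternionUnits * R * quaternionUnits.conjTranspose = (4⁻¹ : ℂ) •
        ((quaternionUnits * quaternionUnits.conjTranspose) * C *
          (quaternionUnits * quaternionUnits.conjTranspose)) := by
      simp only [R, Matrix.mul_smul, Matrix.smul_mul, Matrix.mul_assoc]
    rw [this, quaternionUnits_mul_conjTranspose]
    simp only [Matrix.smul_mul, Matrix.mul_smul, Matrix.one_mul, Matrix.mul_one, smul_smul]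
    norm_num
  have hR : R.PosSemidef := (hC.conjTranspose_mul_mul_same _).smul (by
    rw [Complex.le_def]; norm_num)
  -- Trace preservation and unitality give the six linear relations `e1` to `e6` between entries of
  -- `C`. With Hermiticity they turn the conjugate of an entry of `R` back into the same linear
  -- expression.
  have hreal (α β : Fin 4) : conj (R α β) = R α β := by
    have e1 : C (1, 1) (1, 1) = C (0, 0) (0, 0) := by
      have h1 := htp 0 0; have h2 := hun 1 1; simp at h1 h2; linear_combination h2 - h1
    have e2 : C (1, 0) (1, 0) = C (0, 1) (0, 1) := by
      have h1 := htp 0 0; have h2 := hun 0 0; simp at h1 h2; linear_combination h1 - h2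
    have e3 : C (1, 0) (1, 1) = - C (0, 0) (0, 1) := by
      have := htp 0 1; simp at this; linear_combination this
    have e4 : C (1, 1) (1, 0) = - C (0, 1) (0, 0) := by
      have := htp 1 0; simp at this; linear_combination this
    have e5 : C (0, 1) (1, 1) = - C (0, 0) (1, 0) := by
      have := hun 0 1; simp at this; linear_combination this
    have e6 : C (1, 1) (0, 1) = - C (1, 0) (0, 0) := by
      have := hun 1 0; simp at this; linear_combination this
    have hh (x y : Fin 2 × Fin 2) : conj (C x y) = C y x := hherm x y
    have h4 : conj (4⁻¹ : ℂ) = 4⁻¹ := by rw [map_inv₀, Complex.conj_ofNat]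
    simp only [h4, R, Matrix.smul_apply, Matrix.mul_apply, Fintype.sum_prod_type, Fin.sum_univ_two,
      smul_eq_mul, map_mul, map_add, hh, e1, e2, e3, e4, e5, e6, Matrix.conjTranspose_apply, map_neg]
    fin_cases α <;> fin_cases β <;> simp [quaternionUnits] <;> ring
  let Q : Matrix (Fin 4) (Fin 4) ℝ := Matrix.of fun α β => (R α β).re
  have hRQ (α β : Fin 4) : R α β = (Q α β : ℂ) := (Complex.conj_eq_iff_re.mp (hreal α β)).symm
  have hQ : Q.PosSemidef := by
    rw [Matrix.posSemidef_iff_dotProduct_mulVec] at hR ⊢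
    refine ⟨?_, fun x => ?_⟩
    · ext α β
      have := hR.1.apply α β
      rw [hRQ, hRQ] at this
      simpa using this
    · have := hR.2 fun α => (x α : ℂ)
      have h2 : (star fun α => (x α : ℂ)) ⬝ᵥ R.mulVec (fun α => (x α : ℂ)) =
          ((star x ⬝ᵥ Q.mulVec x : ℝ) : ℂ) := by
        simp [dotProduct, Matrix.mulVec, hRQ]
      rw [h2] at this
      exact_mod_cast this
  obtain ⟨B, hB⟩ := exists_eq_conjTranspose_mul_self hQ
  let N : Matrix (Fin 2 × Fin 2) (Fin 4) ℂ := quaternionUnits * (B.map Complex.ofReal).conjTranspose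
  have hCN : C = N * N.conjTranspose := by
    have : R = (B.map Complex.ofReal).conjTranspose * B.map Complex.ofReal := by
      ext α β
      rw [hRQ, hB]
      simp [Matrix.mul_apply]
    rw [hCR, this]
    simp [N, Matrix.mul_assoc]
  refine ⟨B, fun ρ => ?_⟩
  have hsingle (p q : Fin 2) : S (Matrix.single p q 1) = ∑ k, conjMap (Matrix.of fun i p =>
      ∑ α, quaternionUnits (i, p) α * (B k α : ℂ)) (Matrix.single p q 1) := by
    ext i j
    rw [Matrix.sum_apply]
    simp only [conjMap_single_apply]
    have := congrFun (congrFun hCN (i, p)) (j, q)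
    rw [Matrix.mul_apply] at this
    simpa [N, C, Matrix.mul_apply] using this
  have hρ : ρ = ∑ p, ∑ q, ρ p q • Matrix.single p q (1 : ℂ) := by
    conv_lhs => rw [Matrix.matrix_eq_sum_single ρ]
    simp
  rw [hρ]
  simp only [map_sum, map_smul, hsingle, Finset.smul_sum]
  exact (Finset.sum_congr rfl fun p _ => Finset.sum_comm).trans Finset.sum_comm

/-- For a scalar Hamiltonian the Boltzmann operator is a positive multiple of the identity, so its
preservation is unitality, and the real Kraus operators exhibit the map as a convex combination of
unitary conjugations. -/
theorem EnTO_subset_closure_TO_of_scalar (E : ℝ) (T : ℝ≥0∞) :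
    EnTO ((E : ℂ) • 1 : Matrix (Fin 2) (Fin 2) ℂ) T ⊆
      closure (TO ((E : ℂ) • 1 : Matrix (Fin 2) (Fin 2) ℂ) T) := by
  rintro S ⟨hS, hg, -⟩
  have h1 : S 1 = 1 := by
    have hb : boltzmann ((E : ℂ) • 1 : Matrix (Fin 2) (Fin 2) ℂ) T =
        ((Real.exp (-(invTemp T * E)) : ℝ) : ℂ) • 1 := by
      have := boltzmann_diagonal (fun _ : Fin 2 => E) T
      rw [← Matrix.smul_one_eq_diagonal, ← Matrix.smul_one_eq_diagonal] at this
      exact this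
    rw [hb, map_smul] at hg
    have hne : ((Real.exp (-(invTemp T * E)) : ℝ) : ℂ) ≠ 0 := by
      exact_mod_cast (Real.exp_pos _).ne'
    exact smul_right_injective _ hne hg
  obtain ⟨b, hb⟩ := exists_real_kraus hS h1
  let W (k : Fin 4) : Matrix (Fin 2) (Fin 2) ℂ :=
    Matrix.of fun i p => ∑ α, quaternionUnits (i, p) α * (b k α : ℂ)
  let w (k : Fin 4) : ℝ := ∑ α, b k α ^ 2
  have hw (k : Fin 4) : 0 ≤ w k := Finset.sum_nonneg fun α _ => sq_nonneg _
  have hWW (k : Fin 4) : W k * (W k).conjTranspose = (w k : ℂ) • 1 :=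
    real_combination_mul_conjTranspose (b k)
  have hw1 : ∑ k, w k = 1 := by
    have h := hb 1
    rw [h1] at h
    simp only [conjMap_apply, Matrix.mul_one] at h
    have h2 := congrArg Matrix.trace h
    rw [Matrix.trace_sum] at h2
    simp only [show ∀ k, (Matrix.of fun i p => ∑ α, quaternionUnits (i, p) α * (b k α : ℂ)) *
      (Matrix.of fun i p => ∑ α, quaternionUnits (i, p) α * (b k α : ℂ)).conjTranspose =
        (w k : ℂ) • 1 from hWW, Matrix.trace_smul, Matrix.trace_one, smul_eq_mul,
        ← Finset.sum_mul] at h2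
    have h3 : (∑ k, (w k : ℂ)) = 1 := by
      simp only [Fintype.card_fin] at h2
      push_cast at h2
      linear_combination -h2 / 2
    exact_mod_cast h3
  -- Weight zero forces `W k = 0`, so any unitary will do; otherwise `W k` divided by the root of
  -- its weight is unitary.
  have hex (k : Fin 4) : ∃ u ∈ Matrix.unitaryGroup (Fin 2) ℂ,
      conjMap (W k) = (w k : ℂ) • conjMap u := by
    rcases (hw k).eq_or_lt with h0 | h0
    · refine ⟨1, one_mem _, ?_⟩
      have h2 := hWW k
      rw [← h0, Complex.ofReal_zero, zero_smul, Matrix.self_mul_conjTranspose_eq_zero] at h2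
      ext1 ρ
      simp [conjMap_apply, h2, ← h0]
    · have hs : ((Real.sqrt (w k) : ℝ) : ℂ) * ((Real.sqrt (w k) : ℝ) : ℂ) = (w k : ℂ) := by
        rw [← Complex.ofReal_mul, Real.mul_self_sqrt (hw k)]
      have hs0 : ((Real.sqrt (w k) : ℝ) : ℂ) ≠ 0 := by
        exact_mod_cast (Real.sqrt_pos.mpr h0).ne'
      refine ⟨((Real.sqrt (w k) : ℝ) : ℂ)⁻¹ • W k, ?_, ?_⟩
      · rw [Matrix.mem_unitaryGroup_iff, Matrix.star_eq_conjTranspose, Matrix.conjTranspose_smul,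
          Matrix.smul_mul, Matrix.mul_smul, hWW, smul_smul, smul_smul, star_inv₀]
        rw [Complex.star_def, Complex.conj_ofReal, ← hs]
        field_simp
        simp
      · ext1 ρ
        rw [FunLike.coe_smul, Pi.smul_apply, conjMap_apply, conjMap_apply,
          Matrix.conjTranspose_smul, Matrix.smul_mul, Matrix.mul_smul, Matrix.smul_mul, smul_smul,
          smul_smul, star_inv₀, Complex.star_def, Complex.conj_ofReal, ← hs]
        field_simp
        simp
  choose u hu hWu using hex
  have : S = ∑ k, (w k : ℂ) • conjMap (u k) := by
    ext1 ρ
    rw [hb]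
    simp only [← hWu]
    simp [W]
  rw [this]
  exact convex_combination_conjMap_mem_closure E T hu w hw hw1

end Unital

end ThermalOps

namespace ThermalOps

/-! ### Canonical form of enhanced thermal operations -/

section Gibbs

variable {H : Matrix (Fin 2) (Fin 2) ℂ} {g : QubitBasis} {E : Fin 2 → ℝ} {T : ℝ≥0∞}

theorem invTemp_nonneg (T : ℝ≥0∞) : 0 ≤ invTemp T := ENNReal.toReal_nonneg

theorem matrixElement_conj_diagonal (d : Fin 2 → ℂ) (a b : Fin 2) :
    matrixElement g (basisMatrix g * Matrix.diagonal d * (basisMatrix g).conjTranspose) a b =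
      if a = b then d a else 0 := by
  rw [matrixElement_eq, show (basisMatrix g).conjTranspose * (basisMatrix g * Matrix.diagonal d *
    (basisMatrix g).conjTranspose) * basisMatrix g = ((basisMatrix g).conjTranspose *
      basisMatrix g) * Matrix.diagonal d * ((basisMatrix g).conjTranspose * basisMatrix g) by
      simp only [Matrix.mul_assoc], basisMatrix_star_mul, Matrix.one_mul, Matrix.mul_one,
      Matrix.diagonal_apply]

theorem boltzmann_conj_diagonal
    (h : H = basisMatrix g * Matrix.diagonal (fun j => (E j : ℂ)) * (basisMatrix g).conjTranspose)
    (T : ℝ≥0∞) :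
    boltzmann H T = basisMatrix g *
      Matrix.diagonal (fun j => ((Real.exp (-(invTemp T * E j)) : ℝ) : ℂ)) *
      (basisMatrix g).conjTranspose := by
  have hinv : (basisMatrix g).conjTranspose = (basisMatrix g)⁻¹ :=
    (Matrix.inv_eq_right_inv (basisMatrix_mul_star g)).symm
  rw [← boltzmann_diagonal, boltzmann, boltzmann, hinv, ← Matrix.exp_conj _ _
    (IsUnit.of_mul_eq_one _ (basisMatrix_mul_star g)), ← hinv, h]
  simp

theorem posSemidef_matrixElement {S : Superop (Fin 2)} (hS : IsCPTP S) (g : QubitBasis) :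
    (Matrix.of fun x y : Fin 2 × Fin 2 =>
      matrixElement g (S (ketBra g x.2 y.2)) x.1 y.1).PosSemidef := by
  have h := posSemidef_choi hS (k := 2) (fun j => (g j).ofLp)
  have h2 := h.conjTranspose_mul_mul_same (basisMatrix g ⊗ₖ (1 : Matrix (Fin 2) (Fin 2) ℂ))
  convert h2 using 1
  ext ⟨a, j⟩ ⟨b, k⟩
  rw [Matrix.of_apply, matrixElement_eq]
  simp only [Matrix.mul_apply, Fintype.sum_prod_type, Matrix.conjTranspose_kronecker,
      Matrix.kroneckerMap_apply, Matrix.conjTranspose_one, Matrix.one_apply, Matrix.of_apply,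
      ketBra]
  simp

/-- Covariance decides which entries of the Choi matrix may be non-zero, trace and Gibbs
preservation express the diagonal through λ, and one 2 × 2 minor bounds c. -/
theorem EnTO.exists_canonical (hg : IsOrderedEigenbasis H g) {S : Superop (Fin 2)}
    (hS : S ∈ EnTO H T) :
    ∃ (l : ℝ) (c : ℂ), 0 ≤ l ∧ l ≤ 1 ∧
      ‖c‖ ^ 2 ≤ (1 - l) * (1 - l * boltzmannFactor H T) ∧
      S = canonicalMap g (boltzmannFactor H T) l c := by
  obtain ⟨E, hE, hgap, hH⟩ := hg.exists_eq
  obtain ⟨hcp, hgibbs, hcov⟩ := hS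
  set m : Fin 2 → Fin 2 → Fin 2 → Fin 2 → ℂ :=
    fun j k a b => matrixElement g (S (ketBra g j k)) a b with hm
  have hHe (a b : Fin 2) : matrixElement g H a b = if a = b then (E a : ℂ) else 0 := by
    rw [hH, matrixElement_conj_diagonal]
  -- |g_j⟩⟨g_k| is an eigenvector of [H, ·] with eigenvalue E j - E k. A covariant map preserves
  -- this eigenvalue, so only matrix elements with the same Bohr frequency survive.
  have hzero (j k a b : Fin 2) : ((E j : ℂ) - E k - (E a - E b)) * m j k a b = 0 := by
    have h1 : H * ketBra g j k - ketBra g j k * H = ((E j : ℂ) - E k) • ketBra g j k := by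
      refine matrixElement_ext g fun a b => ?_
      rw [sub_eq_add_neg, ← neg_one_smul ℂ (ketBra g j k * H)]
      simp only [matrixElement_add, matrixElement_smul, matrixElement_mul, matrixElement_ketBra,
        hHe]
      by_cases h1 : a = j <;> by_cases h2 : b = k <;> simp [h1, h2, sub_eq_add_neg]
    have h2 := congrArg (fun X => matrixElement g X a b) (hcov (ketBra g j k))
    simp only [h1, map_smul] at h2
    rw [sub_eq_add_neg (H * _), ← neg_one_smul ℂ (_ * H)] at h2
    simp only [matrixElement_add, matrixElement_smul, matrixElement_mul, hHe] at h2
    simp only [ite_mul, mul_ite, zero_mul, mul_zero, Finset.sum_ite_eq, Finset.sum_ite_eq',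
      Finset.mem_univ, if_true] at h2
    simp only [hm]
    linear_combination h2
  have hne : (E 1 : ℂ) - E 0 ≠ 0 := by
    rw [← Complex.ofReal_sub]; exact_mod_cast (sub_pos.mpr hE).ne'
  have hz {j k a b : Fin 2} (h : (E j : ℂ) - E k - (E a - E b) ≠ 0) : m j k a b = 0 :=
    (mul_eq_zero.mp (hzero j k a b)).resolve_left h
  have hd0 (j : Fin 2) : m j j 0 1 = 0 := hz (by simpa using hne)
  have hd1 (j : Fin 2) : m j j 1 0 = 0 := hz (by
    rw [sub_self, zero_sub]; exact neg_ne_zero.mpr hne)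
  have ho (a : Fin 2) : m 0 1 a a = 0 := hz (by
    rw [sub_self, sub_zero, ← neg_sub]; exact neg_ne_zero.mpr hne)
  have ho' (a : Fin 2) : m 1 0 a a = 0 := hz (by
    rw [sub_self, sub_zero]; exact hne)
  have h2ne : (2 : ℂ) * ((E 1 : ℂ) - E 0) ≠ 0 := mul_ne_zero two_ne_zero hne
  have hx : m 0 1 1 0 = 0 := hz (by
    rw [show (E 0 : ℂ) - E 1 - (E 1 - E 0) = -(2 * ((E 1 : ℂ) - E 0)) by ring]
    exact neg_ne_zero.mpr h2ne)
  have hx' : m 1 0 0 1 = 0 := hz (by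
    rw [show (E 1 : ℂ) - E 0 - (E 0 - E 1) = 2 * ((E 1 : ℂ) - E 0) by ring]
    exact h2ne)
  have htr (j : Fin 2) : m j j 0 0 + m j j 1 1 = 1 := by
    have := hcp.2 (ketBra g j j)
    rw [trace_eq_matrixElement g, trace_eq_matrixElement g] at this
    rw [show m j j 0 0 + m j j 1 1 = _ from this]
    simp only [matrixElement_ketBra]
    fin_cases j <;> simp
  have hP := posSemidef_matrixElement hcp g
  have hnn (j a : Fin 2) : 0 ≤ m j j a a := hP.diag_nonneg (i := (a, j))
  have hherm : m 1 0 1 0 = conj (m 0 1 0 1) := (hP.isHermitian.apply (1, 1) (0, 0)).symm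
  -- The minor on the rows that contain the coherence; it becomes |c|² ≤ (1-λ)(1-λq).
  have hdet : 0 ≤ m 0 0 0 0 * m 1 1 1 1 - m 0 1 0 1 * m 1 0 1 0 := by
    have := (hP.submatrix ![((0 : Fin 2), (0 : Fin 2)), (1, 1)]).det_nonneg
    rw [Matrix.det_fin_two] at this
    simpa [hm] using this
  have hb := boltzmann_conj_diagonal hH T
  have hG : ((Real.exp (-(invTemp T * E 0)) : ℝ) : ℂ) * m 0 0 0 0 +
      ((Real.exp (-(invTemp T * E 1)) : ℝ) : ℂ) * m 1 1 0 0 =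
      ((Real.exp (-(invTemp T * E 0)) : ℝ) : ℂ) := by
    have h1 := congrArg (fun X => matrixElement g X 0 0) hgibbs
    beta_reduce at h1
    rw [sum_ketBra g (boltzmann H T)] at h1
    simp only [Fin.sum_univ_two, map_add, map_smul, hb, matrixElement_conj_diagonal,
      matrixElement_add, matrixElement_smul, matrixElement_ketBra] at h1
    simpa using h1
  have hq : ((Real.exp (-(invTemp T * E 1)) : ℝ) : ℂ) =
      ((Real.exp (-(invTemp T * E 0)) : ℝ) : ℂ) * ((boltzmannFactor H T : ℝ) : ℂ) := by
    rw [← Complex.ofReal_mul, boltzmannFactor, ← Real.exp_add, hgap]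
    congr 2
    ring
  have hl : m 1 1 0 0 = ((m 1 1 0 0).re : ℂ) := Complex.eq_re_of_ofReal_le (hnn 1 0)
  set l : ℝ := (m 1 1 0 0).re with hldef
  set q := boltzmannFactor H T with hqdef
  have h00 : m 0 0 0 0 = ((1 - l * q : ℝ) : ℂ) := by
    rw [hq, hl] at hG
    have he : ((Real.exp (-(invTemp T * E 0)) : ℝ) : ℂ) ≠ 0 := by
      exact_mod_cast (Real.exp_pos _).ne'
    apply mul_left_cancel₀ he
    push_cast at hG ⊢
    linear_combination hG
  have h11 : m 1 1 1 1 = ((1 - l : ℝ) : ℂ) := by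
    have := htr 1
    rw [hl] at this
    push_cast
    linear_combination this
  have h01 : m 0 0 1 1 = ((l * q : ℝ) : ℂ) := by
    have := htr 0
    rw [h00] at this
    push_cast at this ⊢
    linear_combination this
  refine ⟨l, m 0 1 0 1, ?_, ?_, ?_, ?_⟩
  · have := hnn 1 0
    rw [hl] at this
    exact_mod_cast this
  · have := hnn 1 1
    rw [h11] at this
    have : 0 ≤ 1 - l := by exact_mod_cast this
    linarith
  · rw [h00, h11, hherm, Complex.mul_conj, Complex.normSq_eq_norm_sq, ← Complex.ofReal_mul,
      ← Complex.ofReal_sub] at hdet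
    have : 0 ≤ (1 - l * q) * (1 - l) - ‖m 0 1 0 1‖ ^ 2 := by exact_mod_cast hdet
    linarith
  · refine superop_ext g fun j k a b => ?_
    rw [canonicalMap, matrixElement_covMap]
    simp only [matrixElement_ketBra]
    change m j k a b = _
    fin_cases j <;> fin_cases k <;> fin_cases a <;> fin_cases b <;>
      simp [h00, h11, h01, hl, hherm, hx, hx', ho, ho', hd0, hd1]

theorem boltzmannFactor_pos (H : Matrix (Fin 2) (Fin 2) ℂ) (T : ℝ≥0∞) :
    0 < boltzmannFactor H T := Real.exp_pos _

theorem IsOrderedEigenbasis.energyGap_pos (hg : IsOrderedEigenbasis H g) : 0 < energyGap H := by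
  obtain ⟨E, hE, hgap, -⟩ := hg.exists_eq
  rw [hgap]; linarith

theorem IsOrderedEigenbasis.boltzmannFactor_le_one (hg : IsOrderedEigenbasis H g) (T : ℝ≥0∞) :
    boltzmannFactor H T ≤ 1 := by
  rw [boltzmannFactor, Real.exp_le_one_iff, neg_nonpos]
  exact mul_nonneg (invTemp_nonneg T) hg.energyGap_pos.le

end Gibbs

end ThermalOps

namespace ThermalOps

/-! ### Block form of energy-conserving unitaries and the strict coherence bound -/

section Blocks

variable {H : Matrix (Fin 2) (Fin 2) ℂ} {g : QubitBasis} {E : Fin 2 → ℝ} {T : ℝ≥0∞}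

/-- `V ⊗ 1`, where the columns of `V` are the basis vectors. -/
noncomputable def basisLift (g : QubitBasis) (m : ℕ) : Matrix (Fin 2 × Fin m) (Fin 2 × Fin m) ℂ :=
  basisMatrix g ⊗ₖ (1 : Matrix (Fin m) (Fin m) ℂ)

theorem basisLift_star_mul (g : QubitBasis) (m : ℕ) :
    (basisLift g m).conjTranspose * basisLift g m = 1 := by
  rw [basisLift, Matrix.conjTranspose_kronecker, ← Matrix.mul_kronecker_mul, basisMatrix_star_mul]
  simp

theorem basisLift_mul_star (g : QubitBasis) (m : ℕ) :
    basisLift g m * (basisLift g m).conjTranspose = 1 :=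
  mul_eq_one_comm.mp (basisLift_star_mul g m)

/-- The block `⟨i|_S U |k⟩_S`. -/
def systemBlock {m : ℕ} (U : Matrix (Fin 2 × Fin m) (Fin 2 × Fin m) ℂ) (i k : Fin 2) :
    Matrix (Fin m) (Fin m) ℂ :=
  Matrix.of fun a b => U (i, a) (k, b)

theorem matrixElement_partialTrace {m : ℕ} (g : QubitBasis)
    (X : Matrix (Fin 2 × Fin m) (Fin 2 × Fin m) ℂ) (i l : Fin 2) :
    matrixElement g (partialTrace X) i l =
      (systemBlock ((basisLift g m).conjTranspose * X * basisLift g m) i l).trace := by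
  rw [matrixElement_eq]
  simp only [systemBlock, Matrix.trace, Matrix.diag_apply, Matrix.of_apply, basisLift,
    Matrix.mul_apply, Fintype.sum_prod_type, Matrix.conjTranspose_kronecker,
    Matrix.kroneckerMap_apply, Matrix.conjTranspose_one, Matrix.one_apply, partialTrace]
  simp [Finset.mul_sum, Finset.sum_add_distrib, add_mul, Finset.sum_mul]

/-- After passing to the eigenbasis every parameter of a dilation is a Hilbert–Schmidt product of
two system blocks, weighted by the bath state. This is what makes Cauchy–Schwarz applicable. -/
theorem matrixElement_dilation {m : ℕ} (g : QubitBasis) (ω : Matrix (Fin m) (Fin m) ℂ)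
    (U : Matrix (Fin 2 × Fin m) (Fin 2 × Fin m) ℂ) (i j k l : Fin 2) :
    matrixElement g (dilation ω (basisLift g m * U * (basisLift g m).conjTranspose)
      (ketBra g j k)) i l =
      (systemBlock U i j * ω * (systemBlock U l k).conjTranspose).trace := by
  rw [dilation_apply, matrixElement_partialTrace]
  have h1 : ketBra g j k ⊗ₖ ω = basisLift g m * (Matrix.single j k 1 ⊗ₖ ω) *
      (basisLift g m).conjTranspose := by
    rw [ketBra_eq, basisLift, Matrix.conjTranspose_kronecker, ← Matrix.mul_kronecker_mul,
      ← Matrix.mul_kronecker_mul]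
    simp
  have h2 : (basisLift g m).conjTranspose *
      (basisLift g m * U * (basisLift g m).conjTranspose * (ketBra g j k ⊗ₖ ω) *
      (basisLift g m * U * (basisLift g m).conjTranspose).conjTranspose) * basisLift g m =
      U * (Matrix.single j k 1 ⊗ₖ ω) * U.conjTranspose := by
    rw [h1]
    simp only [Matrix.conjTranspose_mul, Matrix.conjTranspose_conjTranspose, Matrix.mul_assoc]
    rw [basisLift_star_mul, Matrix.mul_one]
    simp only [← Matrix.mul_assoc]
    rw [basisLift_star_mul, Matrix.one_mul]
    simp only [Matrix.mul_assoc]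
    rw [← Matrix.mul_assoc (basisLift g m).conjTranspose, basisLift_star_mul, Matrix.one_mul,
      ← Matrix.mul_assoc (basisLift g m).conjTranspose, basisLift_star_mul, Matrix.one_mul]
  rw [h2]
  simp only [Matrix.trace, Matrix.diag_apply]
  refine Finset.sum_congr rfl fun a _ => ?_
  simp only [systemBlock, Matrix.mul_apply, Fintype.sum_prod_type, Matrix.kroneckerMap_apply,
    Matrix.of_apply, Matrix.conjTranspose_apply, Matrix.single_apply]
  fin_cases j <;> fin_cases k <;> simp

theorem totalHamiltonian_basisLift {m : ℕ}
    (h : H = basisMatrix g * Matrix.diagonal (fun j => (E j : ℂ)) * (basisMatrix g).conjTranspose)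
    (HB : Matrix (Fin m) (Fin m) ℂ) :
    totalHamiltonian H HB = basisLift g m *
      totalHamiltonian (Matrix.diagonal fun j => (E j : ℂ)) HB *
      (basisLift g m).conjTranspose := by
  rw [totalHamiltonian, totalHamiltonian, Matrix.mul_add, Matrix.add_mul, basisLift,
    Matrix.conjTranspose_kronecker]
  simp only [← Matrix.mul_kronecker_mul, ← h, Matrix.conjTranspose_one, Matrix.mul_one,
    Matrix.one_mul, basisMatrix_mul_star]

theorem energyConserving_basisLift {m : ℕ}
    (h : H = basisMatrix g * Matrix.diagonal (fun j => (E j : ℂ)) * (basisMatrix g).conjTranspose)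
    {HB : Matrix (Fin m) (Fin m) ℂ} {U : Matrix (Fin 2 × Fin m) (Fin 2 × Fin m) ℂ}
    (hU : EnergyConserving (Matrix.diagonal fun j => (E j : ℂ)) HB U) :
    EnergyConserving H HB (basisLift g m * U * (basisLift g m).conjTranspose) := by
  have hu : basisLift g m ∈ Matrix.unitaryGroup (Fin 2 × Fin m) ℂ :=
    Matrix.mem_unitaryGroup_iff.mpr (basisLift_mul_star g m)
  have hu' : (basisLift g m).conjTranspose ∈ Matrix.unitaryGroup (Fin 2 × Fin m) ℂ :=
    Matrix.mem_unitaryGroup_iff'.mpr (by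
      rw [Matrix.star_eq_conjTranspose, Matrix.conjTranspose_conjTranspose]
      exact basisLift_mul_star g m)
  refine ⟨mul_mem (mul_mem hu hU.1) hu', ?_⟩
  have h2 := hU.2
  rw [totalHamiltonian_basisLift h]
  conv_rhs => rw [← h2]
  simp only [Matrix.conjTranspose_mul, Matrix.conjTranspose_conjTranspose, Matrix.mul_assoc]
  rw [← Matrix.mul_assoc (basisLift g m).conjTranspose (basisLift g m), basisLift_star_mul,
    Matrix.one_mul, ← Matrix.mul_assoc (basisLift g m).conjTranspose (basisLift g m),
    basisLift_star_mul, Matrix.one_mul]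

theorem exists_basisLift {m : ℕ}
    (h : H = basisMatrix g * Matrix.diagonal (fun j => (E j : ℂ)) * (basisMatrix g).conjTranspose)
    {HB : Matrix (Fin m) (Fin m) ℂ} {U : Matrix (Fin 2 × Fin m) (Fin 2 × Fin m) ℂ}
    (hU : EnergyConserving H HB U) :
    ∃ U', EnergyConserving (Matrix.diagonal fun j => (E j : ℂ)) HB U' ∧
      U = basisLift g m * U' * (basisLift g m).conjTranspose := by
  have hu : basisLift g m ∈ Matrix.unitaryGroup (Fin 2 × Fin m) ℂ :=
    Matrix.mem_unitaryGroup_iff.mpr (basisLift_mul_star g m)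
  have hu' : (basisLift g m).conjTranspose ∈ Matrix.unitaryGroup (Fin 2 × Fin m) ℂ :=
    Matrix.mem_unitaryGroup_iff'.mpr (by
      rw [Matrix.star_eq_conjTranspose, Matrix.conjTranspose_conjTranspose]
      exact basisLift_mul_star g m)
  refine ⟨(basisLift g m).conjTranspose * U * basisLift g m,
    ⟨mul_mem (mul_mem hu' hU.1) hu, ?_⟩, ?_⟩
  · have h2 := hU.2
    rw [totalHamiltonian_basisLift h] at h2
    have h3 := congrArg (fun X => (basisLift g m).conjTranspose * X * basisLift g m) h2
    simp only [Matrix.conjTranspose_mul, Matrix.conjTranspose_conjTranspose, Matrix.mul_assoc]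
    simp only [Matrix.mul_assoc] at h3
    rw [basisLift_star_mul, Matrix.mul_one, ← Matrix.mul_assoc _ (basisLift g m) (totalHamiltonian _ _),
      basisLift_star_mul, Matrix.one_mul] at h3
    exact h3
  · rw [← Matrix.mul_assoc, ← Matrix.mul_assoc, basisLift_mul_star, Matrix.one_mul, Matrix.mul_assoc,
      basisLift_mul_star, Matrix.mul_one]

theorem trace_mul_conjTranspose_eq {m : ℕ} (X : Matrix (Fin m) (Fin m) ℂ) :
    (X * X.conjTranspose).trace = (((X * X.conjTranspose).trace.re : ℝ) : ℂ) ∧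
      0 ≤ (X * X.conjTranspose).trace.re := by
  have h := (Matrix.posSemidef_self_mul_conjTranspose X).trace_nonneg
  have h1 := Complex.eq_re_of_ofReal_le h
  exact ⟨h1, (Complex.le_def.mp h).1⟩

/-- The equality case of Cauchy–Schwarz: the squared norm of `ny • X - c • Y` is `ny * (nx * ny -
‖c‖ ^ 2)`, which the hypothesis makes non-positive. -/
theorem smul_eq_smul_of_trace_cauchySchwarz {m : ℕ} (X Y : Matrix (Fin m) (Fin m) ℂ)
    (h : (X * X.conjTranspose).trace.re * (Y * Y.conjTranspose).trace.re ≤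
      ‖(X * Y.conjTranspose).trace‖ ^ 2) :
    (Y * Y.conjTranspose).trace • X = (X * Y.conjTranspose).trace • Y := by
  obtain ⟨hx, hx0⟩ := trace_mul_conjTranspose_eq X
  obtain ⟨hy, hy0⟩ := trace_mul_conjTranspose_eq Y
  set nx := (X * X.conjTranspose).trace.re
  set ny := (Y * Y.conjTranspose).trace.re
  set c := (X * Y.conjTranspose).trace with hc
  have hyx : (Y * X.conjTranspose).trace = conj c := by
    rw [hc, ← Complex.star_def, ← Matrix.trace_conjTranspose, Matrix.conjTranspose_mul,
      Matrix.conjTranspose_conjTranspose]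
  let Z := (ny : ℂ) • X - c • Y
  have hZ : (Z * Z.conjTranspose).trace = ((ny * (nx * ny - ‖c‖ ^ 2) : ℝ) : ℂ) := by
    simp only [Z, Matrix.conjTranspose_sub, Matrix.conjTranspose_smul, Matrix.sub_mul,
      Matrix.mul_sub, Matrix.smul_mul, Matrix.mul_smul, Matrix.trace_sub, Matrix.trace_smul,
      smul_eq_mul, hx, hy, hyx, ← hc, Complex.star_def, Complex.conj_ofReal]
    have := Complex.mul_conj c
    rw [Complex.normSq_eq_norm_sq] at this
    push_cast at this ⊢
    linear_combination (-ny : ℂ) * this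
  have hZ0 := (trace_mul_conjTranspose_eq Z).2
  have hle : ny * (nx * ny - ‖c‖ ^ 2) ≤ 0 :=
    mul_nonpos_of_nonneg_of_nonpos hy0 (by linarith)
  have : (Z * Z.conjTranspose).trace = 0 := by
    rw [hZ] at hZ0 ⊢
    rw [Complex.ofReal_re] at hZ0
    rw [le_antisymm hle hZ0, Complex.ofReal_zero]
  rw [Matrix.trace_mul_conjTranspose_self_eq_zero_iff, sub_eq_zero] at this
  rw [hy]
  exact this

/-- If the bound is attained, the blocks A and D are proportional, and unitarity forces AA* = DD*.
Then BB* and B*B have the same mean bath energy, which contradicts that B raises the bath energy by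
the gap, unless B = 0 and therefore λ = 0. -/
theorem thermalMap_strict {m : ℕ} (hg : IsOrderedEigenbasis H g) (hm : 0 < m)
    {HB : Matrix (Fin m) (Fin m) ℂ} (hB : HB.IsHermitian)
    {U : Matrix (Fin 2 × Fin m) (Fin 2 × Fin m) ℂ} (hU : EnergyConserving H HB U)
    {q l : ℝ} {c : ℂ} (hS : thermalMap T HB U = canonicalMap g q l c) (hl : 0 < l) :
    ‖c‖ ^ 2 < (1 - l) * (1 - l * q) := by
  have : Nonempty (Fin m) := ⟨⟨0, hm⟩⟩
  obtain ⟨E, hE, -, hH⟩ := hg.exists_eq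
  obtain ⟨U, hU', rfl⟩ := exists_basisLift hH hU
  obtain ⟨K, hK, -, hKK⟩ := exists_gibbs_sqrt hB T
  have hel (i j k l' : Fin 2) : matrixElement g (canonicalMap g q l c (ketBra g j k)) i l' =
      ((systemBlock U i j * K) * (systemBlock U l' k * K).conjTranspose).trace := by
    rw [← hS, thermalMap, matrixElement_dilation, ← hKK, Matrix.conjTranspose_mul]
    simp only [Matrix.mul_assoc]
  simp only [canonicalMap, matrixElement_covMap, matrixElement_ketBra] at hel
  set A := systemBlock U 0 0 with hA
  set B := systemBlock U 0 1 with hBdef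
  set D := systemBlock U 1 1 with hD
  set C := systemBlock U 1 0 with hCdef
  have h00 : ((A * K) * (A * K).conjTranspose).trace = ((1 - l * q : ℝ) : ℂ) := by
    rw [← hel 0 0 0 0]; simp
  have h11 : ((D * K) * (D * K).conjTranspose).trace = ((1 - l : ℝ) : ℂ) := by
    rw [← hel 1 1 1 1]; simp
  have h01 : ((A * K) * (D * K).conjTranspose).trace = c := by
    rw [← hel 0 0 1 1]; simp
  have hb : ((B * K) * (B * K).conjTranspose).trace = (l : ℂ) := by
    rw [← hel 0 1 1 0]; simp
  by_contra hcon
  push Not at hcon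
  have hprop := smul_eq_smul_of_trace_cauchySchwarz (A * K) (D * K) (by
    rw [h00, h11, h01, Complex.ofReal_re, Complex.ofReal_re]; linarith)
  rw [h11, h01] at hprop
  have hcancel {X Y : Matrix (Fin m) (Fin m) ℂ} (h : X * K = Y * K) : X = Y := by
    obtain ⟨k, rfl⟩ := hK
    have := congrArg (· * ((k⁻¹ :) : Matrix (Fin m) (Fin m) ℂ)) h
    simpa [Matrix.mul_assoc] using this
  have hAD : ((1 - l : ℝ) : ℂ) • A = c • D := hcancel (by
    rw [Matrix.smul_mul, Matrix.smul_mul]; exact hprop)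
  -- unitarity
  have hu1 : U * U.conjTranspose = 1 := Matrix.mem_unitaryGroup_iff.mp hU'.1
  have hu2 : U.conjTranspose * U = 1 := Matrix.mem_unitaryGroup_iff'.mp hU'.1
  have hr : A * A.conjTranspose + B * B.conjTranspose = 1 := by
    ext a b
    have := congrFun (congrFun hu1 (0, a)) (0, b)
    rw [Matrix.mul_apply, Fintype.sum_prod_type, Fin.sum_univ_two] at this
    simpa [Matrix.mul_apply, hA, hBdef, systemBlock, Matrix.one_apply] using this
  have hc1 : B.conjTranspose * B + D.conjTranspose * D = 1 := by
    ext a b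
    have := congrFun (congrFun hu2 (1, a)) (1, b)
    rw [Matrix.mul_apply, Fintype.sum_prod_type, Fin.sum_univ_two] at this
    simpa [Matrix.mul_apply, hD, hBdef, systemBlock, Matrix.one_apply] using this
  have hcomm := hU'.commute.eq
  -- B lowers the system from g₂ to g₁, so it raises the bath energy by E 1 - E 0.
  have hBc : HB * B = B * HB + ((E 1 - E 0 : ℝ) : ℂ) • B := by
    ext a b
    have := congrFun (congrFun hcomm (0, a)) (1, b)
    simp only [totalHamiltonian, Matrix.mul_apply, Fintype.sum_prod_type, Fin.sum_univ_two,
      Matrix.add_apply, Matrix.kroneckerMap_apply, Matrix.one_apply, Matrix.diagonal_apply] at this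
    simp [mul_add, add_mul, Finset.sum_add_distrib] at this
    simp only [Matrix.mul_apply, Matrix.add_apply, Matrix.smul_apply, hBdef, systemBlock,
      Matrix.of_apply, smul_eq_mul]
    push_cast
    linear_combination -this
  have hDc : HB * D = D * HB := by
    ext a b
    have := congrFun (congrFun hcomm (1, a)) (1, b)
    simp only [totalHamiltonian, Matrix.mul_apply, Fintype.sum_prod_type, Fin.sum_univ_two,
      Matrix.add_apply, Matrix.kroneckerMap_apply, Matrix.one_apply, Matrix.diagonal_apply] at this
    simp [mul_add, add_mul, Finset.sum_add_distrib] at this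
    simp only [Matrix.mul_apply, hD, systemBlock, Matrix.of_apply]
    linear_combination -this
  have htr : (A * A.conjTranspose).trace = (D * D.conjTranspose).trace := by
    have e1 := congrArg Matrix.trace hr
    have e2 := congrArg Matrix.trace hc1
    rw [Matrix.trace_add] at e1 e2
    rw [Matrix.trace_mul_comm B] at e1
    rw [Matrix.trace_mul_comm _ D] at e2
    linear_combination e1 - e2
  -- Equal traces force the two proportionality factors to have equal modulus. If D = 0 the trace
  -- identity makes A vanish as well.
  have hAADD : A * A.conjTranspose = D * D.conjTranspose := by
    by_cases hD0 : D = 0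
    · rw [hD0, Matrix.zero_mul, Matrix.trace_zero,
        Matrix.trace_mul_conjTranspose_self_eq_zero_iff] at htr
      rw [htr, hD0]
    · have hd0 : (D * D.conjTranspose).trace ≠ 0 := fun h =>
        hD0 (Matrix.trace_mul_conjTranspose_self_eq_zero_iff.mp h)
      have e : (((1 - l : ℝ) : ℂ) • A) * (((1 - l : ℝ) : ℂ) • A).conjTranspose =
          (c • D) * (c • D).conjTranspose := by rw [hAD]
      simp only [Matrix.conjTranspose_smul, Matrix.smul_mul, Matrix.mul_smul, smul_smul,
        Complex.star_def, Complex.conj_ofReal] at e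
      have e2 := congrArg Matrix.trace e
      rw [Matrix.trace_smul, Matrix.trace_smul, htr, smul_eq_mul, smul_eq_mul] at e2
      have e3 := mul_right_cancel₀ hd0 e2
      rw [← e3] at e
      have hl1 : ((1 - l : ℝ) : ℂ) ≠ 0 := by
        intro h0
        rw [h0] at h11
        rw [Matrix.trace_mul_conjTranspose_self_eq_zero_iff] at h11
        exact hD0 (hcancel (by rw [h11, Matrix.zero_mul]))
      exact smul_right_injective _ (mul_ne_zero hl1 hl1) e
  -- Uses that D commutes with `HB`, so DD* and D*D have the same mean energy. The commutation rule
  -- for B turns this identity into (E 1 - E 0) tr(BB*) = 0.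
  have key : (HB * (B * B.conjTranspose)).trace = (HB * (B.conjTranspose * B)).trace := by
    have e1 := congrArg (fun X => (HB * X).trace) hr
    have e2 := congrArg (fun X => (HB * X).trace) hc1
    simp only [Matrix.mul_add, Matrix.trace_add, hAADD] at e1 e2
    have e3 : (HB * (D * D.conjTranspose)).trace = (HB * (D.conjTranspose * D)).trace := by
      rw [← Matrix.mul_assoc, hDc, Matrix.mul_assoc, Matrix.trace_mul_comm, Matrix.mul_assoc]
    linear_combination e1 - e2 - e3
  rw [← Matrix.mul_assoc, hBc, Matrix.add_mul, Matrix.trace_add, Matrix.smul_mul,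
    Matrix.trace_smul, Matrix.mul_assoc, Matrix.trace_mul_comm, Matrix.mul_assoc,
    add_eq_left, smul_eq_mul, mul_eq_zero, Matrix.trace_mul_conjTranspose_self_eq_zero_iff] at key
  rcases key with h | h
  · have := Complex.ofReal_eq_zero.mp h
    linarith
  · rw [h] at hb
    simp at hb
    exact hl.ne (Complex.ofReal_eq_zero.mp hb.symm).symm

end Blocks

end ThermalOps

namespace ThermalOps

/-! ### Choice of moduli on a truncated ladder -/

section Profiles

/-- A point of the disc of radius r is the midpoint of a chord, whose endpoints lie at the angles ±
arccos(|c|/r) from the direction of c. -/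
theorem exists_unit_average {r : ℝ} {c : ℂ} (hc : ‖c‖ ≤ r) :
    ∃ z z' : ℂ, ‖z‖ = 1 ∧ ‖z'‖ = 1 ∧ c = (r * z + r * z') / 2 := by
  have hr : 0 ≤ r := (norm_nonneg c).trans hc
  have h1 : ‖c‖ / r ≤ 1 := div_le_one_of_le₀ hc hr
  have h2 : -1 ≤ ‖c‖ / r := by linarith [div_nonneg (norm_nonneg c) hr]
  set θ := Real.arccos (‖c‖ / r)
  have hcos : r * Real.cos θ = ‖c‖ := by
    rw [Real.cos_arccos h2 h1]
    rcases hr.eq_or_lt with h | h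
    · rw [← h, zero_mul]
      exact le_antisymm (norm_nonneg c) (h ▸ hc)
    · field_simp
  refine ⟨Complex.exp ((c.arg + θ : ℝ) * Complex.I), Complex.exp ((c.arg - θ : ℝ) * Complex.I),
    Complex.norm_exp_ofReal_mul_I _, Complex.norm_exp_ofReal_mul_I _, ?_⟩
  have h3 : Complex.exp ((c.arg + θ : ℝ) * Complex.I) + Complex.exp ((c.arg - θ : ℝ) * Complex.I) =
      Complex.exp (c.arg * Complex.I) * (2 * ((Real.cos θ : ℝ) : ℂ)) := by
    rw [Complex.ofReal_cos, Complex.cos]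
    push_cast
    rw [add_mul, sub_mul, Complex.exp_add, Complex.exp_sub, neg_mul, Complex.exp_neg]
    field_simp
  rw [← mul_add, h3]
  conv_lhs => rw [← Complex.norm_mul_exp_arg_mul_I c, ← hcos]
  push_cast
  ring

/-- The Gibbs weights of a truncated bath with Boltzmann factor `q`. -/
noncomputable def truncWeight (q : ℝ) (m j : ℕ) : ℝ := q ^ j / ∑ k ∈ Finset.range (m + 1), q ^ k

variable {q : ℝ}

theorem sum_pow_pos (hq : 0 < q) (m : ℕ) : 0 < ∑ k ∈ Finset.range (m + 1), q ^ k :=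
  Finset.sum_pos (fun k _ => pow_pos hq k) ⟨0, by simp⟩

theorem truncWeight_nonneg (hq : 0 < q) (m j : ℕ) : 0 ≤ truncWeight q m j :=
  div_nonneg (pow_pos hq j).le (sum_pow_pos hq m).le

theorem sum_truncWeight (hq : 0 < q) (m : ℕ) :
    ∑ j ∈ Finset.range (m + 1), truncWeight q m j = 1 := by
  simp only [truncWeight]
  rw [← Finset.sum_div, div_self (sum_pow_pos hq m).ne']

/-- Truncation lowers the partition function, so each weight exceeds its value on the infinite
ladder and lower bounds from infinite sums carry over. -/
theorem le_truncWeight (hq : 0 < q) (hq1 : q < 1) (m j : ℕ) :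
    (1 - q) * q ^ j ≤ truncWeight q m j := by
  rw [truncWeight, le_div_iff₀ (sum_pow_pos hq m)]
  have h := geom_sum_mul_neg q (m + 1)
  have : (1 - q) * q ^ j * ∑ k ∈ Finset.range (m + 1), q ^ k = q ^ j * (1 - q ^ (m + 1)) := by
    rw [← h]; ring
  rw [this]
  have := pow_pos hq (m + 1)
  have := pow_pos hq j
  nlinarith

/-- The admissible moduli of the diagonal blocks for a bath truncated at level `m`. -/
structure IsProfile (m : ℕ) (σ : ℕ → ℝ) : Prop where
  nonneg : ∀ j, 0 ≤ σ j
  le_one : ∀ j, σ j ≤ 1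
  zero : σ 0 = 1
  last : σ (m + 1) = 1

/-- These sums are c and λ of the infinite ladder with moduli k^j. The ratio of consecutive moduli
is constant, which is the equality case of Cauchy–Schwarz, so c = f(λ) for every k. -/
theorem hasSum_geometric_profile (hq : 0 < q) (hq1 : q < 1) {k : ℝ} (hk : 0 ≤ k) (hk1 : k ≤ 1) :
    HasSum (fun j : ℕ => (1 - q) * q ^ j * (k ^ j * k ^ (j + 1))) ((1 - q) * k / (1 - q * k ^ 2)) ∧
    HasSum (fun j : ℕ => (1 - q) * q ^ j * (1 - (k ^ (j + 1)) ^ 2))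
      (1 - (1 - q) * k ^ 2 / (1 - q * k ^ 2)) := by
  have h0 : 0 ≤ q * k ^ 2 := by positivity
  have h1 : q * k ^ 2 < 1 := by nlinarith [pow_le_one₀ (n := 2) hk hk1, sq_nonneg k]
  have h := hasSum_geometric_of_lt_one h0 h1
  constructor
  · have hf : (fun j : ℕ => (1 - q) * q ^ j * (k ^ j * k ^ (j + 1))) =
        fun j => (1 - q) * k * (q * k ^ 2) ^ j := by
      funext j
      rw [mul_pow, ← pow_mul]
      ring
    rw [hf, div_eq_mul_inv]
    exact h.mul_left ((1 - q) * k)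
  · have e := (hasSum_geometric_of_lt_one hq.le hq1).mul_left (1 - q)
    have hf : (fun j : ℕ => (1 - q) * q ^ j * (1 - (k ^ (j + 1)) ^ 2)) =
        fun j => (1 - q) * q ^ j - (1 - q) * k ^ 2 * (q * k ^ 2) ^ j := by
      funext j
      rw [mul_pow, ← pow_mul k 2]
      ring
    rw [mul_inv_cancel₀ (by linarith)] at e
    rw [hf, div_eq_mul_inv]
    exact e.sub (h.mul_left ((1 - q) * k ^ 2))

theorem exists_profile_le (hq : 0 < q) (hq1 : q ≤ 1) {l r : ℝ} (hl : 0 < l) (hl1 : l < 1)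
    (hr : 0 ≤ r) (h : r ^ 2 < (1 - l) * (1 - l * q)) :
    ∃ (m : ℕ) (σ : ℕ → ℝ), IsProfile m σ ∧
      l ≤ ∑ j ∈ Finset.range (m + 1), truncWeight q m j * (1 - σ (j + 1) ^ 2) ∧
      r ≤ ∑ j ∈ Finset.range (m + 1), truncWeight q m j * (σ j * σ (j + 1)) := by
  -- Aiming at l' slightly beyond l, still with r < f(l'), leaves room for the loss caused by
  -- truncation.
  obtain ⟨l', hll, hl1', hr'⟩ : ∃ l', l < l' ∧ l' < 1 ∧ r ^ 2 < (1 - l') * (1 - l' * q) := by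
    have hc : Continuous fun x : ℝ => (1 - x) * (1 - x * q) := by fun_prop
    have h1 : ∀ᶠ x in nhdsWithin l (Set.Ioi l), r ^ 2 < (1 - x) * (1 - x * q) :=
      (hc.continuousAt.eventually (lt_mem_nhds h)).filter_mono nhdsWithin_le_nhds
    have h2 : ∀ᶠ x in nhdsWithin l (Set.Ioi l), x < 1 :=
      (Filter.Eventually.filter_mono nhdsWithin_le_nhds (gt_mem_nhds hl1))
    obtain ⟨x, hx1, hx2, hx3⟩ := (h1.and (h2.and self_mem_nhdsWithin)).exists
    exact ⟨x, hx3, hx2, hx1⟩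
  rcases hq1.eq_or_lt with rfl | hq1
  · -- constant moduli
    set s := Real.sqrt (1 - l') with hs
    have hs0 : 0 ≤ s := Real.sqrt_nonneg _
    have hs2 : s ^ 2 = 1 - l' := Real.sq_sqrt (by linarith)
    have hs1 : s ≤ 1 := by nlinarith
    have hrs : r < s ^ 2 := by rw [hs2]; nlinarith
    -- The top level contributes nothing to λ, so constant moduli give l' m/(m+1), which is at least
    -- l for this m.
    obtain ⟨m, hm⟩ := exists_nat_gt (l / (l' - l))
    rw [div_lt_iff₀ (by linarith)] at hm
    let σ : ℕ → ℝ := fun j => if j = 0 ∨ j = m + 1 then 1 else s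
    have hσs (j : ℕ) : s ≤ σ j := by
      by_cases h : j = 0 ∨ j = m + 1 <;> simp [σ, h, hs1]
    have hσ1 (j : ℕ) : σ j ≤ 1 := by
      by_cases h : j = 0 ∨ j = m + 1 <;> simp [σ, h, hs1]
    refine ⟨m, σ, ⟨fun j => hs0.trans (hσs j), hσ1, by simp [σ], by simp [σ]⟩, ?_, ?_⟩
    · rw [Finset.sum_range_succ]
      have h1 : ∑ j ∈ Finset.range m, truncWeight 1 m j * (1 - σ (j + 1) ^ 2) =
          ∑ j ∈ Finset.range m, 1 / ((m : ℝ) + 1) * l' := by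
        refine Finset.sum_congr rfl fun j hj => ?_
        have hj' := Finset.mem_range.mp hj
        have : σ (j + 1) = s := by simp [σ, hj'.ne]
        rw [this, hs2]
        simp [truncWeight]
      rw [h1, Finset.sum_const, Finset.card_range, nsmul_eq_mul]
      have h2 : σ (m + 1) = 1 := by simp [σ]
      rw [h2]
      have : (0 : ℝ) < m + 1 := by positivity
      rw [one_pow, sub_self, mul_zero, add_zero, div_mul_eq_mul_div, one_mul, ← mul_div_assoc,
        le_div_iff₀ this]
      nlinarith
    · calc r ≤ s ^ 2 := hrs.le
        _ = ∑ j ∈ Finset.range (m + 1), truncWeight 1 m j * s ^ 2 := by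
          rw [← Finset.sum_mul, sum_truncWeight one_pos, one_mul]
        _ ≤ _ := by
          refine Finset.sum_le_sum fun j _ => mul_le_mul_of_nonneg_left ?_
            (truncWeight_nonneg one_pos _ _)
          rw [sq]
          exact mul_le_mul (hσs j) (hσs _) hs0 (hs0.trans (hσs j))
  · have hlq : 0 < 1 - l' * q := by nlinarith
    -- The ratio for which the infinite ladder has λ = l' and c = f(l').
    set k := Real.sqrt ((1 - l') / (1 - l' * q)) with hk
    have hk0 : 0 ≤ k := Real.sqrt_nonneg _
    have hk2 : k ^ 2 = (1 - l') / (1 - l' * q) :=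
      Real.sq_sqrt (div_nonneg (by linarith) hlq.le)
    have hk1 : k ≤ 1 := by
      have : k ^ 2 ≤ 1 := by
        rw [hk2, div_le_one hlq]; nlinarith
      nlinarith
    have hden : 1 - q * k ^ 2 = (1 - q) / (1 - l' * q) := by
      rw [hk2, eq_div_iff hlq.ne', sub_mul, mul_assoc, div_mul_cancel₀ _ hlq.ne']; ring
    obtain ⟨hs1, hs2⟩ := hasSum_geometric_profile hq hq1 hk0 hk1
    have hq0 : 1 - q ≠ 0 := by linarith
    have e1 : (1 - q) * k / (1 - q * k ^ 2) = k * (1 - l' * q) := by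
      rw [hden]; field_simp
    have e2 : 1 - (1 - q) * k ^ 2 / (1 - q * k ^ 2) = l' := by
      have : (1 - q) * ((1 - l') / (1 - l' * q)) / ((1 - q) / (1 - l' * q)) = 1 - l' := by
        rw [← mul_div_assoc, div_div_div_cancel_right₀ hlq.ne', mul_div_cancel_left₀ _ hq0]
      rw [hden, hk2, this, sub_sub_cancel]
    rw [e1] at hs1
    rw [e2] at hs2
    have hrk : r < k * (1 - l' * q) := by
      have : (k * (1 - l' * q)) ^ 2 = (1 - l') * (1 - l' * q) := by
        rw [mul_pow, hk2]; field_simp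
      rw [← this] at hr'
      exact lt_of_pow_lt_pow_left₀ 2 (by positivity) hr'
    have t1 := hs1.tendsto_sum_nat.eventually (lt_mem_nhds hrk)
    have t2 := hs2.tendsto_sum_nat.eventually (lt_mem_nhds hll)
    obtain ⟨m, hm1, hm2⟩ := (t1.and t2).exists
    let σ : ℕ → ℝ := fun j => if j = m + 1 then 1 else k ^ j
    have hσk (j : ℕ) : k ^ j ≤ σ j := by
      by_cases h : j = m + 1 <;> simp [σ, h, pow_le_one₀ hk0 hk1]
    have hσ1 (j : ℕ) : σ j ≤ 1 := by
      by_cases h : j = m + 1 <;> simp [σ, h, pow_le_one₀ hk0 hk1]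
    have hσ0 (j : ℕ) : 0 ≤ σ j := (pow_nonneg hk0 j).trans (hσk j)
    refine ⟨m, σ, ⟨hσ0, hσ1, by simp [σ], by simp [σ]⟩, ?_, ?_⟩
    · rw [Finset.sum_range_succ]
      have h2 : σ (m + 1) = 1 := by simp [σ]
      rw [h2, one_pow, sub_self, mul_zero, add_zero]
      refine hm2.le.trans (Finset.sum_le_sum fun j hj => ?_)
      have : σ (j + 1) = k ^ (j + 1) := by simp [σ, (Finset.mem_range.mp hj).ne]
      rw [this]
      refine mul_le_mul_of_nonneg_right (le_truncWeight hq hq1 m j) ?_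
      have := pow_le_one₀ (n := j + 1) hk0 hk1
      have := pow_nonneg hk0 (j + 1)
      nlinarith
    · rw [Finset.sum_range_succ]
      refine hm1.le.trans ((Finset.sum_le_sum fun j _ => ?_).trans (le_add_of_nonneg_right
        (mul_nonneg (truncWeight_nonneg hq _ _) (mul_nonneg (hσ0 _) (hσ0 _)))))
      exact mul_le_mul (le_truncWeight hq hq1 m j) (mul_le_mul (hσk _) (hσk _)
        (pow_nonneg hk0 _) (hσ0 _)) (by positivity) (truncWeight_nonneg hq _ _)

/-- Multiplying all 1 - σ_j² by l/L ≤ 1 scales λ down to l exactly. It can only increase the moduli,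
so the bound on r survives and the two ends of the ladder stay at modulus one. -/
theorem exists_profile (hq : 0 < q) (hq1 : q ≤ 1) {l r : ℝ} (hl : 0 < l) (hl1 : l < 1)
    (hr : 0 ≤ r) (h : r ^ 2 < (1 - l) * (1 - l * q)) :
    ∃ (m : ℕ) (σ : ℕ → ℝ), IsProfile m σ ∧
      ∑ j ∈ Finset.range (m + 1), truncWeight q m j * (1 - σ (j + 1) ^ 2) = l ∧
      r ≤ ∑ j ∈ Finset.range (m + 1), truncWeight q m j * (σ j * σ (j + 1)) := by
  obtain ⟨m, σ, hσ, h1, h2⟩ := exists_profile_le hq hq1 hl hl1 hr h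
  set L := ∑ j ∈ Finset.range (m + 1), truncWeight q m j * (1 - σ (j + 1) ^ 2) with hL
  have hL0 : 0 < L := hl.trans_le h1
  have ht1 : l / L ≤ 1 := (div_le_one hL0).mpr h1
  have ht0 : 0 ≤ l / L := by positivity
  have hsq (j : ℕ) : 0 ≤ 1 - σ j ^ 2 := by nlinarith [hσ.nonneg j, hσ.le_one j]
  have hpos (j : ℕ) : 0 ≤ 1 - l / L * (1 - σ j ^ 2) := by
    nlinarith [hsq j, sq_nonneg (σ j), mul_nonneg (sub_nonneg.mpr ht1) (hsq j)]
  let σ' : ℕ → ℝ := fun j => Real.sqrt (1 - l / L * (1 - σ j ^ 2))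
  have hle (j : ℕ) : σ j ≤ σ' j := by
    refine Real.le_sqrt_of_sq_le ?_
    nlinarith [hsq j, mul_nonneg (sub_nonneg.mpr ht1) (hsq j)]
  refine ⟨m, σ', ⟨fun j => Real.sqrt_nonneg _, fun j => ?_, ?_, ?_⟩, ?_, ?_⟩
  · rw [Real.sqrt_le_one]
    linarith [mul_nonneg ht0 (hsq j)]
  · simp [σ', hσ.zero]
  · simp [σ', hσ.last]
  · have : ∀ j ∈ Finset.range (m + 1), truncWeight q m j * (1 - σ' (j + 1) ^ 2) =
        l / L * (truncWeight q m j * (1 - σ (j + 1) ^ 2)) := fun j _ => by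
      rw [Real.sq_sqrt (hpos _)]; ring
    rw [Finset.sum_congr rfl this, ← Finset.mul_sum, ← hL]
    field_simp
  · refine h2.trans (Finset.sum_le_sum fun j _ => mul_le_mul_of_nonneg_left ?_
      (truncWeight_nonneg hq _ _))
    exact mul_le_mul (hle _) (hle _) (hσ.nonneg _) (Real.sqrt_nonneg _)

end Profiles

end ThermalOps

namespace ThermalOps

/-! ### The ladder unitary on a truncated bath -/

section Hopping

/-- The matrix elements `⟨i,a|U|k,b⟩` of the energy-conserving unitary on system and ladder with
diagonal moduli `σ` and phases `z`. -/
noncomputable def hopping (σ : ℕ → ℝ) (z : ℕ → ℂ) (i k : Fin 2) (a b : ℕ) : ℂ :=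
  !![(if a = b then (σ b : ℂ) * z b else 0),
      (if a = b + 1 then ((Real.sqrt (1 - σ (b + 1) ^ 2) : ℝ) : ℂ) else 0);
    (if a + 1 = b then -((Real.sqrt (1 - σ b ^ 2) : ℝ) : ℂ) * z b else 0),
      (if a = b then (σ (b + 1) : ℂ) else 0)] i k

/-- The ladder unitary for a bath truncated at level `m`. -/
noncomputable def hoppingMatrix (σ : ℕ → ℝ) (z : ℕ → ℂ) (m : ℕ) :
    Matrix (Fin 2 × Fin (m + 1)) (Fin 2 × Fin (m + 1)) ℂ :=
  Matrix.of fun x y => hopping σ z x.1 y.1 x.2 y.2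

variable {σ : ℕ → ℝ} {z : ℕ → ℂ} {m : ℕ}

theorem sum_fin_ite_eq (f : ℕ → ℂ) (b : ℕ) :
    ∑ a : Fin (m + 1), (if (a : ℕ) = b then f a else 0) = if b < m + 1 then f b else 0 := by
  rw [Fin.sum_univ_eq_sum_range fun a => if a = b then f a else 0]
  simp

theorem sum_fin_ite_succ (f : ℕ → ℂ) (b : ℕ) (hb : b < m + 1) :
    ∑ a : Fin (m + 1), (if (a : ℕ) + 1 = b then f a else 0) =
      if b = 0 then 0 else f (b - 1) := by
  rw [Fin.sum_univ_eq_sum_range fun a => if a + 1 = b then f a else 0]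
  rcases b with _ | b
  · simp
  · have : b < m + 1 := by omega
    simp [this]

theorem sqrt_one_sub_sq {x : ℝ} (h0 : 0 ≤ x) (h1 : x ≤ 1) :
    ((Real.sqrt (1 - x ^ 2) : ℝ) : ℂ) * ((Real.sqrt (1 - x ^ 2) : ℝ) : ℂ) = 1 - (x : ℂ) * x := by
  rw [← Complex.ofReal_mul, Real.mul_self_sqrt (by nlinarith)]
  push_cast
  ring

theorem conj_mul_self_of_norm {w : ℂ} (h : ‖w‖ = 1) : conj w * w = 1 := by
  rw [mul_comm, Complex.mul_conj, Complex.normSq_eq_norm_sq, h]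
  simp

/-- The matrix is a direct sum of 2 × 2 unitaries on the planes of (g₁, j+1) and (g₂, j). The
vectors (g₁, 0) and (g₂, m) have no partner, which is why a profile has modulus one at 0 and at m +
1. -/
theorem hoppingMatrix_mem_unitaryGroup (hσ : IsProfile m σ) (hz : ∀ j, ‖z j‖ = 1) :
    hoppingMatrix σ z m ∈ Matrix.unitaryGroup (Fin 2 × Fin (m + 1)) ℂ := by
  have hs (j : ℕ) := sqrt_one_sub_sq (hσ.nonneg j) (hσ.le_one j)
  have hzz (j : ℕ) := conj_mul_self_of_norm (hz j)
  rw [Matrix.mem_unitaryGroup_iff']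
  ext ⟨k, b⟩ ⟨k', b'⟩
  rw [Matrix.star_eq_conjTranspose, Matrix.mul_apply, Fintype.sum_prod_type, Fin.sum_univ_two,
    Matrix.one_apply]
  simp only [Matrix.conjTranspose_apply, hoppingMatrix, Matrix.of_apply, Prod.mk.injEq,
    Fin.ext_iff (a := b)]
  have hb := b.2
  have hb' := b'.2
  generalize (b : ℕ) = β at *
  generalize (b' : ℕ) = β' at *
  clear b b'
  set τ : ℕ → ℝ := fun j => Real.sqrt (1 - σ j ^ 2) with hτ
  have h00 (a b : ℕ) : hopping σ z 0 0 a b = if a = b then (σ b : ℂ) * z b else 0 := rfl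
  have h01 (a b : ℕ) : hopping σ z 0 1 a b = if a = b + 1 then (τ (b + 1) : ℂ) else 0 := rfl
  have h10 (a b : ℕ) : hopping σ z 1 0 a b = if a + 1 = b then -(τ b : ℂ) * z b else 0 := rfl
  have h11 (a b : ℕ) : hopping σ z 1 1 a b = if a = b then (σ (b + 1) : ℂ) else 0 := rfl
  have hs (j : ℕ) : (τ j : ℂ) * τ j = 1 - (σ j : ℂ) * σ j := hs j
  have hfin : ∀ k : Fin 2, k = 0 ∨ k = 1 := by decide
  rcases hfin k with rfl | rfl <;> rcases hfin k' with rfl | rfl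
  · have e1 (a : Fin (m + 1)) : star (hopping σ z 0 0 a β) * hopping σ z 0 0 a β' =
        if (a : ℕ) = β then (if β = β' then (σ β : ℂ) * σ β else 0) else 0 := by
      rw [h00, h00]
      by_cases h : (a : ℕ) = β
      · subst h
        by_cases h' : (a : ℕ) = β' <;> simp [h']
        linear_combination ((σ β' : ℂ) * σ β') * hzz β'
      · simp [h]
    have e2 (a : Fin (m + 1)) : star (hopping σ z 1 0 a β) * hopping σ z 1 0 a β' =
        if (a : ℕ) + 1 = β then (if β = β' then (τ β : ℂ) * τ β else 0) else 0 := by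
      rw [h10, h10]
      by_cases h : (a : ℕ) + 1 = β
      · subst h
        by_cases h' : (a : ℕ) + 1 = β' <;> simp [h']
        linear_combination ((τ β' : ℂ) * τ β') * hzz β'
      · simp [h]
    rw [Finset.sum_congr rfl fun a _ => e1 a, Finset.sum_congr rfl fun a _ => e2 a,
      sum_fin_ite_eq (fun _ => _), sum_fin_ite_succ (fun _ => _) _ hb, if_pos hb]
    by_cases h : β = β'
    · subst h
      by_cases h' : β = 0 <;> simp [h', hs, hσ.zero]
    · simp [h]
  · have e1 (a : Fin (m + 1)) : star (hopping σ z 0 0 a β) * hopping σ z 0 1 a β' =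
        if (a : ℕ) = β then (if β = β' + 1 then (σ β : ℂ) * τ β * conj (z β) else 0) else 0 := by
      rw [h00, h01]
      by_cases h : (a : ℕ) = β
      · subst h
        by_cases h' : (a : ℕ) = β' + 1 <;> simp [h']
        ring
      · simp [h]
    have e2 (a : Fin (m + 1)) : star (hopping σ z 1 0 a β) * hopping σ z 1 1 a β' =
        if (a : ℕ) + 1 = β then (if β = β' + 1 then -((σ β : ℂ) * τ β * conj (z β)) else 0)
          else 0 := by
      rw [h10, h11]
      by_cases h : (a : ℕ) + 1 = β
      · subst h
        by_cases h' : (a : ℕ) = β' <;> simp [h']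
        ring
      · simp [h]
    rw [Finset.sum_congr rfl fun a _ => e1 a, Finset.sum_congr rfl fun a _ => e2 a,
      sum_fin_ite_eq (fun _ => _), sum_fin_ite_succ (fun _ => _) _ hb, if_pos hb]
    by_cases h : β = β' + 1 <;> simp [h]
  · have e1 (a : Fin (m + 1)) : star (hopping σ z 0 1 a β) * hopping σ z 0 0 a β' =
        if (a : ℕ) = β' then (if β' = β + 1 then (σ β' : ℂ) * τ β' * z β' else 0) else 0 := by
      rw [h00, h01]
      by_cases h : (a : ℕ) = β'
      · subst h
        by_cases h' : (a : ℕ) = β + 1 <;> simp [h']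
        ring
      · simp [h]
    have e2 (a : Fin (m + 1)) : star (hopping σ z 1 1 a β) * hopping σ z 1 0 a β' =
        if (a : ℕ) + 1 = β' then (if β' = β + 1 then -((σ β' : ℂ) * τ β' * z β') else 0)
          else 0 := by
      rw [h10, h11]
      by_cases h : (a : ℕ) + 1 = β'
      · subst h
        by_cases h' : (a : ℕ) = β <;> simp [h']
        ring
      · simp [h]
    rw [Finset.sum_congr rfl fun a _ => e1 a, Finset.sum_congr rfl fun a _ => e2 a,
      sum_fin_ite_eq (fun _ => _), sum_fin_ite_succ (fun _ => _) _ hb', if_pos hb']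
    by_cases h : β' = β + 1 <;> simp [h]
  · have e1 (a : Fin (m + 1)) : star (hopping σ z 0 1 a β) * hopping σ z 0 1 a β' =
        if (a : ℕ) = β + 1 then (if β = β' then (τ (β + 1) : ℂ) * τ (β + 1) else 0) else 0 := by
      rw [h01, h01]
      by_cases h : (a : ℕ) = β + 1
      · by_cases h' : β = β' <;> simp [h, h']
      · simp [h]
    have e2 (a : Fin (m + 1)) : star (hopping σ z 1 1 a β) * hopping σ z 1 1 a β' =
        if (a : ℕ) = β then (if β = β' then (σ (β + 1) : ℂ) * σ (β + 1) else 0) else 0 := by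
      rw [h11, h11]
      by_cases h : (a : ℕ) = β
      · subst h
        by_cases h' : (a : ℕ) = β' <;> simp [h']
      · simp [h]
    rw [Finset.sum_congr rfl fun a _ => e1 a, Finset.sum_congr rfl fun a _ => e2 a,
      sum_fin_ite_eq (fun _ => _), sum_fin_ite_eq (fun _ => _), if_pos hb]
    by_cases h : β = β'
    · by_cases h' : β + 1 < m + 1
      · simp [← h, h', hs]
      -- The partner level m + 1 is missing from the bath, so the diagonal entry alone must have
      -- modulus one.
      · have : β = m := by omega
        subst this
        simp [← h, hσ.last]
    · simp [h]

theorem totalHamiltonian_truncatedBath (E : Fin 2 → ℝ) (Δ : ℝ) (m : ℕ) :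
    totalHamiltonian (Matrix.diagonal fun j => (E j : ℂ)) (truncatedBath Δ m) =
      Matrix.diagonal fun x : Fin 2 × Fin (m + 1) => ((E x.1 + (x.2 : ℕ) * Δ : ℝ) : ℂ) := by
  ext ⟨i, a⟩ ⟨k, b⟩
  by_cases h : i = k <;> by_cases h' : a = b <;>
    simp [totalHamiltonian, truncatedBath, h, h', Matrix.diagonal_apply]

theorem hopping_mul_energy (σ : ℕ → ℝ) (z : ℕ → ℂ) (E : Fin 2 → ℝ) (i k : Fin 2) (a b : ℕ) :
    hopping σ z i k a b * ((E k + b * (E 1 - E 0) : ℝ) : ℂ) =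
      ((E i + a * (E 1 - E 0) : ℝ) : ℂ) * hopping σ z i k a b := by
  rw [mul_comm]
  have hfin : ∀ k : Fin 2, k = 0 ∨ k = 1 := by decide
  rcases hfin i with rfl | rfl <;> rcases hfin k with rfl | rfl <;> simp [hopping]
  all_goals
    split_ifs with h
    · subst h
      push_cast
      ring
    · rfl

theorem energyConserving_hoppingMatrix (hσ : IsProfile m σ) (hz : ∀ j, ‖z j‖ = 1)
    (E : Fin 2 → ℝ) :
    EnergyConserving (Matrix.diagonal fun j => (E j : ℂ)) (truncatedBath (E 1 - E 0) m)
      (hoppingMatrix σ z m) := by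
  refine energyConserving_of_commute (hoppingMatrix_mem_unitaryGroup hσ hz) ?_
  rw [totalHamiltonian_truncatedBath]
  ext ⟨i, a⟩ ⟨k, b⟩
  rw [Matrix.mul_diagonal, Matrix.diagonal_mul]
  exact hopping_mul_energy σ z E i k a b

theorem gibbs_truncatedBath (Δ : ℝ) (T : ℝ≥0∞) (m : ℕ) :
    gibbs (truncatedBath Δ m) T = Matrix.diagonal fun j : Fin (m + 1) =>
      ((truncWeight (Real.exp (-(invTemp T * Δ))) m j : ℝ) : ℂ) := by
  rw [truncatedBath, gibbs_diagonal fun j : Fin (m + 1) => ((j : ℕ) : ℝ) * Δ]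
  have h (j : ℕ) : Real.exp (-(invTemp T * (j * Δ))) = Real.exp (-(invTemp T * Δ)) ^ j := by
    rw [← Real.exp_nat_mul]
    congr 1
    ring
  simp only [h, truncWeight]
  rw [Fin.sum_univ_eq_sum_range fun j => Real.exp (-(invTemp T * Δ)) ^ j]

theorem isHermitian_truncatedBath (Δ : ℝ) (m : ℕ) : (truncatedBath Δ m).IsHermitian :=
  isHermitian_diagonal_ofReal _

theorem truncatedTO_subset_TO (H : Matrix (Fin 2) (Fin 2) ℂ) (T : ℝ≥0∞) :
    truncatedTO H T ⊆ TO H T := by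
  rintro S ⟨m, U, hU, rfl⟩
  exact ⟨m + 1, Nat.succ_pos m, _, isHermitian_truncatedBath _ _, U, hU, rfl⟩

variable {H : Matrix (Fin 2) (Fin 2) ℂ} {g : QubitBasis} {T : ℝ≥0∞}

/-- A thermal operation is already known to be canonical, so it suffices to compute its two
coordinates under `Psi`. -/
theorem exists_truncated_eq_canonicalMap (hg : IsOrderedEigenbasis H g) (hσ : IsProfile m σ)
    (hz : ∀ j, ‖z j‖ = 1) :
    ∃ U, EnergyConserving H (truncatedBath (energyGap H) m) U ∧
      thermalMap T (truncatedBath (energyGap H) m) U = canonicalMap g (boltzmannFactor H T)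
        (∑ j ∈ Finset.range (m + 1), truncWeight (boltzmannFactor H T) m j * (1 - σ (j + 1) ^ 2))
        (∑ j ∈ Finset.range (m + 1),
          ((truncWeight (boltzmannFactor H T) m j * (σ j * σ (j + 1)) : ℝ) : ℂ) * z j) := by
  obtain ⟨E, hE, hgap, hH⟩ := hg.exists_eq
  have hU := energyConserving_basisLift hH (energyConserving_hoppingMatrix (z := z) hσ hz E)
  rw [← hgap] at hU
  refine ⟨_, hU, ?_⟩
  obtain ⟨l, c, -, -, -, hS⟩ := EnTO.exists_canonical hg (TO_subset_EnTO H T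
    (truncatedTO_subset_TO H T ⟨m, _, hU, rfl⟩))
  have hPsi := congrArg (Psi g) hS
  rw [Psi_canonicalMap, Psi, thermalMap, matrixElement_dilation, matrixElement_dilation,
    gibbs_truncatedBath] at hPsi
  have hs (j : ℕ) := sqrt_one_sub_sq (hσ.nonneg j) (hσ.le_one j)
  have h1 : (systemBlock (hoppingMatrix σ z m) 0 1 * (Matrix.diagonal fun j : Fin (m + 1) =>
      ((truncWeight (boltzmannFactor H T) m j : ℝ) : ℂ)) *
      (systemBlock (hoppingMatrix σ z m) 0 1).conjTranspose).trace =
      ((∑ j ∈ Finset.range (m + 1), truncWeight (boltzmannFactor H T) m j *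
        (1 - σ (j + 1) ^ 2) : ℝ) : ℂ) := by
    rw [Matrix.trace_mul_comm, Complex.ofReal_sum,
      ← Fin.sum_univ_eq_sum_range fun j => ((truncWeight (boltzmannFactor H T) m j *
        (1 - σ (j + 1) ^ 2) : ℝ) : ℂ)]
    simp only [Matrix.trace, Matrix.diag_apply]
    refine Finset.sum_congr rfl fun b _ => ?_
    rw [Matrix.mul_apply]
    simp only [Matrix.mul_diagonal, Matrix.conjTranspose_apply, systemBlock, hoppingMatrix,
      Matrix.of_apply]
    have h01 (a b : ℕ) : hopping σ z 0 1 a b =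
      if a = b + 1 then ((Real.sqrt (1 - σ (b + 1) ^ 2) : ℝ) : ℂ) else 0 := rfl
    have e (a : Fin (m + 1)) : star (hopping σ z 0 1 a b) * (hopping σ z 0 1 a b *
        ((truncWeight (boltzmannFactor H T) m b : ℝ) : ℂ)) = if (a : ℕ) = (b : ℕ) + 1 then
        ((truncWeight (boltzmannFactor H T) m b * (1 - σ (b + 1) ^ 2) : ℝ) : ℂ) else 0 := by
      rw [h01]
      by_cases h : (a : ℕ) = b + 1
      · simp only [h, if_true, Complex.star_def, Complex.conj_ofReal]
        rw [← mul_assoc, hs]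
        push_cast
        ring
      · simp [h]
    rw [Finset.sum_congr rfl fun a _ => e a, sum_fin_ite_eq (fun _ => _)]
    split_ifs with h
    · rfl
    · have : (b : ℕ) = m := by have := b.2; omega
      simp [this, hσ.last]
  have h2 : (systemBlock (hoppingMatrix σ z m) 0 0 * (Matrix.diagonal fun j : Fin (m + 1) =>
      ((truncWeight (boltzmannFactor H T) m j : ℝ) : ℂ)) *
      (systemBlock (hoppingMatrix σ z m) 1 1).conjTranspose).trace =
      ∑ j ∈ Finset.range (m + 1),
          ((truncWeight (boltzmannFactor H T) m j * (σ j * σ (j + 1)) : ℝ) : ℂ) * z j := by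
    have d0 : systemBlock (hoppingMatrix σ z m) 0 0 =
        Matrix.diagonal fun j : Fin (m + 1) => (σ j : ℂ) * z j := by
      ext a b
      by_cases h : a = b
      · subst h; simp [systemBlock, hoppingMatrix, hopping]
      · simp [systemBlock, hoppingMatrix, hopping, h, Fin.val_inj]
    have d1 : systemBlock (hoppingMatrix σ z m) 1 1 =
        Matrix.diagonal fun j : Fin (m + 1) => (σ (j + 1) : ℂ) := by
      ext a b
      by_cases h : a = b
      · subst h; simp [systemBlock, hoppingMatrix, hopping]
      · simp [systemBlock, hoppingMatrix, hopping, h, Fin.val_inj]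
    rw [d0, d1, Matrix.diagonal_conjTranspose, Matrix.diagonal_mul_diagonal,
      Matrix.diagonal_mul_diagonal, Matrix.trace_diagonal,
      ← Fin.sum_univ_eq_sum_range fun j =>
        ((truncWeight (boltzmannFactor H T) m j * (σ j * σ (j + 1)) : ℝ) : ℂ) * z j]
    refine Finset.sum_congr rfl fun j _ => ?_
    simp
    ring
  rw [show Real.exp (-(invTemp T * energyGap H)) = boltzmannFactor H T from rfl, h1, h2,
    Complex.ofReal_re] at hPsi
  obtain ⟨rfl, rfl⟩ := Prod.mk.inj hPsi
  exact hS

end Hopping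

end ThermalOps

namespace ThermalOps

/-! ### Geometry of the parameter regions -/

section Region

/-- The parameters of the enhanced thermal operations. -/
def enhancedRegion (q : ℝ) : Set (ℝ × ℂ) :=
  {x | 0 ≤ x.1 ∧ x.1 ≤ 1 ∧ ‖x.2‖ ^ 2 ≤ (1 - x.1) * (1 - x.1 * q)}

/-- The parameters of the thermal operations. -/
def thermalRegion (q : ℝ) : Set (ℝ × ℂ) :=
  {x | x.1 = 0 ∧ ‖x.2‖ ≤ 1 ∨ 0 < x.1 ∧ x.1 < 1 ∧ ‖x.2‖ ^ 2 < (1 - x.1) * (1 - x.1 * q)}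

variable {q : ℝ}

theorem thermalRegion_subset_enhancedRegion : thermalRegion q ⊆ enhancedRegion q := by
  rintro ⟨l, c⟩ (⟨h, hc⟩ | ⟨h, h1, hc⟩)
  · simp only at h
    subst h
    exact ⟨le_rfl, zero_le_one, by simpa using hc⟩
  · exact ⟨h.le, h1.le, hc.le⟩

/-- Since t(1-λ) < 1-tλ and t(1-λq) < 1-tλq, shrinking towards (0, 0) makes the coherence bound
strict. This approximates enhanced thermal operations by thermal ones. -/
theorem scale_mem_thermalRegion (hq : 0 < q) (hq1 : q ≤ 1) {l : ℝ} {c : ℂ}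
    (h : (l, c) ∈ enhancedRegion q) {t : ℝ} (ht : 0 < t) (ht1 : t < 1) :
    (t * l, (t : ℂ) * c) ∈ thermalRegion q := by
  obtain ⟨h0, h1, hc⟩ := h
  simp only at h0 h1 hc
  have hn : ‖(t : ℂ) * c‖ = t * ‖c‖ := by
    rw [norm_mul, Complex.norm_real, Real.norm_of_nonneg ht.le]
  rcases h0.eq_or_lt with rfl | h0
  · refine Or.inl ⟨by simp, ?_⟩
    have : ‖c‖ ≤ 1 := by simpa using hc
    simp only [hn]
    nlinarith [norm_nonneg c]
  · refine Or.inr ⟨mul_pos ht h0, by simp only; nlinarith, ?_⟩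
    simp only [hn]
    have a1 : t * (1 - l) < 1 - t * l := by nlinarith
    have a2 : t * (1 - l * q) < 1 - t * l * q := by nlinarith
    have a3 : l * q ≤ 1 := by nlinarith
    have a4 : 0 ≤ t * (1 - l * q) := mul_nonneg ht.le (by linarith)
    have a5 : 0 ≤ t * (1 - l) := mul_nonneg ht.le (by linarith)
    calc (t * ‖c‖) ^ 2 = t ^ 2 * ‖c‖ ^ 2 := by ring
      _ ≤ t ^ 2 * ((1 - l) * (1 - l * q)) := by gcongr
      _ = (t * (1 - l)) * (t * (1 - l * q)) := by ring
      _ < _ := mul_lt_mul'' a1 a2 a5 a4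

/-- The inequality of arithmetic and geometric means for u₁v₂ and u₂v₁; it is the cross term in the
concavity of √(uv). -/
theorem two_mul_le_of_sq_le {n₁ n₂ u₁ v₁ u₂ v₂ : ℝ} (hu₁ : 0 ≤ u₁) (hv₁ : 0 ≤ v₁) (hu₂ : 0 ≤ u₂)
    (hv₂ : 0 ≤ v₂) (h₁ : n₁ ^ 2 ≤ u₁ * v₁) (h₂ : n₂ ^ 2 ≤ u₂ * v₂) :
    2 * (n₁ * n₂) ≤ u₁ * v₂ + u₂ * v₁ := by
  refine (abs_le_of_sq_le_sq' ?_ (by positivity)).2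
  have := mul_le_mul h₁ h₂ (sq_nonneg _) (by positivity)
  nlinarith [sq_nonneg (u₁ * v₂ - u₂ * v₁)]

/-- Expanding the product at the convex combination reduces concavity of f to the cross-term
estimate. Strictness at one endpoint with λ > 0 makes the combination strict; if both endpoints have
λ = 0 it stays in the unit disc. -/
theorem convex_thermalRegion (hq : 0 < q) (hq1 : q ≤ 1) : Convex ℝ (thermalRegion q) := by
  intro x hx y hy a b ha hb hab
  have hx' := thermalRegion_subset_enhancedRegion hx
  have hy' := thermalRegion_subset_enhancedRegion hy
  rcases ha.eq_or_lt with rfl | ha'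
  · obtain rfl : b = 1 := by linarith
    simpa using hy
  rcases hb.eq_or_lt with rfl | hb'
  · obtain rfl : a = 1 := by linarith
    simpa using hx
  obtain ⟨l₁, c₁⟩ := x
  obtain ⟨l₂, c₂⟩ := y
  obtain ⟨hl₁, hl₁', hc₁⟩ := hx'
  obtain ⟨hl₂, hl₂', hc₂⟩ := hy'
  simp only at hl₁ hl₁' hc₁ hl₂ hl₂' hc₂
  have hn : ‖(a • c₁ + b • c₂ : ℂ)‖ ≤ a * ‖c₁‖ + b * ‖c₂‖ := by
    refine (norm_add_le _ _).trans ?_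
    simp [abs_of_pos ha', abs_of_pos hb']
  have hq₁ : 0 ≤ 1 - l₁ * q := by nlinarith
  have hq₂ : 0 ≤ 1 - l₂ * q := by nlinarith
  have key := two_mul_le_of_sq_le (by linarith) hq₁ (by linarith) hq₂ hc₁ hc₂
  have hn2 : ‖(a • c₁ + b • c₂ : ℂ)‖ ^ 2 ≤ (a * ‖c₁‖ + b * ‖c₂‖) ^ 2 := by gcongr
  have hab' : 0 < a * b := mul_pos ha' hb'
  have e : (1 - (a * l₁ + b * l₂)) * (1 - (a * l₁ + b * l₂) * q) =
      a ^ 2 * ((1 - l₁) * (1 - l₁ * q)) + b ^ 2 * ((1 - l₂) * (1 - l₂ * q)) +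
        a * b * ((1 - l₁) * (1 - l₂ * q) + (1 - l₂) * (1 - l₁ * q)) := by
    obtain rfl : b = 1 - a := by linarith
    ring
  have e' : (a * ‖c₁‖ + b * ‖c₂‖) ^ 2 = a ^ 2 * ‖c₁‖ ^ 2 + b ^ 2 * ‖c₂‖ ^ 2 +
      a * b * (2 * (‖c₁‖ * ‖c₂‖)) := by ring
  by_cases h0 : l₁ = 0 ∧ l₂ = 0
  · obtain ⟨rfl, rfl⟩ := h0
    refine Or.inl ⟨by simp, hn.trans ?_⟩
    have h1 : ‖c₁‖ ≤ 1 := by simpa using hc₁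
    have h2 : ‖c₂‖ ≤ 1 := by simpa using hc₂
    nlinarith
  · right
    simp only [Prod.smul_mk, Prod.mk_add_mk, smul_eq_mul]
    have hs : (0 < l₁ ∧ l₁ < 1 ∧ ‖c₁‖ ^ 2 < (1 - l₁) * (1 - l₁ * q)) ∨
        (0 < l₂ ∧ l₂ < 1 ∧ ‖c₂‖ ^ 2 < (1 - l₂) * (1 - l₂ * q)) := by
      rcases hx with hx | hx
      · rcases hy with hy | hy
        · exact absurd ⟨hx.1, hy.1⟩ h0
        · exact Or.inr hy
      · exact Or.inl hx
    have hk := mul_le_mul_of_nonneg_left key hab'.le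
    have h1 := mul_le_mul_of_nonneg_left hc₁ (sq_nonneg a)
    have h2 := mul_le_mul_of_nonneg_left hc₂ (sq_nonneg b)
    rcases hs with ⟨p0, p1, p2⟩ | ⟨p0, p1, p2⟩
    · have := mul_lt_mul_of_pos_left p2 (pow_pos ha' 2)
      refine ⟨?_, ?_, ?_⟩ <;> nlinarith
    · have := mul_lt_mul_of_pos_left p2 (pow_pos hb' 2)
      refine ⟨?_, ?_, ?_⟩ <;> nlinarith

end Region

/-! ### TO and EnTO in terms of the parameters, and the closure of TO -/

section Characterization

variable {H : Matrix (Fin 2) (Fin 2) ℂ} {g : QubitBasis} {T : ℝ≥0∞}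

theorem canonicalMap_convexComb (g : QubitBasis) (q : ℝ) {a b : ℝ} (hab : a + b = 1) (l₁ l₂ : ℝ)
    (c₁ c₂ : ℂ) : a • canonicalMap g q l₁ c₁ + b • canonicalMap g q l₂ c₂ =
      canonicalMap g q (a * l₁ + b * l₂) (a * c₁ + b * c₂) := by
  obtain rfl : b = 1 - a := by linarith
  refine superop_ext (g := g) fun j k x y => ?_
  have hr (r : ℝ) (S : Superop (Fin 2)) (A : Matrix (Fin 2) (Fin 2) ℂ) :
      (r • S) A = (r : ℂ) • S A := by
    rw [FunLike.coe_smul, Pi.smul_apply]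
    ext i j
    simp
  rw [add_apply, hr, hr, matrixElement_add, matrixElement_smul, matrixElement_smul]
  simp only [canonicalMap, matrixElement_covMap]
  fin_cases x <;> fin_cases y <;> simp <;> ring

theorem half_average_mem_TO {Δ : ℝ} {m : ℕ}
    {U U' : Matrix (Fin 2 × Fin (m + 1)) (Fin 2 × Fin (m + 1)) ℂ}
    (hU : EnergyConserving H (truncatedBath Δ m) U)
    (hU' : EnergyConserving H (truncatedBath Δ m) U') :
    (1 / 2 : ℝ) • thermalMap T (truncatedBath Δ m) U +
      (1 / 2 : ℝ) • thermalMap T (truncatedBath Δ m) U' ∈ TO H T := by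
  have hV : ∀ x : Fin 2, EnergyConserving H (truncatedBath Δ m) (![U, U'] x) := by
    intro x
    fin_cases x
    · exact hU
    · exact hU'
  refine average_mem_TO (ι := Fin 2) (fun j : Fin (m + 1) => ((j : ℕ) : ℝ) * Δ)
    (fun x => (hV x).1) (fun x => (hV x).commute) fun ρ => ?_
  have hr (S : Superop (Fin 2)) (A : Matrix (Fin 2) (Fin 2) ℂ) :
      ((1 / 2 : ℝ) • S) A = (2 : ℂ)⁻¹ • S A := by
    rw [FunLike.coe_smul, Pi.smul_apply]
    ext i j
    simp
  rw [add_apply, hr, hr, ← smul_add, thermalMap, thermalMap, truncatedBath, gibbs_diagonal,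
    dilation_diagonal, dilation_diagonal, Fin.sum_univ_two]
  simp

theorem IsProfile.const_one (m : ℕ) : IsProfile m fun _ => 1 :=
  ⟨fun _ => zero_le_one, fun _ => le_rfl, rfl, rfl⟩

theorem canonicalMap_mem_TO_of_profile (hg : IsOrderedEigenbasis H g) {m : ℕ} {σ : ℕ → ℝ}
    (hσ : IsProfile m σ) {c : ℂ} (hc : ‖c‖ ≤ ∑ j ∈ Finset.range (m + 1),
      truncWeight (boltzmannFactor H T) m j * (σ j * σ (j + 1))) :
    canonicalMap g (boltzmannFactor H T) (∑ j ∈ Finset.range (m + 1),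
      truncWeight (boltzmannFactor H T) m j * (1 - σ (j + 1) ^ 2)) c ∈ TO H T := by
  obtain ⟨z, z', hz, hz', rfl⟩ := exists_unit_average hc
  obtain ⟨U, hU, hUS⟩ := exists_truncated_eq_canonicalMap (T := T) hg hσ (z := fun _ => z)
    fun _ => hz
  obtain ⟨U', hU', hUS'⟩ := exists_truncated_eq_canonicalMap (T := T) hg hσ (z := fun _ => z')
    fun _ => hz'
  have := half_average_mem_TO (T := T) hU hU'
  rw [hUS, hUS', canonicalMap_convexComb _ _ (by norm_num)] at this
  convert this using 1
  congr 1
  · ring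
  · rw [← Finset.sum_mul, ← Finset.sum_mul]
    push_cast
    ring

/-- Strictness in Cauchy–Schwarz gives the upper bound. For the converse a profile provides the
right λ and enough coherence, and averaging two constant phases lowers the coherence to the
prescribed c. -/
theorem mem_TO_iff (hg : IsOrderedEigenbasis H g) {S : Superop (Fin 2)} :
    S ∈ TO H T ↔ ∃ x ∈ thermalRegion (boltzmannFactor H T),
      S = canonicalMap g (boltzmannFactor H T) x.1 x.2 := by
  have hq := boltzmannFactor_pos H T
  have hq1 := hg.boltzmannFactor_le_one T
  constructor
  · intro hS
    obtain ⟨l, c, h0, h1, hc, hSe⟩ := EnTO.exists_canonical hg (TO_subset_EnTO H T hS)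
    refine ⟨(l, c), ?_, hSe⟩
    rcases h0.eq_or_lt with rfl | h0
    · exact Or.inl ⟨rfl, by simpa using hc⟩
    · obtain ⟨m, hm, HB, hB, U, hU, rfl⟩ := hS
      have := thermalMap_strict hg hm hB hU hSe h0
      refine Or.inr ⟨h0, lt_of_le_of_ne h1 ?_, this⟩
      -- At λ = 1 the strict bound would read |c|² < 0.
      rintro rfl
      simp only [sub_self, zero_mul] at this
      nlinarith [norm_nonneg c]
  · rintro ⟨⟨l, c⟩, (⟨h0, hc⟩ | ⟨h0, h1, hc⟩), rfl⟩
    · simp only at h0 hc ⊢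
      subst h0
      have := canonicalMap_mem_TO_of_profile (T := T) hg (IsProfile.const_one 0) (c := c)
        (by simpa [truncWeight] using hc)
      simpa using this
    · obtain ⟨m, σ, hσ, hl, hr⟩ := exists_profile hq hq1 h0 h1 (norm_nonneg c) hc
      simp only at hl ⊢
      rw [← hl]
      exact canonicalMap_mem_TO_of_profile hg hσ hr

theorem mem_closure_TO_of_enhancedRegion (hg : IsOrderedEigenbasis H g) {l : ℝ} {c : ℂ}
    (h : (l, c) ∈ enhancedRegion (boltzmannFactor H T)) :
    canonicalMap g (boltzmannFactor H T) l c ∈ closure (TO H T) := by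
  have hq := boltzmannFactor_pos H T
  have hq1 := hg.boltzmannFactor_le_one T
  have hlim : Filter.Tendsto (fun t : ℝ => canonicalMap g (boltzmannFactor H T) (t * l)
      ((t : ℂ) * c)) (nhdsWithin 1 (Set.Iio 1))
      (nhds (canonicalMap g (boltzmannFactor H T) l c)) := by
    have hc : Continuous fun t : ℝ => canonicalMap g (boltzmannFactor H T) (t * l)
        ((t : ℂ) * c) :=
      (continuous_canonicalMap g (boltzmannFactor H T)).comp
        (f := fun t : ℝ => (t * l, (t : ℂ) * c)) (by fun_prop)
    have := (hc.tendsto 1).mono_left (nhdsWithin_le_nhds (s := Set.Iio (1 : ℝ)))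
    simpa using this
  refine mem_closure_of_tendsto hlim ?_
  filter_upwards [Ioo_mem_nhdsLT (show (0 : ℝ) < 1 from zero_lt_one)] with t ht
  exact (mem_TO_iff hg).mpr ⟨_, scale_mem_thermalRegion hq hq1 h ht.1 ht.2, rfl⟩

/-- Complete positivity of the canonical maps on the boundary needs no separate check: they are
limits of thermal operations and EnTO is closed. -/
theorem mem_EnTO_iff (hg : IsOrderedEigenbasis H g) {S : Superop (Fin 2)} :
    S ∈ EnTO H T ↔ ∃ x ∈ enhancedRegion (boltzmannFactor H T),
      S = canonicalMap g (boltzmannFactor H T) x.1 x.2 := by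
  constructor
  · intro hS
    obtain ⟨l, c, h0, h1, hc, hSe⟩ := EnTO.exists_canonical hg hS
    exact ⟨(l, c), ⟨h0, h1, hc⟩, hSe⟩
  · rintro ⟨⟨l, c⟩, h, rfl⟩
    exact closure_minimal (TO_subset_EnTO H T) (isClosed_EnTO H T)
      (mem_closure_TO_of_enhancedRegion hg h)

theorem closure_TO_eq_EnTO {HS : Matrix (Fin 2) (Fin 2) ℂ} (hHS : HS.IsHermitian) (T : ℝ≥0∞) :
    closure (TO HS T) = EnTO HS T := by
  refine (closure_minimal (TO_subset_EnTO HS T) (isClosed_EnTO HS T)).antisymm ?_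
  by_cases hd : NonDegenerate HS
  · obtain ⟨g, hg⟩ := exists_isOrderedEigenbasis hHS hd
    intro S hS
    obtain ⟨⟨l, c⟩, h, rfl⟩ := (mem_EnTO_iff hg).mp hS
    exact mem_closure_TO_of_enhancedRegion hg h
  · obtain ⟨E, rfl⟩ := eq_smul_one_of_not_nonDegenerate hHS hd
    exact EnTO_subset_closure_TO_of_scalar E T

end Characterization

end ThermalOps

namespace ThermalOps

/-! ### Parametrization by Ψ, convexity, relative interior and boundary -/

section Parametrization

variable {H : Matrix (Fin 2) (Fin 2) ℂ} {g : QubitBasis} {T : ℝ≥0∞}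

theorem IsOrderedEigenbasis.radicand_nonneg (hg : IsOrderedEigenbasis H g) {l : ℝ} (h0 : 0 ≤ l)
    (h1 : l ≤ 1) : 0 ≤ (1 - l) * (1 - l * boltzmannFactor H T) := by
  have hq := boltzmannFactor_pos H T
  have hq1 := hg.boltzmannFactor_le_one T
  exact mul_nonneg (by linarith) (by nlinarith)

theorem norm_le_maxRadius_iff (hg : IsOrderedEigenbasis H g) {l : ℝ} {c : ℂ} (h0 : 0 ≤ l)
    (h1 : l ≤ 1) :
    ‖c‖ ≤ maxRadius H T l ↔ ‖c‖ ^ 2 ≤ (1 - l) * (1 - l * boltzmannFactor H T) :=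
  Real.le_sqrt (norm_nonneg c) (hg.radicand_nonneg h0 h1)

theorem enhancedRegion_eq (hg : IsOrderedEigenbasis H g) :
    {x : ℝ × ℂ | x.1 ∈ Set.Icc (0 : ℝ) 1 ∧ ‖x.2‖ ≤ maxRadius H T x.1} =
      enhancedRegion (boltzmannFactor H T) := by
  ext ⟨l, c⟩
  constructor
  · rintro ⟨⟨h0, h1⟩, h⟩
    exact ⟨h0, h1, (norm_le_maxRadius_iff hg h0 h1).mp h⟩
  · rintro ⟨h0, h1, h⟩
    exact ⟨⟨h0, h1⟩, (norm_le_maxRadius_iff hg h0 h1).mpr h⟩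

theorem mem_EnTO_iff_choi (hg : IsOrderedEigenbasis H g) (S : Superop (Fin 2)) :
    S ∈ EnTO H T ↔ ∃ l ∈ Set.Icc (0 : ℝ) 1, ∃ r ∈ Set.Icc 0 (maxRadius H T l),
      ∃ φ ∈ Set.Ico (-Real.pi) Real.pi, choi g S = canonicalChoi H T l (polar r φ) := by
  rw [mem_EnTO_iff hg]
  constructor
  · rintro ⟨⟨l, c⟩, ⟨h0, h1, hc⟩, hS⟩
    obtain ⟨φ, hφ, hc'⟩ := exists_polar c
    refine ⟨l, ⟨h0, h1⟩, ‖c‖, ⟨norm_nonneg c, (norm_le_maxRadius_iff hg h0 h1).mpr hc⟩, φ, hφ, ?_⟩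
    rw [hc']
    exact (choi_eq_canonicalChoi_iff g H T S l c).mpr hS
  · rintro ⟨l, ⟨h0, h1⟩, r, ⟨hr, hr'⟩, φ, -, hS⟩
    refine ⟨(l, polar r φ), ⟨h0, h1, (norm_le_maxRadius_iff hg h0 h1).mp ?_⟩,
      (choi_eq_canonicalChoi_iff g H T S l _).mp hS⟩
    simpa [norm_polar hr] using hr'

theorem injOn_Psi (H : Matrix (Fin 2) (Fin 2) ℂ) (T : ℝ≥0∞) (g : QubitBasis) :
    Set.InjOn (Psi g) (PsiDomain H T g) := by
  intro S hS R hR h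
  obtain ⟨l, c, rfl⟩ := (mem_PsiDomain_iff g H T S).mp hS
  obtain ⟨l', c', rfl⟩ := (mem_PsiDomain_iff g H T R).mp hR
  rw [Psi_canonicalMap, Psi_canonicalMap] at h
  obtain ⟨rfl, rfl⟩ := Prod.mk.inj h
  rfl

theorem EnTO_subset_PsiDomain (hg : IsOrderedEigenbasis H g) :
    EnTO H T ⊆ PsiDomain H T g := by
  intro S hS
  obtain ⟨x, -, h⟩ := (mem_EnTO_iff hg).mp hS
  exact (mem_PsiDomain_iff g H T S).mpr ⟨_, _, h⟩

theorem bijOn_Psi (hg : IsOrderedEigenbasis H g) :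
    Set.BijOn (Psi g) (EnTO H T)
      {x | x.1 ∈ Set.Icc (0 : ℝ) 1 ∧ ‖x.2‖ ≤ maxRadius H T x.1} := by
  rw [enhancedRegion_eq hg]
  refine ⟨?_, (injOn_Psi H T g).mono (EnTO_subset_PsiDomain hg), ?_⟩
  · intro S hS
    obtain ⟨x, hx, rfl⟩ := (mem_EnTO_iff hg).mp hS
    rw [Psi_canonicalMap]
    exact hx
  · intro x hx
    exact ⟨_, (mem_EnTO_iff hg).mpr ⟨x, hx, rfl⟩, Psi_canonicalMap g _ _ _⟩

theorem convex_TO (hg : IsOrderedEigenbasis H g) (T : ℝ≥0∞) : Convex ℝ (TO H T) := by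
  intro S hS R hR a b ha hb hab
  obtain ⟨x, hx, rfl⟩ := (mem_TO_iff hg).mp hS
  obtain ⟨y, hy, rfl⟩ := (mem_TO_iff hg).mp hR
  rw [canonicalMap_convexComb _ _ hab]
  refine (mem_TO_iff hg).mpr ⟨_, convex_thermalRegion (boltzmannFactor_pos H T)
    (hg.boltzmannFactor_le_one T) hx hy ha hb hab, ?_⟩
  simp

theorem mem_thermalRegion_iff {q : ℝ} {x : ℝ × ℂ} (hx : x ∈ enhancedRegion q) :
    x ∈ thermalRegion q ↔ x.1 = 0 ∨ ‖x.2‖ ^ 2 < (1 - x.1) * (1 - x.1 * q) := by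
  obtain ⟨l, c⟩ := x
  obtain ⟨h0, h1, hc⟩ := hx
  simp only at h0 h1 hc
  constructor
  · rintro (h | h)
    · exact Or.inl h.1
    · exact Or.inr h.2.2
  · simp only
    intro h
    rcases h0.eq_or_lt with rfl | h0
    · exact Or.inl ⟨rfl, by simpa using hc⟩
    · rcases h with h | h
      · exact absurd h h0.ne'
      · refine Or.inr ⟨h0, lt_of_le_of_ne h1 ?_, h⟩
        rintro rfl
        simp only [sub_self, zero_mul] at h
        nlinarith [norm_nonneg c]

theorem canonicalMap_mem_TO_iff (hg : IsOrderedEigenbasis H g) {l : ℝ} {c : ℂ} :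
    canonicalMap g (boltzmannFactor H T) l c ∈ TO H T ↔
      (l, c) ∈ thermalRegion (boltzmannFactor H T) := by
  rw [mem_TO_iff hg]
  constructor
  · rintro ⟨x, hx, h⟩
    have := congrArg (Psi g) h
    rw [Psi_canonicalMap, Psi_canonicalMap] at this
    rwa [this]
  · intro h
    exact ⟨_, h, rfl⟩

theorem canonicalMap_mem_EnTO_iff (hg : IsOrderedEigenbasis H g) {l : ℝ} {c : ℂ} :
    canonicalMap g (boltzmannFactor H T) l c ∈ EnTO H T ↔
      (l, c) ∈ enhancedRegion (boltzmannFactor H T) := by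
  rw [mem_EnTO_iff hg]
  constructor
  · rintro ⟨x, hx, h⟩
    have := congrArg (Psi g) h
    rw [Psi_canonicalMap, Psi_canonicalMap] at this
    rwa [this]
  · intro h
    exact ⟨_, h, rfl⟩

theorem TO_eq_diff (hg : IsOrderedEigenbasis H g) :
    TO H T = EnTO H T \ PsiPreimage H T g
      {x | ∃ l ∈ Set.Ioc (0 : ℝ) 1, ∃ φ ∈ Set.Ico (-Real.pi) Real.pi,
        x = (l, polar (maxRadius H T l) φ)} := by
  ext S
  constructor
  · intro hS
    refine ⟨TO_subset_EnTO H T hS, ?_⟩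
    rintro ⟨-, l, ⟨hl0, hl1⟩, φ, -, h⟩
    obtain ⟨x, hx, rfl⟩ := (mem_TO_iff hg).mp hS
    rw [Psi_canonicalMap] at h
    obtain ⟨rfl, hc⟩ := Prod.mk.inj h
    have := (mem_thermalRegion_iff (thermalRegion_subset_enhancedRegion hx)).mp hx
    rw [hc, norm_polar (r := maxRadius H T x.1) (Real.sqrt_nonneg _), maxRadius,
      Real.sq_sqrt (hg.radicand_nonneg hl0.le hl1)] at this
    rcases this with h | h
    · exact hl0.ne' h
    · exact lt_irrefl _ h
  · rintro ⟨hS, hn⟩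
    obtain ⟨⟨l, c⟩, hx, rfl⟩ := (mem_EnTO_iff hg).mp hS
    refine (canonicalMap_mem_TO_iff hg).mpr ((mem_thermalRegion_iff hx).mpr ?_)
    by_contra! hcon
    obtain ⟨hl, hge⟩ := hcon
    obtain ⟨h0, h1, hle⟩ := hx
    simp only at hl hge h0 h1 hle
    obtain ⟨φ, hφ, hc⟩ := exists_polar c
    refine hn ⟨EnTO_subset_PsiDomain hg hS, l, ⟨lt_of_le_of_ne h0 (Ne.symm hl), h1⟩, φ, hφ, ?_⟩
    rw [Psi_canonicalMap, maxRadius, ← hle.antisymm hge, Real.sqrt_sq (norm_nonneg c), hc]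

theorem mem_relInterior_iff {α : Type*} [TopologicalSpace α] {D A : Set α} {x : α} :
    x ∈ relInterior D A ↔ x ∈ D ∧ ∃ O, IsOpen O ∧ x ∈ O ∧ D ∩ O ⊆ A := by
  constructor
  · rintro ⟨⟨x, hD⟩, hx, rfl⟩
    obtain ⟨t, htA, ht, hxt⟩ := mem_interior.mp hx
    obtain ⟨O, hO, rfl⟩ := isOpen_induced_iff.mp ht
    exact ⟨hD, O, hO, hxt, fun y hy => htA (show (⟨y, hy.1⟩ : D) ∈ Subtype.val ⁻¹' O from hy.2)⟩
  · rintro ⟨hD, O, hO, hxO, hA⟩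
    refine ⟨⟨x, hD⟩, mem_interior.mpr ⟨Subtype.val ⁻¹' O, ?_, hO.preimage continuous_subtype_val,
      hxO⟩, rfl⟩
    intro y hy
    exact hA ⟨y.2, hy⟩

theorem mem_TO_iff_relInterior (hg : IsOrderedEigenbasis H g) {S : Superop (Fin 2)}
    (hS : S ∈ EnTO H T) :
    S ∈ TO H T ↔ (Psi g S).1 = 0 ∨ S ∈ relInterior (PsiDomain H T g) (EnTO H T) := by
  have hq := boltzmannFactor_pos H T
  have hq1 := hg.boltzmannFactor_le_one T
  have hD := EnTO_subset_PsiDomain hg hS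
  obtain ⟨⟨l, c⟩, hx, rfl⟩ := (mem_EnTO_iff hg).mp hS
  rw [canonicalMap_mem_TO_iff hg, Psi_canonicalMap, mem_relInterior_iff]
  constructor
  · rintro (⟨h, -⟩ | h)
    · exact Or.inl h
    · refine Or.inr ⟨hD, Psi g ⁻¹' {x | 0 < x.1 ∧ x.1 < 1 ∧
        ‖x.2‖ ^ 2 < (1 - x.1) * (1 - x.1 * boltzmannFactor H T)}, ?_, ?_, ?_⟩
      · refine IsOpen.preimage (continuous_Psi g) ?_
        refine (isOpen_lt continuous_const continuous_fst).inter
          ((isOpen_lt continuous_fst continuous_const).inter (isOpen_lt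
            (f := fun x : ℝ × ℂ => ‖x.2‖ ^ 2)
            (g := fun x => (1 - x.1) * (1 - x.1 * boltzmannFactor H T)) ?_ ?_)) <;> fun_prop
      · rw [Set.mem_preimage, Psi_canonicalMap]
        exact h
      · rintro R ⟨hR, hRO⟩
        obtain ⟨l', c', rfl⟩ := (mem_PsiDomain_iff g H T R).mp hR
        rw [Set.mem_preimage, Psi_canonicalMap] at hRO
        exact (canonicalMap_mem_EnTO_iff hg).mpr
          (thermalRegion_subset_enhancedRegion (Or.inr hRO))
  · rintro (h | ⟨-, O, hO, hxO, hA⟩)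
    · exact (mem_thermalRegion_iff hx).mpr (Or.inl h)
    · refine (mem_thermalRegion_iff hx).mpr ?_
      obtain ⟨h0, h1, hc⟩ := hx
      simp only at h0 h1 hc hxO ⊢
      -- Along increasing λ at fixed c the radicand strictly decreases, so a point whose neighbours
      -- still lie in EnTO satisfies the bound strictly.
      have hcont : Continuous fun ε : ℝ => canonicalMap g (boltzmannFactor H T) (l + ε) c :=
        (continuous_canonicalMap g (boltzmannFactor H T)).comp
          (f := fun ε : ℝ => (l + ε, c)) (by fun_prop)
      have hev : ∀ᶠ ε in nhdsWithin (0 : ℝ) (Set.Ioi 0),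
          canonicalMap g (boltzmannFactor H T) (l + ε) c ∈ O :=
        nhdsWithin_le_nhds (hcont.continuousAt.eventually_mem (hO.mem_nhds (by simpa using hxO)))
      obtain ⟨ε, hεO, hε⟩ := (hev.and self_mem_nhdsWithin).exists
      have hε : 0 < ε := hε
      obtain ⟨h0', h1', hc'⟩ := (canonicalMap_mem_EnTO_iff hg).mp
        (hA ⟨(mem_PsiDomain_iff g H T _).mpr ⟨_, _, rfl⟩, hεO⟩)
      simp only at h0' h1' hc'
      right
      have e1 : l * boltzmannFactor H T < 1 := by nlinarith
      have e2 : 0 < ε * boltzmannFactor H T := mul_pos hε hq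
      nlinarith

theorem EnTO_diff_TO_subset_relFrontier (hg : IsOrderedEigenbasis H g) :
    EnTO H T \ TO H T ⊆ relFrontier (PsiDomain H T g) (EnTO H T) := by
  rintro S ⟨hS, hn⟩
  refine ⟨⟨S, EnTO_subset_PsiDomain hg hS⟩, ⟨subset_closure hS, fun hi => hn ?_⟩, rfl⟩
  exact (mem_TO_iff_relInterior hg hS).mpr (Or.inr ⟨_, hi, rfl⟩)

end Parametrization

end ThermalOps

namespace ThermalOps

/-! ### Closed polygons with prescribed side lengths -/

section Phases

/-- The third side of a triangle with two given sides can be realized by phases. -/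
theorem exists_phase_norm {a b t : ℝ} (ha : 0 ≤ a) (hb : 0 ≤ b) (h1 : |a - b| ≤ t)
    (h2 : t ≤ a + b) : ∃ u : ℂ, ‖u‖ = 1 ∧ ‖(a : ℂ) + b * u‖ = t := by
  have hc : Continuous fun θ : ℝ => ‖(a : ℂ) + b * Complex.exp (θ * Complex.I)‖ := by fun_prop
  have h0 : ‖(a : ℂ) + b * Complex.exp ((0 : ℝ) * Complex.I)‖ = a + b := by
    rw [Complex.ofReal_zero, zero_mul, Complex.exp_zero, mul_one, ← Complex.ofReal_add,
      Complex.norm_real, Real.norm_of_nonneg (by positivity)]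
  have hpi : ‖(a : ℂ) + b * Complex.exp ((Real.pi : ℝ) * Complex.I)‖ = |a - b| := by
    rw [Complex.exp_pi_mul_I, mul_neg_one, ← sub_eq_add_neg, ← Complex.ofReal_sub,
      Complex.norm_real, Real.norm_eq_abs]
  -- The length varies continuously from a + b at angle 0 to |a - b| at angle π.
  obtain ⟨θ, -, hθ⟩ := intermediate_value_Icc' Real.pi_pos.le hc.continuousOn
    (show t ∈ Set.Icc _ _ by
      simp only [h0, hpi]
      exact ⟨h1, h2⟩)
  exact ⟨_, Complex.norm_exp_ofReal_mul_I θ, hθ⟩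

theorem exists_phases_triangle {a b c : ℝ} (ha : 0 ≤ a) (hb : 0 ≤ b) (hc : 0 ≤ c)
    (h1 : a ≤ b + c) (h2 : b ≤ a + c) (h3 : c ≤ a + b) :
    ∃ u v : ℂ, ‖u‖ = 1 ∧ ‖v‖ = 1 ∧ (a : ℂ) + b * u + c * v = 0 := by
  obtain ⟨u, hu, hn⟩ := exists_phase_norm ha hb
    (abs_sub_le_iff.mpr ⟨by linarith, by linarith⟩) h3
  rcases hc.eq_or_lt with rfl | hc
  · refine ⟨u, 1, hu, by simp, ?_⟩
    rw [norm_eq_zero] at hn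
    simp [hn]
  · refine ⟨u, -(((a : ℂ) + b * u) / c), hu, ?_, ?_⟩
    · rw [norm_neg, norm_div, hn, Complex.norm_real, Real.norm_of_nonneg hc.le, div_self hc.ne']
    · have : (c : ℂ) ≠ 0 := by exact_mod_cast hc.ne'
      field_simp
      ring

theorem exists_unit_mul_norm (w : ℂ) : ∃ u : ℂ, ‖u‖ = 1 ∧ w = ‖w‖ * u := by
  obtain ⟨φ, -, h⟩ := exists_polar w
  exact ⟨_, Complex.norm_exp_ofReal_mul_I φ, h.symm⟩

/-- For `q > 1/2` finitely many vectors of lengths `1, q, q², …` form a closed polygon. -/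
theorem exists_phases_sum_eq_zero {q : ℝ} (hq : 1 / 2 < q) (hq1 : q ≤ 1) :
    ∃ (m : ℕ) (z : ℕ → ℂ), (∀ j, ‖z j‖ = 1) ∧
      ∑ j ∈ Finset.range (m + 1), ((q ^ j : ℝ) : ℂ) * z j = 0 := by
  have hq0 : 0 < q := by linarith
  have hex : ∃ M : ℕ, 1 ≤ ∑ j ∈ Finset.range (M + 1), q ^ (j + 1) := by
    rcases hq1.eq_or_lt with rfl | hq1
    · exact ⟨0, by simp⟩
    · have hs : HasSum (fun j => q ^ (j + 1)) (q * (1 - q)⁻¹) := by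
        simpa [pow_succ'] using (hasSum_geometric_of_lt_one hq0.le hq1).mul_left q
      have ht := hs.tendsto_sum_nat
      -- The sides q, q², … have total length q/(1-q), which exceeds the first side 1 because q >
      -- 1/2.
      have h1 : 1 < q * (1 - q)⁻¹ := by
        rw [← div_eq_mul_inv, lt_div_iff₀ (by linarith)]
        linarith
      obtain ⟨N, hN⟩ := (ht.eventually (lt_mem_nhds h1)).exists
      refine ⟨N, hN.le.trans ?_⟩
      rw [Finset.sum_range_succ]
      have := pow_pos hq0 (N + 1)
      linarith
  classical
  -- With M minimal, the lengths 1, q + … + q^M and q^(M+1) satisfy the triangle inequalities. The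
  -- middle group is laid out along one direction.
  obtain ⟨M, hM, hmin⟩ : ∃ M : ℕ, 1 ≤ ∑ j ∈ Finset.range (M + 1), q ^ (j + 1) ∧
      ∑ j ∈ Finset.range M, q ^ (j + 1) < 1 := by
    refine ⟨Nat.find hex, Nat.find_spec hex, ?_⟩
    rcases h : Nat.find hex with _ | k
    · simp
    · exact not_le.mp (Nat.find_min hex (m := k) (by omega))
  set A := ∑ j ∈ Finset.range M, q ^ (j + 1) with hA
  have hA0 : 0 ≤ A := Finset.sum_nonneg fun j _ => (pow_pos hq0 _).le
  have hB0 : 0 < q ^ (M + 1) := pow_pos hq0 _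
  have hB1 : q ^ (M + 1) ≤ 1 := pow_le_one₀ hq0.le hq1
  rw [Finset.sum_range_succ, ← hA] at hM
  obtain ⟨u, v, hu, hv, huv⟩ := exists_phases_triangle zero_le_one hA0 hB0.le hM
    (by linarith) (by linarith)
  refine ⟨M + 1, fun j => if j = 0 then 1 else if j = M + 1 then v else u, fun j => ?_, ?_⟩
  · simp only
    split_ifs <;> simp [hu, hv]
  · rw [Finset.sum_range_succ, Finset.sum_range_succ', ← huv]
    have : ∑ j ∈ Finset.range M, ((q ^ (j + 1) : ℝ) : ℂ) *
        (if j + 1 = 0 then 1 else if j + 1 = M + 1 then v else u) = A * u := by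
      rw [hA, Complex.ofReal_sum, Finset.sum_mul]
      refine Finset.sum_congr rfl fun j hj => ?_
      have : j ≠ M := (Finset.mem_range.mp hj).ne
      simp [this]
    rw [this]
    simp
    ring

end Phases

/-! ### The semigroup generated by truncated baths -/

section Semigroup

variable {H : Matrix (Fin 2) (Fin 2) ℂ} {g : QubitBasis} {T : ℝ≥0∞} {q : ℝ}

theorem canonicalMap_mul (g : QubitBasis) (q l₁ l₂ : ℝ) (c₁ c₂ : ℂ) :
    canonicalMap g q l₁ c₁ * canonicalMap g q l₂ c₂ =
      canonicalMap g q ((1 - l₁ * q) * l₂ + l₁ * (1 - l₂)) (c₁ * c₂) := by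
  refine superop_ext (g := g) fun j k x y => ?_
  rw [mul_apply_eq_comp]
  simp only [canonicalMap, matrixElement_covMap]
  fin_cases x <;> fin_cases y <;> simp [matrixElement_covMap] <;> ring

/-- For the λ of the composite, 1-λ ≥ (1-l₁)(1-l₂) and 1-λq ≥ (1-l₁q)(1-l₂q), so f(λ) ≥ f(l₁) f(l₂).
Strictness in one factor is inherited, since the other factor's f is positive. -/
theorem mul_mem_thermalRegion (hq : 0 < q) (hq1 : q ≤ 1) {l₁ l₂ : ℝ} {c₁ c₂ : ℂ}
    (h₁ : (l₁, c₁) ∈ thermalRegion q) (h₂ : (l₂, c₂) ∈ thermalRegion q) :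
    ((1 - l₁ * q) * l₂ + l₁ * (1 - l₂), c₁ * c₂) ∈ thermalRegion q := by
  have hx := thermalRegion_subset_enhancedRegion h₁
  have hy := thermalRegion_subset_enhancedRegion h₂
  obtain ⟨a0, a1, ac⟩ := hx
  obtain ⟨b0, b1, bc⟩ := hy
  have a1' : l₁ < 1 := by
    rcases h₁ with h | h
    · exact h.1.trans_lt one_pos
    · exact h.2.1
  have b1' : l₂ < 1 := by
    rcases h₂ with h | h
    · exact h.1.trans_lt one_pos
    · exact h.2.1
  simp only at a0 a1 ac b0 b1 bc
  have aq : 0 < 1 - l₁ * q := by nlinarith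
  have bq : 0 < 1 - l₂ * q := by nlinarith
  have au : 0 < 1 - l₁ := by linarith
  have bu : 0 < 1 - l₂ := by linarith
  have hn : ‖c₁ * c₂‖ ^ 2 = ‖c₁‖ ^ 2 * ‖c₂‖ ^ 2 := by rw [norm_mul, mul_pow]
  have hll : 0 ≤ l₁ * l₂ * q := by positivity
  have e1 : (1 - l₁) * (1 - l₂) ≤ 1 - ((1 - l₁ * q) * l₂ + l₁ * (1 - l₂)) := by nlinarith
  have e2 : (1 - l₁ * q) * (1 - l₂ * q) ≤ 1 - ((1 - l₁ * q) * l₂ + l₁ * (1 - l₂)) * q := by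
    nlinarith
  have e3 : (1 - l₁) * (1 - l₁ * q) * ((1 - l₂) * (1 - l₂ * q)) ≤
      (1 - ((1 - l₁ * q) * l₂ + l₁ * (1 - l₂))) *
        (1 - ((1 - l₁ * q) * l₂ + l₁ * (1 - l₂)) * q) := by
    have := mul_le_mul e1 e2 (by positivity) ((mul_pos au bu).le.trans e1)
    linarith
  have hmem : ((1 - l₁ * q) * l₂ + l₁ * (1 - l₂), c₁ * c₂) ∈ enhancedRegion q := by
    refine ⟨?_, ?_, ?_⟩
    · simp only
      positivity
    · simp only
      linarith [mul_pos au bu]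
    · simp only [hn]
      exact (mul_le_mul ac bc (sq_nonneg _) (by positivity)).trans e3
  refine (mem_thermalRegion_iff hmem).mpr ?_
  simp only [hn]
  rcases (mem_thermalRegion_iff ⟨a0, a1, ac⟩).mp h₁ with h | h <;>
    rcases (mem_thermalRegion_iff ⟨b0, b1, bc⟩).mp h₂ with h' | h' <;> simp only at h h'
  · left
    simp [h, h']
  · right
    calc _ ≤ (1 - l₁) * (1 - l₁ * q) * ‖c₂‖ ^ 2 := by gcongr
      _ < (1 - l₁) * (1 - l₁ * q) * ((1 - l₂) * (1 - l₂ * q)) := by gcongr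
      _ ≤ _ := e3
  · right
    calc _ ≤ ‖c₁‖ ^ 2 * ((1 - l₂) * (1 - l₂ * q)) := by gcongr
      _ < (1 - l₁) * (1 - l₁ * q) * ((1 - l₂) * (1 - l₂ * q)) := by gcongr
      _ ≤ _ := e3
  · right
    calc _ ≤ ‖c₁‖ ^ 2 * ((1 - l₂) * (1 - l₂ * q)) := by gcongr
      _ < (1 - l₁) * (1 - l₁ * q) * ((1 - l₂) * (1 - l₂ * q)) := by gcongr
      _ ≤ _ := e3

theorem mul_mem_TO (hg : IsOrderedEigenbasis H g) {S R : Superop (Fin 2)} (hS : S ∈ TO H T)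
    (hR : R ∈ TO H T) : S * R ∈ TO H T := by
  obtain ⟨x, hx, rfl⟩ := (mem_TO_iff hg).mp hS
  obtain ⟨y, hy, rfl⟩ := (mem_TO_iff hg).mp hR
  rw [canonicalMap_mul, canonicalMap_mem_TO_iff hg]
  exact mul_mem_thermalRegion (boltzmannFactor_pos H T) (hg.boltzmannFactor_le_one T) hx hy

theorem truncatedSemigroup_subset_TO (hg : IsOrderedEigenbasis H g) :
    truncatedSemigroup H T ⊆ TO H T := fun S hS =>
  (Subsemigroup.closure_le (S := ⟨TO H T, fun hR hR' => mul_mem_TO hg hR hR'⟩)).mpr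
    (truncatedTO_subset_TO H T) hS

theorem mem_truncatedSemigroup_of_mem {S : Superop (Fin 2)} (h : S ∈ truncatedTO H T) :
    S ∈ truncatedSemigroup H T :=
  Subsemigroup.subset_closure h

theorem mul_mem_truncatedSemigroup {S R : Superop (Fin 2)} (hS : S ∈ truncatedSemigroup H T)
    (hR : R ∈ truncatedSemigroup H T) : S * R ∈ truncatedSemigroup H T :=
  Subsemigroup.mul_mem _ hS hR

theorem zero_mem_truncatedTO (hg : IsOrderedEigenbasis H g) {m : ℕ} {z : ℕ → ℂ}
    (hz : ∀ j, ‖z j‖ = 1) :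
    canonicalMap g (boltzmannFactor H T) 0 (∑ j ∈ Finset.range (m + 1),
      ((truncWeight (boltzmannFactor H T) m j : ℝ) : ℂ) * z j) ∈ truncatedTO H T := by
  obtain ⟨U, hU, h⟩ := exists_truncated_eq_canonicalMap (T := T) hg (IsProfile.const_one m) hz
  exact ⟨m, U, hU, by simpa using h.symm⟩

/-- Maps with `λ = 0` and `|c|` in an interval `[a, 1]` come from a bath with two levels. -/
theorem zero_mem_truncatedSemigroup_of_le (hg : IsOrderedEigenbasis H g) {t : ℝ}
    (h1 : 1 / (1 + boltzmannFactor H T) - boltzmannFactor H T / (1 + boltzmannFactor H T) ≤ t)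
    (h2 : t ≤ 1) {w : ℂ} (hw : ‖w‖ = 1) :
    canonicalMap g (boltzmannFactor H T) 0 (t * w) ∈ truncatedSemigroup H T := by
  have hq := boltzmannFactor_pos H T
  have hq1 := hg.boltzmannFactor_le_one T
  set q := boltzmannFactor H T with hqdef
  have hsum : 1 / (1 + q) + q / (1 + q) = 1 := by field_simp
  have hle : q / (1 + q) ≤ 1 / (1 + q) := by gcongr
  obtain ⟨u, hu, hn⟩ := exists_phase_norm (a := 1 / (1 + q)) (b := q / (1 + q)) (t := t)
    (by positivity) (by positivity) (by rwa [abs_of_nonneg (by linarith)]) (by linarith)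
  obtain ⟨v, hv, hvn⟩ := exists_unit_mul_norm (((1 / (1 + q) : ℝ) : ℂ) + ((q / (1 + q) : ℝ) : ℂ) * u)
  have hv0 : v ≠ 0 := by
    rintro rfl
    simp at hv
  refine mem_truncatedSemigroup_of_mem ?_
  -- Dividing both phases by v turns the sum of modulus t into the positive axis, and w then gives
  -- it the required direction.
  convert zero_mem_truncatedTO (T := T) hg (m := 1)
    (z := fun j => if j = 0 then w / v else u * w / v) fun j => ?_ using 2
  · rw [← hqdef, Finset.sum_range_succ, Finset.sum_range_one]
    have w0 : truncWeight q 1 0 = 1 / (1 + q) := by simp [truncWeight, Finset.sum_range_succ]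
    have w1 : truncWeight q 1 1 = q / (1 + q) := by simp [truncWeight, Finset.sum_range_succ]
    rw [w0, w1]
    rw [hn] at hvn
    simp only [if_true, one_ne_zero, if_false]
    field_simp
    linear_combination (-w) * hvn
  · split_ifs <;> simp [hu, hw, hv]

/-- At λ = 0 composition multiplies the coherences, so the moduli in [a, 1] generate those in [a^n,
1] for every n, hence all of (0, 1]. -/
theorem zero_mem_truncatedSemigroup (hg : IsOrderedEigenbasis H g) {c : ℂ} (hc0 : c ≠ 0)
    (hc : ‖c‖ ≤ 1) : canonicalMap g (boltzmannFactor H T) 0 c ∈ truncatedSemigroup H T := by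
  have hq := boltzmannFactor_pos H T
  have hq1 := hg.boltzmannFactor_le_one T
  -- The maximum with 1/2 keeps a positive when q = 1, where the two-level bound is 0.
  set a := max (1 / 2) (1 / (1 + boltzmannFactor H T) -
    boltzmannFactor H T / (1 + boltzmannFactor H T)) with ha
  have ha0 : 0 < a := lt_of_lt_of_le (by norm_num) (le_max_left _ _)
  have ha1 : a < 1 := by
    refine max_lt (by norm_num) ?_
    rw [← sub_div, div_lt_one (by positivity)]
    linarith
  have key : ∀ n : ℕ, ∀ t : ℝ, a ^ n ≤ t → t ≤ 1 → ∀ w : ℂ, ‖w‖ = 1 →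
      canonicalMap g (boltzmannFactor H T) 0 (t * w) ∈ truncatedSemigroup H T := by
    intro n
    induction n with
    | zero =>
      intro t h1 h2 w hw
      obtain rfl : t = 1 := le_antisymm h2 (by simpa using h1)
      exact zero_mem_truncatedSemigroup_of_le hg ((le_max_right _ _).trans ha1.le) le_rfl hw
    | succ n ih =>
      intro t h1 h2 w hw
      rcases le_or_gt a t with h | h
      · exact zero_mem_truncatedSemigroup_of_le hg ((le_max_right _ _).trans h) h2 hw
      · have hA := zero_mem_truncatedSemigroup_of_le (T := T) hg (le_max_right _ _) ha1.le
          (w := 1) (by simp)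
        have hB := ih (t / a) (by rwa [le_div_iff₀ ha0, ← pow_succ])
          ((div_le_one ha0).mpr h.le) w hw
        have := mul_mem_truncatedSemigroup hA hB
        rw [canonicalMap_mul] at this
        convert this using 2
        · simp
        · have : (a : ℂ) ≠ 0 := by exact_mod_cast ha0.ne'
          rw [← ha]
          push_cast
          field_simp
  obtain ⟨u, hu, hcu⟩ := exists_unit_mul_norm c
  obtain ⟨n, hn⟩ := exists_pow_lt_of_lt_one (norm_pos_iff.mpr hc0) ha1
  rw [hcu]
  exact key n _ hn.le hc u hu

/-- Equal phases give a real coherence at least as large as required; it is lowered afterwards by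
composing with a map that has λ = 0. -/
theorem exists_truncated_of_mem_thermalRegion (hg : IsOrderedEigenbasis H g) {l : ℝ} {c : ℂ}
    (h : (l, c) ∈ thermalRegion (boltzmannFactor H T)) :
    ∃ r : ℝ, ‖c‖ ≤ r ∧ canonicalMap g (boltzmannFactor H T) l r ∈ truncatedSemigroup H T := by
  rcases h with ⟨rfl, hc⟩ | ⟨h0, h1, hc⟩
  · exact ⟨1, hc, zero_mem_truncatedSemigroup hg (by simp) (by simp)⟩
  · obtain ⟨m, σ, hσ, hl, hr⟩ := exists_profile (boltzmannFactor_pos H T)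
      (hg.boltzmannFactor_le_one T) h0 h1 (norm_nonneg c) hc
    obtain ⟨U, hU, hS⟩ := exists_truncated_eq_canonicalMap (T := T) hg hσ (z := fun _ => 1)
      fun _ => by simp
    refine ⟨_, hr, mem_truncatedSemigroup_of_mem ⟨m, U, hU, ?_⟩⟩
    rw [hS, hl]
    simp

theorem mem_truncatedSemigroup_of_ne_zero (hg : IsOrderedEigenbasis H g) {l : ℝ} {c : ℂ}
    (h : (l, c) ∈ thermalRegion (boltzmannFactor H T)) (hc : c ≠ 0) :
    canonicalMap g (boltzmannFactor H T) l c ∈ truncatedSemigroup H T := by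
  obtain ⟨r, hr, hS⟩ := exists_truncated_of_mem_thermalRegion hg h
  have hr0 : 0 < r := (norm_pos_iff.mpr hc).trans_le hr
  have hr0' : (r : ℂ) ≠ 0 := by exact_mod_cast hr0.ne'
  have := mul_mem_truncatedSemigroup hS (zero_mem_truncatedSemigroup (T := T) hg
    (c := c / r) (div_ne_zero hc hr0') (by
      rw [norm_div, Complex.norm_real, Real.norm_of_nonneg hr0.le]
      exact div_le_one_of_le₀ hr hr0.le))
  rw [canonicalMap_mul] at this
  convert this using 2
  · ring
  · field_simp

/-- The closed polygon gives a map with (λ, c) = (0, 0), which erases coherence and leaves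
populations unchanged. Composing with it supplies the only missing points, those with c = 0. -/
theorem truncatedSemigroup_eq_TO_of_half_lt (hg : IsOrderedEigenbasis H g)
    (hq : 1 / 2 < boltzmannFactor H T) : truncatedSemigroup H T = TO H T := by
  refine (truncatedSemigroup_subset_TO hg).antisymm fun S hS => ?_
  obtain ⟨⟨l, c⟩, hx, rfl⟩ := (mem_TO_iff hg).mp hS
  by_cases hc : c = 0
  · subst hc
    obtain ⟨m, z, hz, hsum⟩ := exists_phases_sum_eq_zero hq (hg.boltzmannFactor_le_one T)
    have h0 := mem_truncatedSemigroup_of_mem (zero_mem_truncatedTO (T := T) hg (m := m) hz)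
    have : ∑ j ∈ Finset.range (m + 1), ((truncWeight (boltzmannFactor H T) m j : ℝ) : ℂ) * z j =
        0 := by
      rw [← mul_zero (((∑ k ∈ Finset.range (m + 1), boltzmannFactor H T ^ k : ℝ) : ℂ)⁻¹), ← hsum,
        Finset.mul_sum]
      refine Finset.sum_congr rfl fun j _ => ?_
      rw [truncWeight]
      push_cast
      ring
    rw [this] at h0
    obtain ⟨r, -, hr⟩ := exists_truncated_of_mem_thermalRegion hg hx
    have := mul_mem_truncatedSemigroup hr h0
    rw [canonicalMap_mul] at this
    convert this using 2 <;> ring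
  · exact mem_truncatedSemigroup_of_ne_zero hg hx hc

theorem symmDiff_truncatedSemigroup_TO_subset (hg : IsOrderedEigenbasis H g) :
    symmDiff (truncatedSemigroup H T) (TO H T) ⊆
      PsiPreimage H T g {x | x.1 ∈ Set.Icc (0 : ℝ) 1 ∧ x.2 = 0} := by
  rintro S (⟨h, hn⟩ | ⟨h, hn⟩)
  · exact absurd (truncatedSemigroup_subset_TO hg h) hn
  · refine ⟨EnTO_subset_PsiDomain hg (TO_subset_EnTO H T h), ?_⟩
    obtain ⟨⟨l, c⟩, hx, rfl⟩ := (mem_TO_iff hg).mp h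
    rw [Psi_canonicalMap]
    obtain ⟨h0, h1, -⟩ := thermalRegion_subset_enhancedRegion hx
    refine ⟨⟨h0, h1⟩, ?_⟩
    by_contra hc
    exact hn (mem_truncatedSemigroup_of_ne_zero hg hx hc)

/-- Only points with c = 0 can be missing, and they are limits along small positive c at the same λ.
-/
theorem closure_truncatedSemigroup (hg : IsOrderedEigenbasis H g) :
    closure (truncatedSemigroup H T) = closure (TO H T) := by
  refine (closure_mono (truncatedSemigroup_subset_TO hg)).antisymm
    (closure_minimal ?_ isClosed_closure)
  intro S hS
  obtain ⟨⟨l, c⟩, hx, rfl⟩ := (mem_TO_iff hg).mp hS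
  by_cases hc : c = 0
  · subst hc
    have hcont : Continuous fun ε : ℝ => canonicalMap g (boltzmannFactor H T) l (ε : ℂ) :=
      (continuous_canonicalMap g (boltzmannFactor H T)).comp
        (f := fun ε : ℝ => (l, (ε : ℂ))) (by fun_prop)
    have hlim : Filter.Tendsto (fun ε : ℝ => canonicalMap g (boltzmannFactor H T) l (ε : ℂ))
        (nhdsWithin 0 (Set.Ioi 0)) (nhds (canonicalMap g (boltzmannFactor H T) l 0)) := by
      simpa using (hcont.tendsto 0).mono_left (nhdsWithin_le_nhds (s := Set.Ioi (0 : ℝ)))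
    refine mem_closure_of_tendsto hlim ?_
    have hreg : ∀ᶠ ε : ℝ in nhdsWithin 0 (Set.Ioi 0),
        (l, (ε : ℂ)) ∈ thermalRegion (boltzmannFactor H T) := by
      rcases hx with ⟨h0, -⟩ | ⟨h0, h1, h⟩
      · filter_upwards [Ioo_mem_nhdsGT (show (0 : ℝ) < 1 from zero_lt_one)] with ε hε
        refine Or.inl ⟨h0, ?_⟩
        simpa [abs_of_pos hε.1] using hε.2.le
      · have : ∀ᶠ ε : ℝ in nhds 0, ‖(ε : ℂ)‖ ^ 2 < (1 - l) * (1 - l * boltzmannFactor H T) :=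
          ContinuousAt.eventually_lt (f := fun ε : ℝ => ‖(ε : ℂ)‖ ^ 2) (by fun_prop) (by fun_prop)
            (by simpa using h)
        filter_upwards [nhdsWithin_le_nhds this] with ε hε
        exact Or.inr ⟨h0, h1, hε⟩
    filter_upwards [hreg, self_mem_nhdsWithin] with ε h1 h2
    exact mem_truncatedSemigroup_of_ne_zero hg h1 (by
      have : (0 : ℝ) < ε := h2
      exact_mod_cast this.ne')
  · exact subset_closure (mem_truncatedSemigroup_of_ne_zero hg hx hc)

end Semigroup

end ThermalOps

namespace ThermalOps

/-! ### The temperature threshold in terms of the Boltzmann factor -/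

section Threshold

theorem exp_invTemp_ofReal {Δ t : ℝ} (ht : 0 < t) :
    Real.exp (-(invTemp (ENNReal.ofReal t) * Δ)) = Real.exp (-(Δ / t)) := by
  rw [invTemp, ENNReal.toReal_inv, ENNReal.toReal_ofReal ht.le, div_eq_inv_mul]

theorem half_eq_exp_neg_log_two : (1 / 2 : ℝ) = Real.exp (-Real.log 2) := by
  rw [Real.exp_neg, Real.exp_log two_pos, one_div]

theorem lt_ofReal_div_log_two_iff {Δ : ℝ} {T : ℝ≥0∞} (hT : 0 < T) :
    T < ENNReal.ofReal (Δ / Real.log 2) ↔ Real.exp (-(invTemp T * Δ)) < 1 / 2 := by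
  have hl : 0 < Real.log 2 := Real.log_pos one_lt_two
  rcases eq_or_ne T ⊤ with rfl | hTtop
  · simp [invTemp]
    norm_num
  · have ht : 0 < T.toReal := ENNReal.toReal_pos hT.ne' hTtop
    rw [← ENNReal.ofReal_toReal hTtop, exp_invTemp_ofReal ht, half_eq_exp_neg_log_two,
      ENNReal.ofReal_lt_ofReal_iff_of_nonneg ht.le, Real.exp_lt_exp, neg_lt_neg_iff,
      lt_div_iff₀ hl, lt_div_iff₀ ht, mul_comm]

theorem ofReal_div_log_two_lt_iff {Δ : ℝ} (hΔ : 0 < Δ) {T : ℝ≥0∞} (hT : 0 < T) :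
    ENNReal.ofReal (Δ / Real.log 2) < T ↔ 1 / 2 < Real.exp (-(invTemp T * Δ)) := by
  have hl : 0 < Real.log 2 := Real.log_pos one_lt_two
  rcases eq_or_ne T ⊤ with rfl | hTtop
  · simp [invTemp]
    norm_num
  · have ht : 0 < T.toReal := ENNReal.toReal_pos hT.ne' hTtop
    rw [← ENNReal.ofReal_toReal hTtop, exp_invTemp_ofReal ht, half_eq_exp_neg_log_two,
      ENNReal.ofReal_lt_ofReal_iff_of_nonneg (div_pos hΔ hl).le, Real.exp_lt_exp, neg_lt_neg_iff,
      div_lt_iff₀ hl, div_lt_iff₀ ht, mul_comm]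

end Threshold

/-! ### Truncated baths with q ≤ 1/2 cannot erase coherence -/

section NonZero

variable {H : Matrix (Fin 2) (Fin 2) ℂ} {g : QubitBasis} {T : ℝ≥0∞}

theorem sum_norm_sq_col {ι : Type*} [Fintype ι] [DecidableEq ι] {U : Matrix ι ι ℂ}
    (hU : U ∈ Matrix.unitaryGroup ι ℂ) (y : ι) : ∑ x, ‖U x y‖ ^ 2 = 1 := by
  have h := congrFun (congrFun (Matrix.mem_unitaryGroup_iff'.mp hU) y) y
  rw [Matrix.star_eq_conjTranspose, Matrix.mul_apply, Matrix.one_apply_eq] at h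
  have : ((∑ x, ‖U x y‖ ^ 2 : ℝ) : ℂ) = 1 := by
    rw [← h, Complex.ofReal_sum]
    refine Finset.sum_congr rfl fun x _ => ?_
    rw [Matrix.conjTranspose_apply, Complex.star_def, mul_comm, Complex.mul_conj,
      Complex.normSq_eq_norm_sq]
  exact_mod_cast this

theorem sum_norm_sq_row {ι : Type*} [Fintype ι] [DecidableEq ι] {U : Matrix ι ι ℂ}
    (hU : U ∈ Matrix.unitaryGroup ι ℂ) (x : ι) : ∑ y, ‖U x y‖ ^ 2 = 1 := by
  have h := sum_norm_sq_col (Unitary.star_mem hU) x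
  rw [← h]
  refine Finset.sum_congr rfl fun y _ => ?_
  rw [Matrix.star_apply, norm_star]

theorem eq_zero_of_norm_eq_one {ι : Type*} [Fintype ι] [DecidableEq ι] {f : ι → ℂ}
    (hf : ∑ x, ‖f x‖ ^ 2 = 1) {x : ι} (hx : ‖f x‖ = 1) {y : ι} (hy : y ≠ x) : f y = 0 := by
  have h := Finset.add_sum_erase Finset.univ (fun x => ‖f x‖ ^ 2) (Finset.mem_univ x)
  simp only [hf, hx, one_pow, add_eq_left] at h
  have := (Finset.sum_eq_zero_iff_of_nonneg fun i _ => sq_nonneg ‖f i‖).mp h y (by simp [hy])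
  simpa using this

theorem norm_eq_one_of_forall_ne {ι : Type*} [Fintype ι] [DecidableEq ι] {f : ι → ℂ}
    (hf : ∑ x, ‖f x‖ ^ 2 = 1) {x : ι} (hx : ∀ y, y ≠ x → f y = 0) : ‖f x‖ = 1 := by
  rw [Finset.sum_eq_single x (fun y _ hy => by simp [hx y hy]) (by simp)] at hf
  nlinarith [norm_nonneg (f x)]

/-- The finite sum (1 - q^(m+1))/(1-q) stays below 2 even at q = 1/2. This is why the threshold for
the truncated baths is strict. -/
theorem half_lt_truncWeight_zero {q : ℝ} (hq : 0 < q) (hq2 : q ≤ 1 / 2) (m : ℕ) :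
    1 / 2 < truncWeight q m 0 := by
  have hpos : 0 < ∑ k ∈ Finset.range (m + 1), q ^ k :=
    Finset.sum_pos (fun k _ => pow_pos hq k) (by simp)
  rw [truncWeight, pow_zero, div_lt_div_iff₀ two_pos hpos, one_mul, one_mul]
  have := geom_sum_mul_neg q (m + 1)
  have := pow_pos hq (m + 1)
  nlinarith

theorem sum_phases_ne_zero {q : ℝ} (hq : 0 < q) (hq2 : q ≤ 1 / 2) (m : ℕ) {w : Fin (m + 1) → ℂ}
    (hw : ∀ j, ‖w j‖ = 1) :
    ∑ j : Fin (m + 1), ((truncWeight q m j : ℝ) : ℂ) * w j ≠ 0 := by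
  intro h
  have hs := sum_truncWeight hq m
  rw [← Fin.sum_univ_eq_sum_range (truncWeight q m), Fin.sum_univ_succ] at hs
  rw [Fin.sum_univ_succ, add_eq_zero_iff_eq_neg] at h
  have hn (j : Fin (m + 1)) : ‖((truncWeight q m j : ℝ) : ℂ) * w j‖ = truncWeight q m j := by
    rw [norm_mul, hw, mul_one, Complex.norm_real,
      Real.norm_of_nonneg (truncWeight_nonneg hq m j)]
  have h1 := congrArg norm h
  rw [norm_neg, hn] at h1
  have h2 := norm_sum_le Finset.univ fun j : Fin m =>
    ((truncWeight q m j.succ : ℝ) : ℂ) * w j.succ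
  simp only [hn] at h2
  have := half_lt_truncWeight_zero hq hq2 m
  simp only [Fin.val_zero] at *
  linarith

/-- All bath weights are positive, so λ = 0 makes the block from g₂ to g₁ vanish. Energy
conservation and unitarity then make the diagonal blocks diagonal matrices of phases, and c is a
weighted sum of phases whose first weight dominates. -/
theorem Psi_ne_zero_of_mem_truncatedTO (hg : IsOrderedEigenbasis H g)
    (hq2 : boltzmannFactor H T ≤ 1 / 2) {S : Superop (Fin 2)} (hS : S ∈ truncatedTO H T)
    (hl : (Psi g S).1 = 0) : (Psi g S).2 ≠ 0 := by
  obtain ⟨m, U, hU, rfl⟩ := hS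
  obtain ⟨E, hE, hgap, hH⟩ := hg.exists_eq
  have hq := boltzmannFactor_pos H T
  obtain ⟨U, hU', rfl⟩ := exists_basisLift hH hU
  have hcomm := hU'.commute
  rw [totalHamiltonian_truncatedBath] at hcomm
  have hen (i : Fin 2) (a b : Fin (m + 1)) (hab : a ≠ b) : U (i, a) (i, b) = 0 := by
    have := congrFun (congrFun hcomm.eq (i, a)) (i, b)
    rw [Matrix.mul_diagonal, Matrix.diagonal_mul] at this
    have hne : (((a : ℕ) : ℝ) - (b : ℕ)) * energyGap H ≠ 0 := by
      refine mul_ne_zero (sub_ne_zero.mpr ?_) hg.energyGap_pos.ne'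
      exact_mod_cast Fin.val_ne_of_ne hab
    have hne' : ((((a : ℕ) : ℝ) - (b : ℕ)) * energyGap H : ℂ) ≠ 0 := by exact_mod_cast hne
    refine (mul_eq_zero.mp (?_ : ((((a : ℕ) : ℝ) - (b : ℕ)) * energyGap H : ℂ) *
      U (i, a) (i, b) = 0)).resolve_left hne'
    push_cast at this ⊢
    linear_combination -this
  have hω : gibbs (truncatedBath (energyGap H) m) T = Matrix.diagonal fun j : Fin (m + 1) =>
      ((truncWeight (boltzmannFactor H T) m j : ℝ) : ℂ) := gibbs_truncatedBath _ T m
  have hp (j : ℕ) : 0 < truncWeight (boltzmannFactor H T) m j :=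
    div_pos (pow_pos hq j) (Finset.sum_pos (fun k _ => pow_pos hq k) (by simp))
  rw [Psi, thermalMap] at hl ⊢
  simp only [matrixElement_dilation, hω] at hl ⊢
  have h01 (a b : Fin (m + 1)) : U (0, a) (1, b) = 0 := by
    rw [Matrix.trace, Complex.re_sum] at hl
    have hterm (a : Fin (m + 1)) : ((systemBlock U 0 1 * (Matrix.diagonal fun j : Fin (m + 1) =>
        ((truncWeight (boltzmannFactor H T) m j : ℝ) : ℂ)) *
        (systemBlock U 0 1).conjTranspose).diag a).re =
        ∑ b : Fin (m + 1), truncWeight (boltzmannFactor H T) m b * ‖U (0, a) (1, b)‖ ^ 2 := by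
      rw [Matrix.diag_apply, Matrix.mul_apply, Complex.re_sum]
      refine Finset.sum_congr rfl fun b _ => ?_
      rw [Matrix.mul_diagonal, Matrix.conjTranspose_apply, systemBlock, Matrix.of_apply,
        ← Complex.normSq_eq_norm_sq, ← Complex.ofReal_re (truncWeight _ _ _ * _),
        Complex.ofReal_mul, ← Complex.mul_conj, Complex.star_def]
      congr 1
      ring
    rw [Finset.sum_congr rfl fun a _ => hterm a] at hl
    have hnn (a b : Fin (m + 1)) : 0 ≤ truncWeight (boltzmannFactor H T) m b *
        ‖U (0, a) (1, b)‖ ^ 2 := mul_nonneg (hp b).le (sq_nonneg _)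
    have h1 := (Finset.sum_eq_zero_iff_of_nonneg fun a _ =>
      Finset.sum_nonneg fun b _ => hnn a b).mp hl a (Finset.mem_univ a)
    have h2 := (Finset.sum_eq_zero_iff_of_nonneg fun b _ => hnn a b).mp h1 b (Finset.mem_univ b)
    simpa [(hp b).ne'] using h2
  have hfin : ∀ k : Fin 2, k = 0 ∨ k = 1 := by decide
  have h11 (b : Fin (m + 1)) : ‖U (1, b) (1, b)‖ = 1 := by
    refine norm_eq_one_of_forall_ne (f := fun x => U x (1, b)) (sum_norm_sq_col hU'.1 (1, b)) ?_
    rintro ⟨i, a⟩ hne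
    rcases hfin i with rfl | rfl
    · exact h01 a b
    · exact hen 1 a b fun h => hne (by rw [h])
  have h00 (b : Fin (m + 1)) : ‖U (0, b) (0, b)‖ = 1 := by
    refine norm_eq_one_of_forall_ne (f := fun x => U x (0, b)) (sum_norm_sq_col hU'.1 (0, b)) ?_
    rintro ⟨i, a⟩ hne
    rcases hfin i with rfl | rfl
    · exact hen 0 a b fun h => hne (by rw [h])
    -- The row (1, a) already has an entry of modulus one at (1, a), so its other entries vanish.
    · exact eq_zero_of_norm_eq_one (f := U (1, a)) (sum_norm_sq_row hU'.1 (1, a)) (h11 a)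
        (by simp)
  have hd (i : Fin 2) : systemBlock U i i = Matrix.diagonal fun b => U (i, b) (i, b) := by
    ext a b
    by_cases h : a = b
    · subst h
      simp [systemBlock]
    · simp [systemBlock, h, hen i a b h]
  rw [hd, hd, Matrix.diagonal_conjTranspose, Matrix.diagonal_mul_diagonal,
    Matrix.diagonal_mul_diagonal, Matrix.trace_diagonal]
  have := sum_phases_ne_zero hq hq2 m (w := fun b => U (0, b) (0, b) * star (U (1, b) (1, b)))
    fun b => by rw [norm_mul, norm_star, h00, h11, one_mul]
  convert this using 1
  refine Finset.sum_congr rfl fun b _ => ?_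
  rw [Pi.star_apply]
  ring

/-- The property "λ = 0 implies c ≠ 0" survives composition, because a product of thermal operations
has λ = 0 only if both factors do. The thermal operation with (λ, c) = (0, 0) lacks it. -/
theorem truncatedSemigroup_ne_TO (hg : IsOrderedEigenbasis H g)
    (hq2 : boltzmannFactor H T ≤ 1 / 2) : truncatedSemigroup H T ≠ TO H T := by
  have hq := boltzmannFactor_pos H T
  let G : Subsemigroup (Superop (Fin 2)) :=
    { carrier := {S | S ∈ TO H T ∧ ((Psi g S).1 = 0 → (Psi g S).2 ≠ 0)}
      mul_mem' := by
        rintro S R ⟨hS, hS0⟩ ⟨hR, hR0⟩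
        refine ⟨mul_mem_TO hg hS hR, ?_⟩
        obtain ⟨⟨l₁, c₁⟩, hx, rfl⟩ := (mem_TO_iff hg).mp hS
        obtain ⟨⟨l₂, c₂⟩, hy, rfl⟩ := (mem_TO_iff hg).mp hR
        rw [canonicalMap_mul, Psi_canonicalMap]
        rw [Psi_canonicalMap] at hS0 hR0
        simp only at hS0 hR0 ⊢
        intro h0
        have hx' := thermalRegion_subset_enhancedRegion hx
        have hy' := thermalRegion_subset_enhancedRegion hy
        obtain ⟨a0, a1, -⟩ := hx'
        obtain ⟨b0, b1, -⟩ := hy'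
        simp only at a0 a1 b0 b1
        have a1' : l₁ < 1 := by
          rcases hx with h | h
          · exact h.1.trans_lt one_pos
          · exact h.2.1
        have aq : 0 < 1 - l₁ * boltzmannFactor H T := by
          nlinarith [hg.boltzmannFactor_le_one T]
        have e1 : 0 ≤ (1 - l₁ * boltzmannFactor H T) * l₂ := mul_nonneg aq.le b0
        have e2 : 0 ≤ l₁ * (1 - l₂) := mul_nonneg a0 (by linarith)
        have hl₂ : l₂ = 0 := by
          have : (1 - l₁ * boltzmannFactor H T) * l₂ = 0 := by linarith
          exact (mul_eq_zero.mp this).resolve_left aq.ne'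
        subst hl₂
        have hl₁ : l₁ = 0 := by linarith
        exact mul_ne_zero (hS0 hl₁) (hR0 rfl) }
  have hle : truncatedSemigroup H T ⊆ G :=
    (Subsemigroup.closure_le (S := G)).mpr fun S hS =>
      ⟨truncatedTO_subset_TO H T hS, Psi_ne_zero_of_mem_truncatedTO hg hq2 hS⟩
  intro heq
  have hmem : canonicalMap g (boltzmannFactor H T) 0 0 ∈ TO H T :=
    (canonicalMap_mem_TO_iff hg).mpr (Or.inl ⟨rfl, by simp⟩)
  rw [← heq] at hmem
  have := (hle hmem).2
  rw [Psi_canonicalMap] at this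
  exact this rfl rfl

end NonZero

end ThermalOps

namespace ThermalOps

/-! ### The bosonic mode: matrix elements and a lower bound at low temperature -/

section Mode

variable {H : Matrix (Fin 2) (Fin 2) ℂ} {g : QubitBasis} {E : Fin 2 → ℝ} {T : ℝ≥0∞}
  {U : ModeSpace (Fin 2) ≃ₗᵢ[ℂ] ModeSpace (Fin 2)}

theorem hasSum_of_forall_eq {ι α : Type*} [AddCommMonoid α] [TopologicalSpace α] {f f' : ι → α}
    {a : α} (h : HasSum f a) (e : ∀ x, f' x = f x) : HasSum f' a := by
  rwa [funext e]

/-- `g_i ⊗ |j⟩`. -/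
noncomputable def modeVec (g : QubitBasis) (x : Fin 2 × ℕ) : ModeSpace (Fin 2) :=
  ∑ k, lp.single 2 (k, x.2) (basisMatrix g k x.1)

theorem modeVec_apply (x y : Fin 2 × ℕ) :
    modeVec g x y = if y.2 = x.2 then basisMatrix g y.1 x.1 else 0 := by
  obtain ⟨i, a⟩ := x
  obtain ⟨k, b⟩ := y
  simp only [modeVec, lp.coeFn_sum, Finset.sum_apply, lp.single_apply, Pi.single_apply,
    Prod.mk.injEq]
  by_cases h : b = a <;> simp [h]

theorem inner_modeVec (x : Fin 2 × ℕ) (φ : ModeSpace (Fin 2)) :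
    inner ℂ (modeVec g x) φ = ∑ k, conj (basisMatrix g k x.1) * φ (k, x.2) := by
  rw [modeVec, sum_inner]
  refine Finset.sum_congr rfl fun k _ => ?_
  rw [lp.inner_single_left, RCLike.inner_apply, mul_comm]

theorem sum_basisMatrix_mul_inner (φ : ModeSpace (Fin 2)) (k : Fin 2) (a : ℕ) :
    ∑ i, basisMatrix g k i * inner ℂ (modeVec g (i, a)) φ = φ (k, a) := by
  have h := congrArg (fun M => (M.mulVec fun k => φ (k, a)) k) (basisMatrix_mul_star g)
  simp only [Matrix.one_mulVec, ← Matrix.mulVec_mulVec] at h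
  rw [← h]
  simp only [inner_modeVec, Matrix.mulVec, dotProduct, Matrix.conjTranspose_apply, Complex.star_def]

theorem inner_modeVec_modeVec (x y : Fin 2 × ℕ) :
    inner ℂ (modeVec g x) (modeVec g y) = if x = y then (1 : ℂ) else 0 := by
  obtain ⟨i, a⟩ := x
  obtain ⟨k, b⟩ := y
  rw [inner_modeVec]
  simp only [modeVec_apply, Prod.mk.injEq]
  have h := congrFun (congrFun (basisMatrix_star_mul g) i) k
  rw [Matrix.mul_apply, Matrix.one_apply] at h
  simp only [Matrix.conjTranspose_apply, Complex.star_def] at h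
  by_cases hab : a = b
  · simp only [hab, if_true, and_true]
    exact h
  · simp [hab]

theorem orthonormal_modeVec (g : QubitBasis) : Orthonormal ℂ (modeVec g) :=
  orthonormal_iff_ite.mpr inner_modeVec_modeVec

theorem eq_zero_of_inner_modeVec (φ : ModeSpace (Fin 2))
    (h : ∀ x, inner ℂ (modeVec g x) φ = (0 : ℂ)) : φ = 0 := by
  ext ⟨k, a⟩
  rw [← sum_basisMatrix_mul_inner (g := g)]
  simp [h]

/-- The Hilbert basis `g_i ⊗ |j⟩`. -/
noncomputable def modeBasis (g : QubitBasis) : HilbertBasis (Fin 2 × ℕ) ℂ (ModeSpace (Fin 2)) :=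
  HilbertBasis.mkOfOrthogonalEqBot (orthonormal_modeVec g) <| by
    rw [Submodule.eq_bot_iff]
    intro φ hφ
    exact eq_zero_of_inner_modeVec (g := g) φ fun x =>
      (Submodule.mem_orthogonal _ _).mp hφ _ (Submodule.subset_span ⟨x, rfl⟩)

theorem modeBasis_apply (x : Fin 2 × ℕ) : modeBasis g x = modeVec g x := by
  rw [modeBasis, HilbertBasis.coe_mkOfOrthogonalEqBot]

/-- The matrix elements of `U` in the basis `g_i ⊗ |j⟩`. -/
noncomputable def modeElement (g : QubitBasis) (U : ModeSpace (Fin 2) ≃ₗᵢ[ℂ] ModeSpace (Fin 2))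
    (x y : Fin 2 × ℕ) : ℂ :=
  inner ℂ (modeVec g x) (U (modeVec g y))

/-- The total Hamiltonian is diagonal in the Hilbert basis g_i ⊗ |j⟩, so its graph is described
coordinate by coordinate; square summability of χ encodes the domain. -/
theorem inTotalGraph_iff {Δ : ℝ}
    (hH : H = basisMatrix g * Matrix.diagonal (fun j => (E j : ℂ)) * (basisMatrix g).conjTranspose)
    (ψ χ : ModeSpace (Fin 2)) :
    InTotalGraph H Δ ψ χ ↔ ∀ x : Fin 2 × ℕ, inner ℂ (modeVec g x) χ =
      ((E x.1 + x.2 * Δ : ℝ) : ℂ) * inner ℂ (modeVec g x) ψ := by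
  have key (a : ℕ) : (∀ i, χ (i, a) = (∑ k, H i k * ψ (k, a)) + (((a : ℝ) * Δ : ℝ) : ℂ) * ψ (i, a))
      ↔ ∀ i, inner ℂ (modeVec g (i, a)) χ =
        ((E i + a * Δ : ℝ) : ℂ) * inner ℂ (modeVec g (i, a)) ψ := by
    have e1 : (∀ i, χ (i, a) = (∑ k, H i k * ψ (k, a)) +
        (((a : ℝ) * Δ : ℝ) : ℂ) * ψ (i, a)) ↔ (fun i => χ (i, a)) =
        H.mulVec (fun i => ψ (i, a)) + (((a : ℝ) * Δ : ℝ) : ℂ) • fun i => ψ (i, a) := by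
      rw [funext_iff]
      rfl
    have e3 (φ : ModeSpace (Fin 2)) : (fun i => inner ℂ (modeVec g (i, a)) φ) =
        (basisMatrix g).conjTranspose.mulVec fun i => φ (i, a) := by
      ext i
      rw [inner_modeVec]
      rfl
    have e2 : (∀ i, inner ℂ (modeVec g (i, a)) χ =
        ((E i + a * Δ : ℝ) : ℂ) * inner ℂ (modeVec g (i, a)) ψ) ↔
        (basisMatrix g).conjTranspose.mulVec (fun i => χ (i, a)) =
        (Matrix.diagonal fun j => (E j : ℂ)).mulVec
          ((basisMatrix g).conjTranspose.mulVec fun i => ψ (i, a)) +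
        (((a : ℝ) * Δ : ℝ) : ℂ) • (basisMatrix g).conjTranspose.mulVec fun i => ψ (i, a) := by
      rw [← e3, ← e3, funext_iff]
      refine forall_congr' fun i => ?_
      rw [Pi.add_apply, Matrix.mulVec_diagonal, Pi.smul_apply, smul_eq_mul, Complex.ofReal_add,
        add_mul]
    rw [e1, e2]
    constructor
    · intro h
      rw [h, Matrix.mulVec_add, Matrix.mulVec_smul, hH, Matrix.mulVec_mulVec, Matrix.mulVec_mulVec,
        ← Matrix.mul_assoc, ← Matrix.mul_assoc, basisMatrix_star_mul, Matrix.one_mul]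
    · intro h
      have h' := congrArg (basisMatrix g).mulVec h
      rw [Matrix.mulVec_add, Matrix.mulVec_smul, Matrix.mulVec_mulVec, Matrix.mulVec_mulVec,
        Matrix.mulVec_mulVec, Matrix.mulVec_mulVec, basisMatrix_mul_star, Matrix.one_mulVec,
        Matrix.one_mulVec, ← hH] at h'
      exact h'
  constructor
  · rintro h ⟨i, a⟩
    exact (key a).mp (fun i => h i a) i
  · intro h i a
    exact (key a).mpr (fun i => h (i, a)) i

theorem apply_modeVec (U : ModeSpace (Fin 2) ≃ₗᵢ[ℂ] ModeSpace (Fin 2)) (k i : Fin 2) (a j : ℕ) :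
    U (modeVec g (k, j)) (i, a) = ∑ l, modeBlock U a j i l * basisMatrix g l k := by
  have h (l : Fin 2) : lp.single 2 (l, j) (basisMatrix g l k) =
      basisMatrix g l k • (lp.single 2 (l, j) (1 : ℂ) : ModeSpace (Fin 2)) := by
    rw [← lp.single_smul]
    simp
  simp only [modeVec, h, map_sum, map_smul, lp.coeFn_sum, Finset.sum_apply, lp.coeFn_smul,
    Pi.smul_apply, smul_eq_mul, modeBlock, Matrix.of_apply]
  exact Finset.sum_congr rfl fun l _ => mul_comm _ _

theorem matrixElement_modeBlock (U : ModeSpace (Fin 2) ≃ₗᵢ[ℂ] ModeSpace (Fin 2)) (a j : ℕ)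
    (i k : Fin 2) : matrixElement g (modeBlock U a j) i k = modeElement g U (i, a) (k, j) := by
  rw [modeElement, inner_modeVec, matrixElement_eq, Matrix.mul_assoc, Matrix.mul_apply]
  refine Finset.sum_congr rfl fun l _ => ?_
  rw [apply_modeVec, Matrix.conjTranspose_apply, Matrix.mul_apply, Complex.star_def]

theorem hasSum_norm_sq_modeElement (U : ModeSpace (Fin 2) ≃ₗᵢ[ℂ] ModeSpace (Fin 2))
    (y : Fin 2 × ℕ) : HasSum (fun x => ‖modeElement g U x y‖ ^ 2) 1 := by
  have h := (modeBasis g).hasSum_inner_mul_inner (U (modeVec g y)) (U (modeVec g y))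
  rw [LinearIsometryEquiv.inner_map_map, inner_modeVec_modeVec, if_pos rfl] at h
  have h' := Complex.hasSum_re h
  rw [Complex.one_re] at h'
  refine hasSum_of_forall_eq h' fun x => ?_
  rw [modeBasis_apply, ← inner_conj_symm, mul_comm, Complex.mul_conj, Complex.ofReal_re,
    Complex.normSq_eq_norm_sq]
  rfl

theorem norm_modeElement_le_one (U : ModeSpace (Fin 2) ≃ₗᵢ[ℂ] ModeSpace (Fin 2))
    (x y : Fin 2 × ℕ) : ‖modeElement g U x y‖ ≤ 1 := by
  have := le_hasSum (hasSum_norm_sq_modeElement (g := g) U y) x fun z _ => sq_nonneg _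
  nlinarith [norm_nonneg (modeElement g U x y)]

/-- Energy conservation sends an eigenvector to an eigenvector with the same energy, and
eigenvectors with different energies are orthogonal. -/
theorem modeElement_eq_zero {Δ : ℝ}
    (hH : H = basisMatrix g * Matrix.diagonal (fun j => (E j : ℂ)) * (basisMatrix g).conjTranspose)
    (hU : ModeEnergyConserving H Δ U) {x y : Fin 2 × ℕ}
    (hxy : E x.1 + x.2 * Δ ≠ E y.1 + y.2 * Δ) : modeElement g U x y = 0 := by
  have h1 : InTotalGraph H Δ (modeVec g y) (((E y.1 + y.2 * Δ : ℝ) : ℂ) • modeVec g y) := by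
    rw [inTotalGraph_iff hH]
    intro z
    rw [inner_smul_right, inner_modeVec_modeVec]
    by_cases h : z = y
    · subst h; rfl
    · simp [h]
  have h2 := (inTotalGraph_iff hH _ _).mp ((hU _ _).mp h1) x
  rw [map_smul, inner_smul_right] at h2
  have h3 : (((E x.1 + x.2 * Δ : ℝ) : ℂ) - ((E y.1 + y.2 * Δ : ℝ) : ℂ)) *
      modeElement g U x y = 0 := by
    rw [modeElement]
    linear_combination -h2
  refine (mul_eq_zero.mp h3).resolve_left (sub_ne_zero.mpr ?_)
  exact_mod_cast hxy

theorem IsModeDilation.hasSum_matrixElement {p : ℕ → ℝ} {S : Superop (Fin 2)}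
    (h : IsModeDilation U p S) (i j k l : Fin 2) :
    HasSum (fun x : ℕ × ℕ => (p x.2 : ℂ) * (modeElement g U (i, x.1) (j, x.2) *
      conj (modeElement g U (l, x.1) (k, x.2)))) (matrixElement g (S (ketBra g j k)) i l) := by
  have h1 := (h (ketBra g j k)).map (matrixElementₗ g i l) (continuous_matrixElement g i l)
  refine hasSum_of_forall_eq h1 fun x => ?_
  change _ = matrixElement g _ i l
  rw [matrixElement_smul, matrixElement_mul]
  congr 1
  simp only [matrixElement_mul, matrixElement_ketBra, matrixElement_conjTranspose,
    matrixElement_modeBlock]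
  fin_cases j <;> fin_cases k <;> simp

theorem modeGibbs_eq {Δ : ℝ} (h : Real.exp (-(invTemp T * Δ)) < 1) (j : ℕ) :
    modeGibbs Δ T j = (1 - Real.exp (-(invTemp T * Δ))) * Real.exp (-(invTemp T * Δ)) ^ j := by
  have h' (j : ℕ) : Real.exp (-(invTemp T * (j * Δ))) = Real.exp (-(invTemp T * Δ)) ^ j := by
    rw [← Real.exp_nat_mul]
    congr 1
    ring
  simp only [modeGibbs, h']
  rw [tsum_geometric_of_lt_one (Real.exp_pos _).le h, div_inv_eq_mul, mul_comm]

theorem invTemp_pos (hT : 0 < T) (hT' : T < ⊤) : 0 < invTemp T :=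
  ENNReal.toReal_pos (ENNReal.inv_ne_zero.mpr hT'.ne) (ENNReal.inv_ne_top.mpr hT.ne') |> id

theorem IsOrderedEigenbasis.boltzmannFactor_lt_one (hg : IsOrderedEigenbasis H g) (hT : 0 < T)
    (hT' : T < ⊤) : boltzmannFactor H T < 1 := by
  rw [boltzmannFactor, Real.exp_lt_one_iff]
  linarith [mul_pos (invTemp_pos hT hT') hg.energyGap_pos]

/-- For a bosonic bath at finite temperature, `λ` and `|c|` cannot both be small. -/
theorem one_sub_two_mul_le_of_mem_bosonicTO (hg : IsOrderedEigenbasis H g) (hT : 0 < T)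
    (hT' : T < ⊤) {S : Superop (Fin 2)} (hS : S ∈ bosonicTO H T) :
    1 - 2 * boltzmannFactor H T ≤ ‖(Psi g S).2‖ + (Psi g S).1 := by
  obtain ⟨U, hU, ⟨-, hS⟩ | ⟨h, -⟩⟩ := hS
  swap
  · exact absurd h hT'.ne
  obtain ⟨E, hE, hgap, hH⟩ := hg.exists_eq
  have hΔ := hg.energyGap_pos
  have hq := boltzmannFactor_pos H T
  have hq1 := hg.boltzmannFactor_lt_one hT hT'
  have hp (j : ℕ) : modeGibbs (energyGap H) T j =
      (1 - boltzmannFactor H T) * boltzmannFactor H T ^ j := modeGibbs_eq hq1 j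
  -- The total number of excitations, i + a, is conserved.
  have hzero {i k : Fin 2} {a b : ℕ} (h : ((i : ℕ) + a : ℕ) ≠ (k : ℕ) + b) :
      modeElement g U (i, a) (k, b) = 0 := by
    refine modeElement_eq_zero hH hU ?_
    have hEi (i : Fin 2) : E i = E 0 + (i : ℕ) * energyGap H := by
      rw [hgap]
      fin_cases i <;> simp
    simp only
    rw [hEi i, hEi k]
    intro he
    have : (((i : ℕ) + a : ℕ) : ℝ) * energyGap H = (((k : ℕ) + b : ℕ) : ℝ) * energyGap H := by
      push_cast
      linarith
    exact h (by exact_mod_cast mul_right_cancel₀ hΔ.ne' this)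
  have hfin : ∀ k : Fin 2, k = 0 ∨ k = 1 := by decide
  -- The lowest total energy is non-degenerate, so `U` acts on it by a phase.
  have h00 : ‖modeElement g U (0, 0) (0, 0)‖ ^ 2 = 1 := by
    refine (hasSum_single (f := fun x => ‖modeElement g U x (0, 0)‖ ^ 2) (0, 0) ?_).unique
      (hasSum_norm_sq_modeElement U _)
    rintro ⟨i, a⟩ hne
    rw [hzero, norm_zero, sq, zero_mul]
    intro h
    apply hne
    rcases hfin i with rfl | rfl
    · simp at h
      simp [h]
    · simp at h
  -- The next level is spanned by (1, 0) and (0, 1).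
  have h10 : ‖modeElement g U (1, 0) (1, 0)‖ ^ 2 + ‖modeElement g U (0, 1) (1, 0)‖ ^ 2 = 1 := by
    have := (hasSum_sum_of_ne_finset_zero (f := fun x => ‖modeElement g U x (1, 0)‖ ^ 2)
      (s := {(1, 0), (0, 1)}) ?_).unique (hasSum_norm_sq_modeElement U _)
    · rwa [Finset.sum_pair (by simp)] at this
    · rintro ⟨i, a⟩ hne
      rw [hzero, norm_zero, sq, zero_mul]
      intro h
      apply hne
      rcases hfin i with rfl | rfl
      · simp at h
        simp [h]
      · simp at h
        simp [h]
  have hl : (1 - boltzmannFactor H T) * ‖modeElement g U (0, 1) (1, 0)‖ ^ 2 ≤ (Psi g S).1 := by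
    have h := Complex.hasSum_re (hS.hasSum_matrixElement (g := g) 0 1 1 0)
    have e (x : ℕ × ℕ) : ((modeGibbs (energyGap H) T x.2 : ℂ) * (modeElement g U (0, x.1) (1, x.2) *
        conj (modeElement g U (0, x.1) (1, x.2)))).re =
        modeGibbs (energyGap H) T x.2 * ‖modeElement g U (0, x.1) (1, x.2)‖ ^ 2 := by
      rw [Complex.mul_conj, ← Complex.ofReal_mul, Complex.ofReal_re, Complex.normSq_eq_norm_sq]
    simp only [e] at h
    simp only [hp] at h
    have := le_hasSum h (1, 0) fun x _ => mul_nonneg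
      (mul_nonneg (by linarith) (pow_pos hq _).le) (sq_nonneg _)
    rw [pow_zero, mul_one] at this
    exact this
  -- The term j = 0 of c is compared with all others, whose weights add up to q.
  have hc : (1 - boltzmannFactor H T) * ‖modeElement g U (1, 0) (1, 0)‖ -
      boltzmannFactor H T ≤ ‖(Psi g S).2‖ := by
    have h := hS.hasSum_matrixElement (g := g) 0 0 1 1
    have hinj : Function.Injective fun j : ℕ => (j, j) := fun a b hab => (Prod.mk.inj hab).1
    rw [← hinj.hasSum_iff] at h
    swap
    · rintro ⟨a, b⟩ hab
      have : a ≠ b := fun h => hab ⟨a, by simp [h]⟩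
      rw [hzero (i := 0) (k := 0) (by simpa using this)]
      simp
    rw [← hasSum_nat_add_iff' 1] at h
    have hgeo : HasSum (fun j => (1 - boltzmannFactor H T) * boltzmannFactor H T ^ (j + 1))
        (boltzmannFactor H T) := by
      have := (hasSum_geometric_of_lt_one hq.le hq1).mul_left
        ((1 - boltzmannFactor H T) * boltzmannFactor H T)
      have hne : 1 - boltzmannFactor H T ≠ 0 := by linarith
      rw [show (1 - boltzmannFactor H T) * boltzmannFactor H T * (1 - boltzmannFactor H T)⁻¹ =
        boltzmannFactor H T by field_simp] at this
      exact hasSum_of_forall_eq this fun j => by ring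
    have hb := tsum_of_norm_bounded hgeo (f := _) fun j => by
      change ‖(((fun x : ℕ × ℕ => (modeGibbs (energyGap H) T x.2 : ℂ) *
        (modeElement g U (0, x.1) (0, x.2) * conj (modeElement g U (1, x.1) (1, x.2)))) ∘
        fun j => (j, j)) (j + 1))‖ ≤ _
      simp only [Function.comp_apply, norm_mul, Complex.norm_real, RCLike.norm_conj]
      rw [hp, Real.norm_of_nonneg (mul_nonneg (by linarith) (pow_pos hq _).le)]
      refine mul_le_of_le_one_right (mul_nonneg (by linarith) (pow_pos hq _).le) ?_
      exact mul_le_one₀ (norm_modeElement_le_one _ _ _) (norm_nonneg _)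
        (norm_modeElement_le_one _ _ _)
    rw [h.tsum_eq] at hb
    have h00' : ‖modeElement g U (0, 0) (0, 0)‖ = 1 := by
      nlinarith [norm_nonneg (modeElement g U (0, 0) (0, 0))]
    have hfirst : ‖(modeGibbs (energyGap H) T 0 : ℂ) * (modeElement g U (0, 0) (0, 0) *
        conj (modeElement g U (1, 0) (1, 0)))‖ =
        (1 - boltzmannFactor H T) * ‖modeElement g U (1, 0) (1, 0)‖ := by
      rw [norm_mul, norm_mul, h00', RCLike.norm_conj, one_mul, Complex.norm_real, hp, pow_zero,
        mul_one, Real.norm_of_nonneg (by linarith)]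
    rw [← hfirst]
    have := norm_sub_norm_le ((modeGibbs (energyGap H) T 0 : ℂ) * (modeElement g U (0, 0) (0, 0) *
        conj (modeElement g U (1, 0) (1, 0)))) (Psi g S).2
    rw [norm_sub_rev] at this
    simp only [Finset.sum_range_one, Function.comp_apply] at hb
    change ‖(Psi g S).2 - _‖ ≤ _ at hb
    linarith
  have hle := norm_modeElement_le_one (g := g) U (1, 0) (1, 0)
  -- With x the modulus of the (1, 0) diagonal entry, the sum is at least (1-q)(1 + x - x²) - q, and
  -- x - x² ≥ 0.
  nlinarith [norm_nonneg (modeElement g U (1, 0) (1, 0)),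
    mul_nonneg (sub_nonneg.mpr hq1.le) (mul_nonneg
      (norm_nonneg (modeElement g U (1, 0) (1, 0))) (sub_nonneg.mpr hle))]

end Mode

end ThermalOps

namespace ThermalOps

/-! ### The ladder unitary on the full mode -/

section Ladder

/-- Moduli and phases of an energy-conserving unitary on system and bosonic mode. -/
structure IsLadder (σ : ℕ → ℝ) (z : ℕ → ℂ) : Prop where
  nonneg : ∀ j, 0 ≤ σ j
  le_one : ∀ j, σ j ≤ 1
  zero : σ 0 = 1
  norm : ∀ j, ‖z j‖ = 1

variable {H : Matrix (Fin 2) (Fin 2) ℂ} {g : QubitBasis} {E : Fin 2 → ℝ} {T : ℝ≥0∞}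
  {σ : ℕ → ℝ} {z : ℕ → ℂ}

/-- The columns of the energy-conserving unitary on system and bosonic mode. -/
noncomputable def ladderVec (g : QubitBasis) (σ : ℕ → ℝ) (z : ℕ → ℂ) :
    Fin 2 × ℕ → ModeSpace (Fin 2)
  | (0, 0) => z 0 • modeVec g (0, 0)
  | (0, b + 1) => ((σ (b + 1) : ℂ) * z (b + 1)) • modeVec g (0, b + 1) -
      (((Real.sqrt (1 - σ (b + 1) ^ 2) : ℝ) : ℂ) * z (b + 1)) • modeVec g (1, b)
  | (1, b) => (σ (b + 1) : ℂ) • modeVec g (1, b) +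
      ((Real.sqrt (1 - σ (b + 1) ^ 2) : ℝ) : ℂ) • modeVec g (0, b + 1)

theorem forall_ladder {P : Fin 2 × ℕ → Prop} (h0 : P (0, 0)) (h1 : ∀ b, P (0, b + 1))
    (h2 : ∀ b, P (1, b)) : ∀ x, P x
  | (0, 0) => h0
  | (0, b + 1) => h1 b
  | (1, b) => h2 b

theorem inner_modeVec_ladderVec (h : IsLadder σ z) (x y : Fin 2 × ℕ) :
    inner ℂ (modeVec g x) (ladderVec g σ z y) = hopping σ z x.1 y.1 x.2 y.2 := by
  obtain ⟨i, a⟩ := x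
  have hfin : ∀ k : Fin 2, k = 0 ∨ k = 1 := by decide
  revert y
  refine forall_ladder ?_ (fun b => ?_) (fun b => ?_) <;> rcases hfin i with rfl | rfl <;>
    simp [ladderVec, inner_smul_right, inner_sub_right, inner_add_right, inner_modeVec_modeVec,
      hopping, h.zero]
  split_ifs <;> simp

theorem orthonormal_ladderVec (h : IsLadder σ z) : Orthonormal ℂ (ladderVec g σ z) := by
  have hs (j : ℕ) := sqrt_one_sub_sq (h.nonneg j) (h.le_one j)
  have hzz (j : ℕ) := conj_mul_self_of_norm (h.norm j)
  rw [orthonormal_iff_ite]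
  refine forall_ladder ?_ (fun b => ?_) (fun b => ?_) <;>
    refine forall_ladder ?_ (fun b' => ?_) (fun b' => ?_) <;>
    simp [ladderVec, inner_smul_right, inner_sub_right, inner_add_right, inner_smul_left,
      inner_sub_left, inner_add_left, inner_modeVec_modeVec]
  · left
    rw [norm_smul, h.norm, (orthonormal_modeVec g).1, one_mul]
  · split_ifs with hb
    · subst hb
      linear_combination ((σ (b + 1) : ℂ) * σ (b + 1) + ((Real.sqrt (1 - σ (b + 1) ^ 2) : ℝ) : ℂ) *
        ((Real.sqrt (1 - σ (b + 1) ^ 2) : ℝ) : ℂ)) * hzz (b + 1) + hs (b + 1)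
    · simp
  · split_ifs with hb
    · subst hb
      ring
    · simp
  · split_ifs with hb
    · subst hb
      ring
    · simp
  · split_ifs with hb
    · subst hb
      linear_combination hs (b + 1)
    · simp

/-- This and the next two identities invert the 2 × 2 rotations. They show that a vector orthogonal
to all columns is zero, so the columns form a Hilbert basis. -/
theorem modeVec_zero_eq (h : IsLadder σ z) :
    modeVec g (0, 0) = conj (z 0) • ladderVec g σ z (0, 0) := by
  rw [ladderVec, smul_smul, conj_mul_self_of_norm (h.norm 0), one_smul]

theorem modeVec_succ_eq (h : IsLadder σ z) (b : ℕ) :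
    modeVec g (0, b + 1) = ((σ (b + 1) : ℂ) * conj (z (b + 1))) • ladderVec g σ z (0, b + 1) +
      ((Real.sqrt (1 - σ (b + 1) ^ 2) : ℝ) : ℂ) • ladderVec g σ z (1, b) := by
  have hs := sqrt_one_sub_sq (h.nonneg (b + 1)) (h.le_one (b + 1))
  have hzz := conj_mul_self_of_norm (h.norm (b + 1))
  simp only [ladderVec]
  match_scalars
  · linear_combination (-((σ (b + 1) : ℂ) * σ (b + 1))) * hzz - hs
  · linear_combination ((σ (b + 1) : ℂ) * ((Real.sqrt (1 - σ (b + 1) ^ 2) : ℝ) : ℂ)) * hzz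

theorem modeVec_one_eq (h : IsLadder σ z) (b : ℕ) :
    modeVec g (1, b) = (-(((Real.sqrt (1 - σ (b + 1) ^ 2) : ℝ) : ℂ) * conj (z (b + 1)))) •
      ladderVec g σ z (0, b + 1) + (σ (b + 1) : ℂ) • ladderVec g σ z (1, b) := by
  have hs := sqrt_one_sub_sq (h.nonneg (b + 1)) (h.le_one (b + 1))
  have hzz := conj_mul_self_of_norm (h.norm (b + 1))
  simp only [ladderVec]
  match_scalars
  · linear_combination (-(((Real.sqrt (1 - σ (b + 1) ^ 2) : ℝ) : ℂ) *
      ((Real.sqrt (1 - σ (b + 1) ^ 2) : ℝ) : ℂ))) * hzz - hs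
  · linear_combination (((Real.sqrt (1 - σ (b + 1) ^ 2) : ℝ) : ℂ) * (σ (b + 1) : ℂ)) * hzz

/-- The Hilbert basis of the columns. -/
noncomputable def ladderBasis (g : QubitBasis) (h : IsLadder σ z) :
    HilbertBasis (Fin 2 × ℕ) ℂ (ModeSpace (Fin 2)) :=
  HilbertBasis.mkOfOrthogonalEqBot (orthonormal_ladderVec (g := g) h) <| by
    rw [Submodule.eq_bot_iff]
    intro φ hφ
    have hw (x : Fin 2 × ℕ) : inner ℂ (ladderVec g σ z x) φ = (0 : ℂ) :=
      (Submodule.mem_orthogonal _ _).mp hφ _ (Submodule.subset_span ⟨x, rfl⟩)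
    refine eq_zero_of_inner_modeVec (g := g) φ (forall_ladder ?_ (fun b => ?_) fun b => ?_)
    · rw [modeVec_zero_eq h, inner_smul_left, hw, mul_zero]
    · rw [modeVec_succ_eq h, inner_add_left, inner_smul_left, inner_smul_left, hw, hw, mul_zero,
        mul_zero, add_zero]
    · rw [modeVec_one_eq h, inner_add_left, inner_smul_left, inner_smul_left, hw, hw, mul_zero,
        mul_zero, add_zero]

/-- The energy-conserving unitary on system and bosonic mode with columns `ladderVec`. -/
noncomputable def ladderUnitary (g : QubitBasis) (h : IsLadder σ z) :
    ModeSpace (Fin 2) ≃ₗᵢ[ℂ] ModeSpace (Fin 2) :=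
  (modeBasis g).repr.trans (ladderBasis g h).repr.symm

theorem ladderUnitary_modeVec (h : IsLadder σ z) (x : Fin 2 × ℕ) :
    ladderUnitary g h (modeVec g x) = ladderVec g σ z x := by
  rw [ladderUnitary, LinearIsometryEquiv.trans_apply, ← modeBasis_apply, HilbertBasis.repr_self,
    HilbertBasis.repr_symm_single, ladderBasis, HilbertBasis.coe_mkOfOrthogonalEqBot]

theorem modeElement_ladderUnitary (h : IsLadder σ z) (x y : Fin 2 × ℕ) :
    modeElement g (ladderUnitary g h) x y = hopping σ z x.1 y.1 x.2 y.2 := by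
  rw [modeElement, ladderUnitary_modeVec, inner_modeVec_ladderVec h]

theorem inner_add_smul_eq {F : Type*} [NormedAddCommGroup F] [InnerProductSpace ℂ F] {u v ψ χ : F}
    {e : ℂ} (hu : inner ℂ u χ = e * inner ℂ u ψ) (hv : inner ℂ v χ = e * inner ℂ v ψ) (a b : ℂ) :
    inner ℂ (a • u + b • v) χ = e * inner ℂ (a • u + b • v) ψ := by
  simp only [inner_add_left, inner_smul_left, hu, hv]
  ring

/-- Each ladder column combines basis vectors of equal total energy only (`he`), and conversely.
Hence the coordinate description of the graph is the same in both Hilbert bases. -/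
theorem ladderVec_eigen_iff (h : IsLadder σ z) (ψ χ : ModeSpace (Fin 2)) :
    (∀ x : Fin 2 × ℕ, inner ℂ (ladderVec g σ z x) χ =
      ((E x.1 + x.2 * (E 1 - E 0) : ℝ) : ℂ) * inner ℂ (ladderVec g σ z x) ψ) ↔
    ∀ x : Fin 2 × ℕ, inner ℂ (modeVec g x) χ =
      ((E x.1 + x.2 * (E 1 - E 0) : ℝ) : ℂ) * inner ℂ (modeVec g x) ψ := by
  have he (b : ℕ) : E 0 + ((b + 1 : ℕ) : ℝ) * (E 1 - E 0) = E 1 + (b : ℝ) * (E 1 - E 0) := by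
    push_cast
    ring
  constructor
  · intro H
    refine forall_ladder ?_ (fun b => ?_) fun b => ?_
    · rw [modeVec_zero_eq h, inner_smul_left, inner_smul_left, H]
      ring
    · rw [modeVec_succ_eq h]
      refine inner_add_smul_eq (H _) ?_ _ _
      rw [H]
      simp only [he]
    · rw [modeVec_one_eq h]
      refine inner_add_smul_eq ?_ (H _) _ _
      rw [H]
      simp only [he]
  · intro H
    refine forall_ladder ?_ (fun b => ?_) fun b => ?_
    · rw [ladderVec, inner_smul_left, inner_smul_left, H]
      ring
    · rw [ladderVec, sub_eq_add_neg, ← neg_smul]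
      refine inner_add_smul_eq (H _) ?_ _ _
      rw [H]
      simp only [he]
    · rw [ladderVec]
      refine inner_add_smul_eq (H _) ?_ _ _
      rw [H]
      simp only [he]

theorem modeEnergyConserving_ladderUnitary (h : IsLadder σ z)
    (hH : H = basisMatrix g * Matrix.diagonal (fun j => (E j : ℂ)) *
      (basisMatrix g).conjTranspose) :
    ModeEnergyConserving H (E 1 - E 0) (ladderUnitary g h) := by
  intro ψ χ
  rw [inTotalGraph_iff hH, inTotalGraph_iff hH,
    ← ladderVec_eigen_iff h (ladderUnitary g h ψ)]
  simp only [← ladderUnitary_modeVec h, LinearIsometryEquiv.inner_map_map]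

theorem isModeDilation_of_matrixElement {U : ModeSpace (Fin 2) ≃ₗᵢ[ℂ] ModeSpace (Fin 2)}
    {p : ℕ → ℝ} {S : Superop (Fin 2)}
    (h : ∀ i j k l, HasSum (fun x : ℕ × ℕ => (p x.2 : ℂ) * (modeElement g U (i, x.1) (j, x.2) *
      conj (modeElement g U (l, x.1) (k, x.2)))) (matrixElement g (S (ketBra g j k)) i l)) :
    IsModeDilation U p S := by
  have hk (j k : Fin 2) : HasSum (fun x : ℕ × ℕ => ((p x.2 : ℝ) : ℂ) •
      (modeBlock U x.1 x.2 * ketBra g j k * (modeBlock U x.1 x.2).conjTranspose))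
      (S (ketBra g j k)) := by
    rw [sum_ketBra g (S (ketBra g j k))]
    have := hasSum_sum (s := Finset.univ) fun i _ => hasSum_sum (s := Finset.univ)
      fun l _ => (h i j k l).smul_const (ketBra g i l)
    refine hasSum_of_forall_eq this fun x => ?_
    conv_lhs => rw [sum_ketBra g (_ • _)]
    refine Finset.sum_congr rfl fun i _ => Finset.sum_congr rfl fun l _ => ?_
    congr 1
    rw [matrixElement_smul, matrixElement_mul]
    congr 1
    simp only [matrixElement_mul, matrixElement_ketBra, matrixElement_conjTranspose,
      matrixElement_modeBlock]
    fin_cases j <;> fin_cases k <;> simp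
  intro ρ
  rw [sum_ketBra g ρ]
  simp only [map_sum, map_smul]
  have := hasSum_sum (s := Finset.univ) fun j _ => hasSum_sum (s := Finset.univ)
    fun k _ => (hk j k).const_smul (matrixElement g ρ j k)
  refine hasSum_of_forall_eq this fun x => ?_
  simp only [Matrix.mul_sum, Matrix.sum_mul, Finset.smul_sum, Matrix.mul_smul, Matrix.smul_mul]
  refine Finset.sum_congr rfl fun i _ => Finset.sum_congr rfl fun l _ => ?_
  rw [smul_comm]

/-- The weights p need not be Gibbsian, so the upward probability y is independent of x. The uniform
states used at T = ∞ require this generality. -/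
theorem isModeDilation_ladderUnitary (h : IsLadder σ z) {p : ℕ → ℝ} {x y : ℝ} {c : ℂ}
    (hp : HasSum p 1) (hx : HasSum (fun j => p j * (1 - σ (j + 1) ^ 2)) x)
    (hy : HasSum (fun j => p j * (1 - σ j ^ 2)) y)
    (sc : HasSum (fun j => ((p j * (σ j * σ (j + 1)) : ℝ) : ℂ) * z j) c) :
    IsModeDilation (ladderUnitary g h) p (covMap g x y c) := by
  have hs (j : ℕ) := sqrt_one_sub_sq (h.nonneg j) (h.le_one j)
  have hzz (j : ℕ) := conj_mul_self_of_norm (h.norm j)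
  have hd : Function.Injective fun j : ℕ => (j, j) := fun a b hab => (Prod.mk.inj hab).1
  have hu : Function.Injective fun j : ℕ => (j + 1, j) := fun a b hab => (Prod.mk.inj hab).2
  have hl : Function.Injective fun j : ℕ => (j, j + 1) := fun a b hab => (Prod.mk.inj hab).1
  have h00 (a b : ℕ) : hopping σ z 0 0 a b = if a = b then (σ b : ℂ) * z b else 0 := rfl
  have h01 (a b : ℕ) : hopping σ z 0 1 a b =
    if a = b + 1 then ((Real.sqrt (1 - σ (b + 1) ^ 2) : ℝ) : ℂ) else 0 := rfl
  have h10 (a b : ℕ) : hopping σ z 1 0 a b =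
    if a + 1 = b then -((Real.sqrt (1 - σ b ^ 2) : ℝ) : ℂ) * z b else 0 := rfl
  have h11 (a b : ℕ) : hopping σ z 1 1 a b = if a = b then (σ (b + 1) : ℂ) else 0 := rfl
  have sx : HasSum (fun j => ((p j * (1 - σ (j + 1) ^ 2) : ℝ) : ℂ)) (x : ℂ) :=
    Complex.hasSum_ofReal.mpr hx
  -- The level j = 0 cannot give energy to the system: σ 0 = 1 removes its term and the index shifts
  -- by one.
  have sy : HasSum (fun j => ((p (j + 1) * (1 - σ (j + 1) ^ 2) : ℝ) : ℂ)) (y : ℂ) := by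
    refine Complex.hasSum_ofReal.mpr ?_
    have := (hasSum_nat_add_iff' 1).mpr hy
    simpa [h.zero] using this
  have sx' : HasSum (fun j => ((p j * σ (j + 1) ^ 2 : ℝ) : ℂ)) (1 - x : ℂ) := by
    rw [← Complex.ofReal_one, ← Complex.ofReal_sub]
    exact Complex.hasSum_ofReal.mpr (hasSum_of_forall_eq (hp.sub hx) fun j => by ring)
  have sy' : HasSum (fun j => ((p j * σ j ^ 2 : ℝ) : ℂ)) (1 - y : ℂ) := by
    rw [← Complex.ofReal_one, ← Complex.ofReal_sub]
    exact Complex.hasSum_ofReal.mpr (hasSum_of_forall_eq (hp.sub hy) fun j => by ring)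
  have sc' : HasSum (fun j => ((p j * (σ j * σ (j + 1)) : ℝ) : ℂ) * conj (z j)) (conj c) := by
    refine hasSum_of_forall_eq (Complex.hasSum_conj.mpr (by simpa using sc)) fun j => ?_
    simp
  refine isModeDilation_of_matrixElement (g := g) fun i j k l => ?_
  simp only [modeElement_ladderUnitary]
  have hfin : ∀ k : Fin 2, k = 0 ∨ k = 1 := by decide
  have hzero {f : ℕ × ℕ → ℂ} {a : ℂ} (hf : ∀ x, f x = 0) (ha : a = 0) : HasSum f a := by
    rw [ha, funext hf]
    exact hasSum_zero
  have hD {f : ℕ × ℕ → ℂ} {F : ℕ → ℂ} {s s' : ℂ} (hF : HasSum F s) (hs : s' = s)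
      (e : ∀ j, f (j, j) = F j) (e0 : ∀ a b, a ≠ b → f (a, b) = 0) : HasSum f s' := by
    rw [← hd.hasSum_iff, hs]
    · exact hasSum_of_forall_eq hF e
    · rintro ⟨a, b⟩ hab
      exact e0 a b fun h => hab ⟨a, by simp [h]⟩
  have hU {f : ℕ × ℕ → ℂ} {F : ℕ → ℂ} {s s' : ℂ} (hF : HasSum F s) (hs : s' = s)
      (e : ∀ j, f (j + 1, j) = F j) (e0 : ∀ a b, a ≠ b + 1 → f (a, b) = 0) : HasSum f s' := by
    rw [← hu.hasSum_iff, hs]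
    · exact hasSum_of_forall_eq hF e
    · rintro ⟨a, b⟩ hab
      exact e0 a b fun h => hab ⟨b, by simp [h]⟩
  have hL {f : ℕ × ℕ → ℂ} {F : ℕ → ℂ} {s s' : ℂ} (hF : HasSum F s) (hs : s' = s)
      (e : ∀ j, f (j, j + 1) = F j) (e0 : ∀ a b, a + 1 ≠ b → f (a, b) = 0) : HasSum f s' := by
    rw [← hl.hasSum_iff, hs]
    · exact hasSum_of_forall_eq hF e
    · rintro ⟨a, b⟩ hab
      exact e0 a b fun h => hab ⟨a, by simp [h]⟩
  rcases hfin i with rfl | rfl <;> rcases hfin j with rfl | rfl <;>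
    rcases hfin k with rfl | rfl <;> rcases hfin l with rfl | rfl <;>
    simp only [h00, h01, h10, h11, matrixElement_covMap, matrixElement_ketBra]
  · refine hD sy' (by simp) (fun j => ?_) fun a b hab => ?_
    · simp
      left
      linear_combination ((σ j : ℂ) * σ j) * hzz j
    · simp [hab]
  · exact hzero (fun x => by split_ifs <;> first | omega | simp) (by simp)
  · exact hzero (fun x => by split_ifs <;> first | omega | simp) (by simp)
  · refine hD sc (by simp) (fun j => ?_) fun a b hab => ?_
    · simp
      ring
    · simp [hab]
  · exact hzero (fun x => by split_ifs <;> first | omega | simp) (by simp)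
  · exact hzero (fun x => by split_ifs <;> first | omega | simp) (by simp)
  · refine hU sx (by simp) (fun j => ?_) fun a b hab => ?_
    · simp
      left
      linear_combination hs (j + 1)
    · simp [hab]
  · exact hzero (fun x => by split_ifs <;> first | omega | simp) (by simp)
  · exact hzero (fun x => by split_ifs <;> first | omega | simp) (by simp)
  · refine hL sy (by simp) (fun j => ?_) fun a b hab => ?_
    · simp
      left
      linear_combination (((Real.sqrt (1 - σ (j + 1) ^ 2) : ℝ) : ℂ) *
        ((Real.sqrt (1 - σ (j + 1) ^ 2) : ℝ) : ℂ)) * hzz (j + 1) + hs (j + 1)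
    · simp [hab]
  · exact hzero (fun x => by split_ifs <;> first | omega | simp) (by simp)
  · exact hzero (fun x => by split_ifs <;> first | omega | simp) (by simp)
  · refine hD sc' (by simp) (fun j => ?_) fun a b hab => ?_
    · simp
      ring
    · simp [hab]
  · exact hzero (fun x => by split_ifs <;> first | omega | simp) (by simp)
  · exact hzero (fun x => by split_ifs <;> first | omega | simp) (by simp)
  · refine hD sx' (by simp) (fun j => ?_) fun a b hab => ?_
    · simp
      left
      ring
    · simp [hab]

end Ladder

end ThermalOps

namespace ThermalOps

/-! ### Realizing maps with the bosonic mode -/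

section Bosonic

variable {H : Matrix (Fin 2) (Fin 2) ℂ} {g : QubitBasis} {T : ℝ≥0∞} {σ : ℕ → ℝ} {z : ℕ → ℂ}

theorem mem_bosonicTO_of_lt_top (hg : IsOrderedEigenbasis H g) (hT : 0 < T) (hT' : T < ⊤)
    (h : IsLadder σ z) {l : ℝ} {c : ℂ}
    (hl : HasSum (fun j => (1 - boltzmannFactor H T) * boltzmannFactor H T ^ j *
      (1 - σ (j + 1) ^ 2)) l)
    (hc : HasSum (fun j => (((1 - boltzmannFactor H T) * boltzmannFactor H T ^ j *
      (σ j * σ (j + 1)) : ℝ) : ℂ) * z j) c) :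
    canonicalMap g (boltzmannFactor H T) l c ∈ bosonicTO H T := by
  obtain ⟨E, hE, hgap, hH⟩ := hg.exists_eq
  have hq := boltzmannFactor_pos H T
  have hq1 := hg.boltzmannFactor_lt_one hT hT'
  refine ⟨ladderUnitary g h, hgap ▸ modeEnergyConserving_ladderUnitary h hH, Or.inl ⟨hT', ?_⟩⟩
  have hp : modeGibbs (energyGap H) T = fun j =>
      (1 - boltzmannFactor H T) * boltzmannFactor H T ^ j := funext fun j => modeGibbs_eq hq1 j
  rw [hp]
  refine isModeDilation_ladderUnitary h ?_ hl ?_ hc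
  · have := (hasSum_geometric_of_lt_one hq.le hq1).mul_left (1 - boltzmannFactor H T)
    rwa [mul_inv_cancel₀ (by linarith)] at this
  -- Shifting the index multiplies each Gibbs weight by q, which gives the upward probability λq.
  · refine (hasSum_nat_add_iff' 1).mp ?_
    have := hl.mul_right (boltzmannFactor H T)
    simp only [Finset.sum_range_one, h.zero, one_pow, sub_self, mul_zero, sub_zero]
    exact hasSum_of_forall_eq this fun j => by ring

/-- At infinite temperature, a constant modulus and two alternating phases suffice. -/
theorem mem_bosonicTO_top (hg : IsOrderedEigenbasis H g) {l : ℝ} {c : ℂ}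
    (h : (l, c) ∈ enhancedRegion (boltzmannFactor H ⊤)) :
    canonicalMap g (boltzmannFactor H ⊤) l c ∈ bosonicTO H ⊤ := by
  obtain ⟨E, hE, hgap, hH⟩ := hg.exists_eq
  have hq : boltzmannFactor H ⊤ = 1 := by simp [boltzmannFactor, invTemp]
  rw [hq] at h ⊢
  obtain ⟨h0, h1, hc⟩ := h
  simp only [mul_one] at h0 h1 hc
  -- At q = 1 the bound f(λ) is 1 - λ, the value of s² for constant modulus s.
  have hc' : ‖c‖ ≤ 1 - l := abs_le_of_sq_le_sq' (by nlinarith) (by linarith) |>.2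
  obtain ⟨w, w', hw, hw', hcw⟩ := exists_unit_average hc'
  set s := Real.sqrt (1 - l) with hs
  have hs2 : s ^ 2 = 1 - l := Real.sq_sqrt (by linarith)
  have hs1 : s ≤ 1 := Real.sqrt_le_one.mpr (by linarith)
  have hlad : IsLadder (fun j => if j = 0 then 1 else s) (fun j => if Even j then w else w') :=
    ⟨fun j => by split_ifs; exacts [zero_le_one, Real.sqrt_nonneg _],
      fun j => by split_ifs; exacts [le_rfl, hs1], by simp,
      fun j => by split_ifs; exacts [hw, hw']⟩
  refine ⟨ladderUnitary g hlad, hgap ▸ modeEnergyConserving_ladderUnitary hlad hH,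
    Or.inr ⟨rfl, ?_⟩⟩
  set y : ℕ → ℝ := fun N => ∑ j ∈ Finset.range (N + 1),
    modeUniform N j * (1 - (if j = 0 then 1 else s) ^ 2) with hy
  set d : ℕ → ℂ := fun N => ∑ j ∈ Finset.range (N + 1),
    ((modeUniform N j * ((if j = 0 then 1 else s) * s) : ℝ) : ℂ) *
      (if Even j then w else w') with hd
  have hz (N j : ℕ) (hj : j ∉ Finset.range (N + 1)) : modeUniform N j = 0 := by
    have : ¬ j ≤ N := by simpa [Nat.lt_succ_iff] using hj
    simp [modeUniform, this]
  have hu (N j : ℕ) (hj : j ∈ Finset.range (N + 1)) : modeUniform N j = 1 / ((N : ℝ) + 1) := by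
    have : j ≤ N := Nat.lt_succ_iff.mp (Finset.mem_range.mp hj)
    simp [modeUniform, this]
  have hp (N : ℕ) : HasSum (modeUniform N) 1 := by
    have : HasSum (modeUniform N) _ := hasSum_sum_of_ne_finset_zero (hz N)
    rw [Finset.sum_congr rfl (hu N)] at this
    convert this using 1
    simp
    field_simp
  refine ⟨fun N => covMap g l (y N) (d N), fun N => ?_, ?_⟩
  · refine isModeDilation_ladderUnitary hlad (hp N) ?_ ?_ ?_
    · have := (hp N).mul_right l
      rw [one_mul] at this
      refine hasSum_of_forall_eq this fun j => ?_
      simp [hs2]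
    · exact hasSum_sum_of_ne_finset_zero fun j hj => by simp [hz N j hj]
    · refine hasSum_of_forall_eq (hasSum_sum_of_ne_finset_zero (s := Finset.range (N + 1))
        (f := fun j => ((modeUniform N j * ((if j = 0 then 1 else s) * s) : ℝ) : ℂ) *
          (if Even j then w else w')) fun j hj => ?_) fun j => ?_
      · simp [hz N j hj]
      · simp
  · have hylim : Filter.Tendsto y Filter.atTop (nhds l) := by
      -- The modulus one at level 0 removes one of N + 1 equal contributions, an error that vanishes
      -- in the limit.
      have e (N : ℕ) : y N = l - l * (1 / ((N : ℝ) + 1)) := by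
        rw [hy]
        simp only
        rw [Finset.sum_congr rfl fun j hj => by rw [hu N j hj], ← Finset.mul_sum,
          Finset.sum_range_succ']
        simp [hs2]
        field_simp
        ring
      rw [funext e]
      simpa using tendsto_const_nhds.sub ((tendsto_one_div_add_atTop_nhds_zero_nat (𝕜 := ℝ)).const_mul l)
    have hdlim : Filter.Tendsto d Filter.atTop (nhds c) := by
      -- Apart from a multiple of N + 1, the partial sums consist of a boundary term and a bounded
      -- parity term, both lost after division by N + 1.
      have key (N : ℕ) : ∑ j ∈ Finset.range (N + 1),
          ((((if j = 0 then 1 else s) * s : ℝ) : ℂ) * (if Even j then w else w')) =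
          (s - s ^ 2) * w + s ^ 2 * ((N + 1) * ((w + w') / 2) +
            if Even (N + 1) then 0 else (w - w') / 2) := by
        induction N with
        | zero =>
          simp
          ring
        | succ N ih =>
          rw [Finset.sum_range_succ, ih]
          rcases Nat.even_or_odd (N + 1) with h | h
          · have h' : ¬ Even (N + 1 + 1) := by simpa [Nat.even_add_one] using h
            simp only [h, h', if_true, if_false, Nat.succ_ne_zero]
            push_cast
            ring
          · have h0 : ¬ Even (N + 1) := Nat.not_even_iff_odd.mpr h
            have h' : Even (N + 1 + 1) := h.add_one
            simp only [h0, h', if_true, if_false, Nat.succ_ne_zero]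
            push_cast
            ring
      have hcs : c = s ^ 2 * ((w + w') / 2) := by
        rw [hcw, ← Complex.ofReal_pow, hs2]
        ring
      have e (N : ℕ) : d N - c = ((1 / ((N : ℝ) + 1) : ℝ) : ℂ) * ((s - s ^ 2) * w + s ^ 2 *
          if Even (N + 1) then 0 else (w - w') / 2) := by
        have hN : ((N : ℂ) + 1) ≠ 0 := by exact_mod_cast N.succ_ne_zero
        have : d N = ((1 / ((N : ℝ) + 1) : ℝ) : ℂ) * ∑ j ∈ Finset.range (N + 1),
            ((((if j = 0 then 1 else s) * s : ℝ) : ℂ) * (if Even j then w else w')) := by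
          rw [hd, Finset.mul_sum]
          refine Finset.sum_congr rfl fun j hj => ?_
          rw [hu N j hj, Complex.ofReal_mul, mul_assoc]
        rw [this, key, hcs]
        push_cast
        field_simp
        ring
      rw [tendsto_iff_norm_sub_tendsto_zero]
      refine squeeze_zero (g := fun N : ℕ => (1 / ((N : ℝ) + 1)) *
        (‖((s : ℂ) - s ^ 2) * w‖ + ‖(s : ℂ) ^ 2 * ((w - w') / 2)‖))
        (fun N => norm_nonneg _) (fun N => ?_) ?_
      · rw [e, norm_mul, Complex.norm_real, Real.norm_of_nonneg (by positivity)]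
        gcongr
        refine (norm_add_le _ _).trans ?_
        gcongr
        split_ifs
        · simp
          positivity
        · exact le_rfl
      · have := (tendsto_one_div_add_atTop_nhds_zero_nat (𝕜 := ℝ)).mul_const
          (‖((s : ℂ) - s ^ 2) * w‖ + ‖(s : ℂ) ^ 2 * ((w - w') / 2)‖)
        rwa [zero_mul] at this
    have hcont : Continuous fun p : ℝ × ℂ => covMap g l p.1 p.2 :=
      (continuous_covMap g).comp (f := fun p : ℝ × ℂ => ((l : ℂ), ((p.1 : ℝ) : ℂ), p.2))
        (by fun_prop)
    have := (hcont.tendsto (l, c)).comp (hylim.prodMk_nhds hdlim)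
    simpa [canonicalMap, Function.comp_def] using this

end Bosonic

end ThermalOps

namespace ThermalOps

/-! ### All coherences on the mode for q ≥ 1/2 -/

section Path

variable {q : ℝ}

/-- For `1/2 ≤ q < 1` vectors of lengths `(1 - q) q ^ j` can be arranged to sum to zero. -/
theorem exists_phases_hasSum_zero (hq : 1 / 2 ≤ q) (hq1 : q < 1) :
    ∃ u : ℕ → ℂ, (∀ j, ‖u j‖ = 1) ∧
      HasSum (fun j => (((1 - q) * q ^ j : ℝ) : ℂ) * u j) 0 := by
  have hq0 : 0 < q := by linarith
  -- The weights before K, at K and after K sum to 1 - q^K, (1-q)q^K and q^(K+1). For this K each is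
  -- at most 1/2 and their total is 1, so they are the sides of a triangle, degenerate when one
  -- equals 1/2.
  obtain ⟨K, hK, hK'⟩ : ∃ K : ℕ, q ^ (K + 1) ≤ 1 / 2 ∧ 1 / 2 ≤ q ^ K := by
    classical
    have hex : ∃ K : ℕ, q ^ (K + 1) ≤ 1 / 2 := by
      obtain ⟨n, hn⟩ := exists_pow_lt_of_lt_one (show (0 : ℝ) < 1 / 2 by norm_num) hq1
      exact ⟨n, (pow_le_pow_of_le_one hq0.le hq1.le n.le_succ).trans hn.le⟩
    refine ⟨Nat.find hex, Nat.find_spec hex, ?_⟩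
    rcases h : Nat.find hex with _ | k
    · norm_num
    · exact (not_le.mp (Nat.find_min hex (m := k) (by omega))).le
  have hsucc : q ^ (K + 1) = q ^ K * q := pow_succ q K
  have hKpos : 0 < q ^ K := pow_pos hq0 K
  have hK1 : q ^ K ≤ 1 := pow_le_one₀ hq0.le hq1.le
  obtain ⟨u, v, hu, hv, huv⟩ := exists_phases_triangle (a := 1 - q ^ K) (b := (1 - q) * q ^ K)
    (c := q ^ (K + 1)) (by linarith) (mul_nonneg (by linarith) hKpos.le) (pow_pos hq0 _).le
    (by nlinarith) (by nlinarith) (by nlinarith)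
  refine ⟨fun j => if j < K then 1 else if j = K then u else v, fun j => ?_, ?_⟩
  · simp only
    split_ifs <;> simp [hu, hv]
  · refine (hasSum_nat_add_iff' (K + 1)).mp ?_
    have htail : HasSum (fun j => (((1 - q) * q ^ (j + (K + 1)) : ℝ) : ℂ) * v)
        (((q ^ (K + 1) : ℝ) : ℂ) * v) := by
      refine (Complex.hasSum_ofReal.mpr ?_).mul_right v
      have := (hasSum_geometric_of_lt_one hq0.le hq1).mul_left ((1 - q) * q ^ (K + 1))
      rw [show (1 - q) * q ^ (K + 1) * (1 - q)⁻¹ = q ^ (K + 1) by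
        have : 1 - q ≠ 0 := by linarith
        field_simp] at this
      exact hasSum_of_forall_eq this fun j => by ring
    have hhead : ∑ j ∈ Finset.range (K + 1), (((1 - q) * q ^ j : ℝ) : ℂ) *
        (if j < K then 1 else if j = K then u else v) =
        ((1 - q ^ K : ℝ) : ℂ) + (((1 - q) * q ^ K : ℝ) : ℂ) * u := by
      rw [Finset.sum_range_succ, Finset.sum_congr rfl fun j hj => by
        rw [if_pos (Finset.mem_range.mp hj), mul_one]]
      rw [← Complex.ofReal_sum, ← Finset.mul_sum, mul_neg_geom_sum]
      simp
    rw [hhead, zero_sub, show -(((1 - q ^ K : ℝ) : ℂ) + (((1 - q) * q ^ K : ℝ) : ℂ) * u) =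
      ((q ^ (K + 1) : ℝ) : ℂ) * v by linear_combination -huv]
    refine hasSum_of_forall_eq htail fun j => ?_
    have h1 : ¬ j + (K + 1) < K := by omega
    have h2 : j + (K + 1) ≠ K := by omega
    simp only [h1, h2, if_false]

theorem hasSum_geometric_add_alternating (hq0 : 0 < q) (hq1 : q < 1) (a b : ℝ) :
    HasSum (fun j : ℕ => (1 - q) * q ^ j * (if Even j then a else b)) ((a + q * b) / (1 + q)) := by
  have h1 := (hasSum_geometric_of_lt_one hq0.le hq1).mul_left ((1 - q) * ((a + b) / 2))
  have h2 := (hasSum_geometric_of_abs_lt_one (r := -q) (by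
    rw [abs_neg, abs_of_pos hq0]; exact hq1)).mul_left ((1 - q) * ((a - b) / 2))
  have h := h1.add h2
  rw [show (1 - q) * ((a + b) / 2) * (1 - q)⁻¹ + (1 - q) * ((a - b) / 2) * (1 - -q)⁻¹ =
    (a + q * b) / (1 + q) by
      have : 1 - q ≠ 0 := by linarith
      have : 1 + q ≠ 0 := by linarith
      rw [sub_neg_eq_add]
      field_simp
      ring] at h
  refine hasSum_of_forall_eq h fun j => ?_
  split_ifs with hj
  · rw [hj.neg_pow]
    ring
  · rw [(Nat.not_even_iff_odd.mp hj).neg_pow]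
    ring

/-- For every `λ` there are moduli and phases with `c = 0`. -/
theorem exists_ladder_zero (hq : 1 / 2 ≤ q) (hq1 : q < 1) {l : ℝ} (h0 : 0 ≤ l) (h1 : l ≤ 1) :
    ∃ (σ φ : ℕ → ℝ), (∀ j, 0 ≤ σ j) ∧ (∀ j, σ j ≤ 1) ∧ σ 0 = 1 ∧
      HasSum (fun j => (1 - q) * q ^ j * (1 - σ (j + 1) ^ 2)) l ∧
      HasSum (fun j => (((1 - q) * q ^ j * (σ j * σ (j + 1)) : ℝ) : ℂ) *
        Complex.exp (φ j * Complex.I)) 0 := by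
  have hq0 : 0 < q := by linarith
  rcases le_or_gt (q / (1 + q)) (1 - l) with h | h
  -- Moduli alternating between 1 and x make all products of neighbours equal to x, so the closed
  -- polygon gives c = 0. This covers λ = (1-x²)/(1+q).
  · obtain ⟨u, hu, hsum⟩ := exists_phases_hasSum_zero hq hq1
    rw [div_le_iff₀ (by linarith)] at h
    have hx1 : (1 - l) * (1 + q) - q ≤ 1 := by nlinarith
    set x := Real.sqrt ((1 - l) * (1 + q) - q) with hx
    have hx2 : x ^ 2 = (1 - l) * (1 + q) - q := Real.sq_sqrt (by linarith)
    have hx0 : 0 ≤ x := Real.sqrt_nonneg _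
    have hxle : x ≤ 1 := Real.sqrt_le_one.mpr hx1
    refine ⟨fun j => if Even j then 1 else x, fun j => (u j).arg, fun j => ?_, fun j => ?_,
      by simp, ?_, ?_⟩
    · simp only
      split_ifs
      exacts [zero_le_one, hx0]
    · simp only
      split_ifs
      exacts [le_rfl, hxle]
    · have := hasSum_geometric_add_alternating hq0 hq1 (1 - x ^ 2) 0
      rw [show (1 - x ^ 2 + q * 0) / (1 + q) = l by rw [hx2]; field_simp; ring] at this
      refine hasSum_of_forall_eq this fun j => ?_
      by_cases hj : Even j <;> simp [Nat.even_add_one, hj]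
    · have := hsum.mul_left (x : ℂ)
      rw [mul_zero] at this
      refine hasSum_of_forall_eq this fun j => ?_
      have hexp : Complex.exp ((u j).arg * Complex.I) = u j := by
        have := Complex.norm_mul_exp_arg_mul_I (u j)
        rwa [hu, Complex.ofReal_one, one_mul] at this
      rw [hexp]
      by_cases hj : Even j <;> simp [Nat.even_add_one, hj] <;> ring
  -- For larger λ the odd moduli are set to 0, so all products of neighbours vanish; the even moduli
  -- y after level 0 adjust λ = (1 + q(1-y²))/(1+q).
  · rw [lt_div_iff₀ (by linarith)] at h
    have hy1 : (1 - l) * (1 + q) / q ≤ 1 := by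
      rw [div_le_one hq0]
      exact h.le
    set y := Real.sqrt ((1 - l) * (1 + q) / q) with hy
    have hy2 : y ^ 2 = (1 - l) * (1 + q) / q :=
      Real.sq_sqrt (div_nonneg (mul_nonneg (by linarith) (by linarith)) hq0.le)
    have hy0 : 0 ≤ y := Real.sqrt_nonneg _
    have hyle : y ≤ 1 := Real.sqrt_le_one.mpr hy1
    refine ⟨fun j => if j = 0 then 1 else if Even j then y else 0, fun _ => 0, fun j => ?_,
      fun j => ?_, by simp, ?_, ?_⟩
    · simp only
      split_ifs
      exacts [zero_le_one, hy0, le_rfl]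
    · simp only
      split_ifs
      exacts [le_rfl, hyle, zero_le_one]
    · have := hasSum_geometric_add_alternating hq0 hq1 1 (1 - y ^ 2)
      rw [show (1 + q * (1 - y ^ 2)) / (1 + q) = l by rw [hy2]; field_simp; ring] at this
      refine hasSum_of_forall_eq this fun j => ?_
      by_cases hj : Even j <;> simp [Nat.even_add_one, hj]
    · refine hasSum_of_forall_eq (f := fun _ => 0) hasSum_zero fun j => ?_
      by_cases hj : Even j <;> simp [Nat.even_add_one, hj]
      intro h
      simp [h] at hj

/-- λ is affine in the squares σ_j². Interpolating these squares linearly between the geometric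
moduli and moduli with c = 0 keeps λ fixed while |c| moves continuously from f(λ) to 0, so the
required |c| occurs. A common phase then corrects the argument of c. -/
theorem exists_ladder (hq : 1 / 2 ≤ q) (hq1 : q < 1) {l : ℝ} {c : ℂ}
    (h : (l, c) ∈ enhancedRegion q) :
    ∃ (σ : ℕ → ℝ) (z : ℕ → ℂ), IsLadder σ z ∧
      HasSum (fun j => (1 - q) * q ^ j * (1 - σ (j + 1) ^ 2)) l ∧
      HasSum (fun j => (((1 - q) * q ^ j * (σ j * σ (j + 1)) : ℝ) : ℂ) * z j) c := by
  obtain ⟨h0, h1, hc⟩ := h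
  simp only at h0 h1 hc
  have hq0 : 0 < q := by linarith
  have hlq : 0 < 1 - l * q := by nlinarith
  have hlq' : 1 - l * q ≠ 0 := hlq.ne'
  obtain ⟨σ₁, φ, hn, hle, hz, hl₁, hc₁⟩ := exists_ladder_zero hq hq1 h0 h1
  set k := Real.sqrt ((1 - l) / (1 - l * q)) with hk
  have hk2 : k ^ 2 = (1 - l) / (1 - l * q) := Real.sq_sqrt (div_nonneg (by linarith) hlq.le)
  have hk0 : 0 ≤ k := Real.sqrt_nonneg _
  have hk1 : k ≤ 1 := Real.sqrt_le_one.mpr (by rw [div_le_one hlq]; nlinarith)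
  obtain ⟨hcs, hls⟩ := hasSum_geometric_profile hq0 hq1 hk0 hk1
  have hcancel : (1 - l) / (1 - l * q) * (1 - l * q) = 1 - l := div_mul_cancel₀ _ hlq'
  have hden : 1 - q * k ^ 2 = (1 - q) / (1 - l * q) := by
    rw [hk2, eq_div_iff hlq']
    linear_combination (-q) * hcancel
  have hq1' : 1 - q ≠ 0 := by linarith
  have hdiv (x : ℝ) : (1 - q) * x / ((1 - q) / (1 - l * q)) = x * (1 - l * q) := by
    rw [div_div_eq_mul_div, mul_assoc, mul_div_cancel_left₀ _ hq1']
  rw [hden, hk2, hdiv, hcancel, sub_sub_cancel] at hls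
  rw [hden, hdiv] at hcs
  have hck : ‖c‖ ≤ k * (1 - l * q) := by
    refine abs_le_of_sq_le_sq' ?_ (by positivity) |>.2
    rw [mul_pow, hk2]
    calc ‖c‖ ^ 2 ≤ (1 - l) * (1 - l * q) := hc
      _ = (1 - l) / (1 - l * q) * (1 - l * q) ^ 2 := by rw [sq, ← mul_assoc, hcancel]
  set σ : ℝ → ℕ → ℝ := fun t j => Real.sqrt ((1 - t) * (k ^ j) ^ 2 + t * σ₁ j ^ 2) with hσ
  set w : ℝ → ℕ → ℂ := fun t j => Complex.exp ((t * φ j : ℝ) * Complex.I) with hw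
  have hkj (j : ℕ) : (k ^ j) ^ 2 ≤ 1 := pow_le_one₀ (by positivity) (pow_le_one₀ hk0 hk1)
  have hs1 (j : ℕ) : σ₁ j ^ 2 ≤ 1 := pow_le_one₀ (hn j) (hle j)
  have hσ2 {t : ℝ} (ht : t ∈ Set.Icc (0 : ℝ) 1) (j : ℕ) :
      σ t j ^ 2 = (1 - t) * (k ^ j) ^ 2 + t * σ₁ j ^ 2 :=
    Real.sq_sqrt (add_nonneg (mul_nonneg (by linarith [ht.2]) (sq_nonneg _))
      (mul_nonneg ht.1 (sq_nonneg _)))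
  have hσ0 (t : ℝ) (j : ℕ) : 0 ≤ σ t j := Real.sqrt_nonneg _
  have hσ1 {t : ℝ} (ht : t ∈ Set.Icc (0 : ℝ) 1) (j : ℕ) : σ t j ≤ 1 := by
    refine Real.sqrt_le_one.mpr ?_
    have := mul_le_mul_of_nonneg_left (hkj j) (sub_nonneg.mpr ht.2)
    have := mul_le_mul_of_nonneg_left (hs1 j) ht.1
    linarith
  have hwn (t : ℝ) (j : ℕ) : ‖w t j‖ = 1 := Complex.norm_exp_ofReal_mul_I _
  have hgeo : HasSum (fun j => (1 - q) * q ^ j) 1 := by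
    have := (hasSum_geometric_of_lt_one hq0.le hq1).mul_left (1 - q)
    rwa [mul_inv_cancel₀ hq1'] at this
  have hbound {t : ℝ} (ht : t ∈ Set.Icc (0 : ℝ) 1) (j : ℕ) :
      ‖(((1 - q) * q ^ j * (σ t j * σ t (j + 1)) : ℝ) : ℂ) * w t j‖ ≤ (1 - q) * q ^ j := by
    have hp : 0 ≤ (1 - q) * q ^ j := mul_nonneg (by linarith) (pow_pos hq0 j).le
    rw [norm_mul, hwn, mul_one, Complex.norm_real, Real.norm_of_nonneg
      (mul_nonneg hp (mul_nonneg (hσ0 t j) (hσ0 t (j + 1))))]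
    exact mul_le_of_le_one_right hp (mul_le_one₀ (hσ1 ht j) (hσ0 t _) (hσ1 ht _))
  set C : ℝ → ℂ := fun t => ∑' j, (((1 - q) * q ^ j * (σ t j * σ t (j + 1)) : ℝ) : ℂ) * w t j
    with hC
  have hCsum {t : ℝ} (ht : t ∈ Set.Icc (0 : ℝ) 1) :
      HasSum (fun j => (((1 - q) * q ^ j * (σ t j * σ t (j + 1)) : ℝ) : ℂ) * w t j) (C t) :=
    (Summable.of_norm_bounded hgeo.summable (hbound ht)).hasSum
  -- Each term is continuous in t and dominated by its Gibbs weight, so the series converges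
  -- uniformly.
  have hcont : ContinuousOn (fun t => ‖C t‖) (Set.Icc 0 1) := by
    refine ContinuousOn.norm (continuousOn_tsum (fun j => Continuous.continuousOn ?_)
      hgeo.summable fun j t ht => hbound ht j)
    simp only [hσ, hw]
    fun_prop
  have hC0 : C 0 = ((k * (1 - l * q) : ℝ) : ℂ) := by
    refine (hCsum ⟨le_rfl, zero_le_one⟩).unique ?_
    refine hasSum_of_forall_eq (Complex.hasSum_ofReal.mpr hcs) fun j => ?_
    simp [hσ, hw, Real.sqrt_sq (pow_nonneg hk0 _)]
  have hC1 : C 1 = 0 := by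
    refine (hCsum ⟨zero_le_one, le_rfl⟩).unique ?_
    refine hasSum_of_forall_eq hc₁ fun j => ?_
    simp [hσ, hw, Real.sqrt_sq (hn _)]
  obtain ⟨t, ht, hCt⟩ := intermediate_value_Icc' zero_le_one hcont
    (show ‖c‖ ∈ Set.Icc ‖C 1‖ ‖C 0‖ by
      rw [hC0, hC1, norm_zero, Complex.norm_real, Real.norm_of_nonneg (by positivity)]
      exact ⟨norm_nonneg c, hck⟩)
  replace hCt : ‖C t‖ = ‖c‖ := hCt
  obtain ⟨u, hu, hcu⟩ := exists_unit_mul_norm c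
  obtain ⟨v, hv, hcv⟩ := exists_unit_mul_norm (C t)
  have hv0 : v ≠ 0 := by
    rintro rfl
    simp at hv
  refine ⟨σ t, fun j => w t j * (u / v), ⟨hσ0 t, hσ1 ht, ?_, fun j => ?_⟩, ?_, ?_⟩
  · simp [hσ, hz]
  · rw [norm_mul, hwn, norm_div, hu, hv]
    norm_num
  · have := (hls.mul_left (1 - t)).add (hl₁.mul_left t)
    rw [← add_mul, sub_add_cancel, one_mul] at this
    refine hasSum_of_forall_eq this fun j => ?_
    rw [hσ2 ht]
    ring
  · have := (hCsum ht).mul_right (u / v)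
    rw [hcv, hCt, mul_assoc, mul_div_cancel₀ u hv0, ← hcu] at this
    exact hasSum_of_forall_eq this fun j => by ring

end Path

/-! ### The bosonic threshold -/

section BosonicThreshold

variable {H : Matrix (Fin 2) (Fin 2) ℂ} {g : QubitBasis} {T : ℝ≥0∞}

theorem EnTO_subset_bosonicTO (hg : IsOrderedEigenbasis H g) (hT : 0 < T)
    (hq : 1 / 2 ≤ boltzmannFactor H T) : EnTO H T ⊆ bosonicTO H T := by
  intro S hS
  obtain ⟨⟨l, c⟩, hx, rfl⟩ := (mem_EnTO_iff hg).mp hS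
  rcases eq_or_ne T ⊤ with rfl | hT'
  · exact mem_bosonicTO_top hg hx
  · have hT' := lt_top_iff_ne_top.mpr hT'
    obtain ⟨σ, z, h, hl, hc⟩ := exists_ladder hq (hg.boltzmannFactor_lt_one hT hT') hx
    exact mem_bosonicTO_of_lt_top hg hT hT' h hl hc

theorem not_EnTO_subset_bosonicTO (hg : IsOrderedEigenbasis H g) (hT : 0 < T) (hT' : T < ⊤)
    (hq : boltzmannFactor H T < 1 / 2) : ¬ EnTO H T ⊆ bosonicTO H T := by
  intro h
  have h0 : canonicalMap g (boltzmannFactor H T) 0 0 ∈ EnTO H T :=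
    (canonicalMap_mem_EnTO_iff hg).mpr ⟨le_rfl, zero_le_one, by simp⟩
  have := one_sub_two_mul_le_of_mem_bosonicTO hg hT hT' (h h0)
  rw [Psi_canonicalMap] at this
  simp at this
  linarith

theorem volume_image_diff_bosonicTO_pos (hg : IsOrderedEigenbasis H g) (hT : 0 < T) (hT' : T < ⊤)
    (hq : boltzmannFactor H T < 1 / 2) :
    0 < MeasureTheory.volume (Psi g '' (EnTO H T \ bosonicTO H T)) := by
  set q := boltzmannFactor H T with hqdef
  have hq0 : 0 < q := boltzmannFactor_pos H T
  set δ := (1 - 2 * q) / 2 with hδ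
  have hδ0 : 0 < δ := by linarith
  -- On this box λ + |c| < 2δ = 1 - 2q, which no map realized by the mode satisfies. The radius 1/4
  -- keeps the box inside the enhanced region.
  let O : Set (ℝ × ℂ) := Set.Ioo 0 δ ×ˢ Metric.ball 0 (min δ (1 / 4))
  have hO : IsOpen O := isOpen_Ioo.prod Metric.isOpen_ball
  have hne : O.Nonempty := ⟨(δ / 2, 0), ⟨by simp only; constructor <;> linarith, by
    simp [hδ0]⟩⟩
  refine (hO.measure_pos MeasureTheory.volume hne).trans_le (MeasureTheory.measure_mono ?_)
  rintro ⟨l, c⟩ ⟨⟨hl0, hlδ⟩, hc⟩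
  simp only [mem_ball_zero_iff, lt_min_iff] at hl0 hlδ hc
  refine ⟨canonicalMap g q l c, ⟨(canonicalMap_mem_EnTO_iff hg).mpr ⟨hl0.le, ?_, ?_⟩, fun hb => ?_⟩,
    Psi_canonicalMap g q l c⟩
  · simp only
    linarith
  · simp only
    have : l * q ≤ 1 / 4 := by nlinarith
    have : ‖c‖ ^ 2 ≤ 1 / 16 := by nlinarith [norm_nonneg c]
    nlinarith
  · have := one_sub_two_mul_le_of_mem_bosonicTO hg hT hT' hb
    rw [Psi_canonicalMap, ← hqdef] at this
    simp only at this
    linarith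

end BosonicThreshold

end ThermalOps

theorem theorem1 (HS : Matrix (Fin 2) (Fin 2) ℂ) (hHS : HS.IsHermitian)
    (T : ℝ≥0∞) (hT : 0 < T) :
    -- (i)
    closure (TO HS T) = EnTO HS T ∧
    (NonDegenerate HS →
      -- the parametrization of the enhanced thermal operations
      (∀ g : QubitBasis, IsOrderedEigenbasis HS g →
        (∀ S : Superop (Fin 2), S ∈ EnTO HS T ↔
          ∃ l ∈ Set.Icc (0 : ℝ) 1, ∃ r ∈ Set.Icc 0 (maxRadius HS T l),
            ∃ φ ∈ Set.Ico (-Real.pi) Real.pi, choi g S = canonicalChoi HS T l (polar r φ)) ∧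
        Set.InjOn (Psi g) (PsiDomain HS T g) ∧
        Set.BijOn (Psi g) (EnTO HS T)
          {x | x.1 ∈ Set.Icc (0 : ℝ) 1 ∧ ‖x.2‖ ≤ maxRadius HS T x.1}) ∧
      -- (ii)
      (Convex ℝ (TO HS T) ∧
        ∀ g : QubitBasis, IsOrderedEigenbasis HS g →
          TO HS T = EnTO HS T \ PsiPreimage HS T g
            {x | ∃ l ∈ Set.Ioc (0 : ℝ) 1, ∃ φ ∈ Set.Ico (-Real.pi) Real.pi,
              x = (l, polar (maxRadius HS T l) φ)} ∧
          (∀ S ∈ EnTO HS T, S ∈ TO HS T ↔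
            (Psi g S).1 = 0 ∨ S ∈ relInterior (PsiDomain HS T g) (EnTO HS T)) ∧
          EnTO HS T \ TO HS T ⊆ relFrontier (PsiDomain HS T g) (EnTO HS T)) ∧
      -- (iii)
      ((truncatedSemigroup HS T = TO HS T ↔ ENNReal.ofReal (energyGap HS / Real.log 2) < T) ∧
        (∀ g : QubitBasis, IsOrderedEigenbasis HS g →
          symmDiff (truncatedSemigroup HS T) (TO HS T) ⊆
            PsiPreimage HS T g {x | x.1 ∈ Set.Icc (0 : ℝ) 1 ∧ x.2 = 0}) ∧
        closure (truncatedSemigroup HS T) = closure (TO HS T)) ∧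
      -- (iv)
      ((EnTO HS T ⊆ bosonicTO HS T ↔ ENNReal.ofReal (energyGap HS / Real.log 2) ≤ T) ∧
        (T < ENNReal.ofReal (energyGap HS / Real.log 2) →
          ∀ g : QubitBasis, IsOrderedEigenbasis HS g →
            0 < MeasureTheory.volume (Psi g '' (EnTO HS T \ bosonicTO HS T)) ∧
            ∃ l₀ > (0 : ℝ), ∃ r₀ > (0 : ℝ), ∀ S ∈ bosonicTO HS T,
              (Psi g S).1 ≤ l₀ → r₀ ≤ ‖(Psi g S).2‖))) := by
  refine ⟨closure_TO_eq_EnTO hHS T, fun hd => ?_⟩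
  obtain ⟨g₀, hg₀⟩ := exists_isOrderedEigenbasis hHS hd
  have hΔ := hg₀.energyGap_pos
  refine ⟨fun g hg => ⟨mem_EnTO_iff_choi hg, injOn_Psi HS T g, bijOn_Psi hg⟩,
    ⟨convex_TO hg₀ T, fun g hg => ⟨TO_eq_diff hg, fun S hS => mem_TO_iff_relInterior hg hS,
      EnTO_diff_TO_subset_relFrontier hg⟩⟩,
    ⟨?_, fun g hg => symmDiff_truncatedSemigroup_TO_subset hg, closure_truncatedSemigroup hg₀⟩,
    ⟨?_, fun hlt g hg => ?_⟩⟩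
  · rw [ofReal_div_log_two_lt_iff hΔ hT]
    refine ⟨fun h => ?_, truncatedSemigroup_eq_TO_of_half_lt hg₀⟩
    by_contra hq
    exact truncatedSemigroup_ne_TO hg₀ (not_lt.mp hq) h
  · rw [← not_lt, lt_ofReal_div_log_two_iff hT]
    constructor
    · intro h hq
      exact not_EnTO_subset_bosonicTO hg₀ hT
        (((lt_ofReal_div_log_two_iff hT).mpr hq).trans ENNReal.ofReal_lt_top) hq h
    · exact fun hq => EnTO_subset_bosonicTO hg₀ hT (not_lt.mp hq)
  · have hT' : T < ⊤ := hlt.trans ENNReal.ofReal_lt_top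
    have hq : boltzmannFactor HS T < 1 / 2 := (lt_ofReal_div_log_two_iff hT).mp hlt
    -- Half of the lower bound 1 - 2q on |c| + λ is assigned to each of λ₀ and r₀.
    refine ⟨volume_image_diff_bosonicTO_pos hg hT hT' hq, (1 - 2 * boltzmannFactor HS T) / 2,
      by linarith, (1 - 2 * boltzmannFactor HS T) / 2, by linarith, fun S hS hl => ?_⟩
    have := one_sub_two_mul_le_of_mem_bosonicTO hg hT hT' hS
    linarith
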